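/- Let $M$ be a smooth manifold and $(\mathcal A,\rho,[\,,])$ a Lie algebroid over $M$, i.e. a smooth vector bundle $\mathcal A\to M$ of finite rank with a Lie bracket on $\Gamma(\mathcal A)$ and a bundle map $\rho:\mathcal A\to TM$ such that $\rho[s,t]=[\rho s,\rho t]$ and $[s,ft]=f[s,t]+(\rho(s)f)\,t$. Let $(\omega,J,g)$ be a compatible triple on $\mathcal A$: $\omega$ is a nondegenerate $2$-form on $\mathcal A$ with $d_{\mathcal A}\omega=0$, $J$ is a bundle endomorphism with $J^2=-\mathrm{id}$, $g$ is a Riemannian metric on the bundle $\mathcal A$, and $g(Ja,Jb)=g(a,b)$, $\omega(a,b)=g(a,Jb)$. For $p\in M$ put $$L_p=\ker\rho_p,\quad L^1_p=L_p\cap L_p^{\omega},\quad L^2_p=(L^1_p)^{\perp_g}\cap L_p,\quad E^1_p=J(L^1_p),\quad E^2_p=(L_p+E^1_p)^{\omega},$$ where $S^\omega$ denotes the $\omega$-complement of $S$. Then $\mathcal A_p=(E^1_p\oplus E^2_p)\oplus(L^1_p\oplus L^2_p)$ with $L^1_p\oplus L^2_p=L_p$. Let $N$ be a leaf of the characteristic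 foliation of $\mathcal A$, that is, a maximal connected (injectively immersed) integral submanifold of the generalized distribution $\rho(\mathcal A)\subseteq TM$. (a) The restricted bundle $\mathcal A_N$ has exactly one Lie algebroid structure $(\rho_N,[\,,]_N)$ over $N$ whose anchor is $\rho$ with values in $TN$ and for which $[s|_N,t|_N]_N=[s,t]|_N$ for all $s,t\in\Gamma(\mathcal A)$; the restriction $\omega_N$ of $\omega$ is a symplectic form on it. (b) Each $f\in C^\infty(N)$ has exactly one Hamiltonian section $a_f\in\Gamma(\mathcal A_N)$, defined by $df(\rho_N(b))=\omega_N(a_f,b)$ for all $b$, and there is exactly one Poisson structure (bivector field) $\pi$ on $N$ with $\pi(df,dh)=\{f,h\}=\omega_N(a_f,a_h)$ for all $f,h\in C^\infty(N)$. With $\pi^\sharp(\alpha)=\pi(\alpha,\cdot)$ and $[\alpha,\beta]_\pi=\mathcal L_{\pi^\sharp\alpha}\beta-\mathcal L_{\pi^\sharp\beta}\alpha-d(\pi(\alpha,\beta))$, $(T^*N,\pi^\sharp,[\,,]_\pi)$ is a Lie algebroid over $N$. (c) For each $x\in N$ let $\lambda_x:T_xN\to\mathcal A_x$ be the unique linear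 map with $\rho_N\circ\lambda_x=\mathrm{id}$ and values in $E^1_x+E^2_x$. Then $(E^2+L^1)_N$ is a smooth vector subbundle of $\mathcal A_N$ whose sections are closed under $[\,,]_N$, hence a Lie subalgebroid of $\mathcal A_N$, and $$\psi:(E^2+L^1)_N\to T^*N,\qquad \psi(a)=-\lambda^*(i_a\omega)=-\omega(a,\lambda(\cdot)),$$ is an isomorphism of Lie algebroids over $N$ from $(E^2+L^1)_N$ onto $(T^*N,\pi^\sharp,[\,,]_\pi)$: a smooth vector bundle isomorphism over $\mathrm{id}_N$ with $\pi^\sharp\circ\psi=\rho_N$ and $\psi([a,b]_N)=[\psi(a),\psi(b)]_\pi$ for all smooth sections $a,b$ of $(E^2+L^1)_N$. -/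

import Mathlib

open Bundle VectorField Set Filter Topology
open scoped Manifold ContDiff

universe u v

noncomputable section

/-! ### Pullback bundles: fibrewise instances -/

instance pullbackFiberAddCommGroup {B B' : Type*} (f : B' → B) (V : B → Type*)
    [∀ x, AddCommGroup (V x)] (x : B') : AddCommGroup ((f *ᵖ V) x) :=
  inferInstanceAs (AddCommGroup (V (f x)))

instance pullbackFiberIsTopologicalAddGroup {B B' : Type*} (f : B' → B) (V : B → Type*)
    [∀ x, AddCommGroup (V x)] [∀ x, TopologicalSpace (V x)]
    [∀ x, IsTopologicalAddGroup (V x)] (x : B') : IsTopologicalAddGroup ((f *ᵖ V) x) :=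
  inferInstanceAs (IsTopologicalAddGroup (V (f x)))

instance pullbackFiberContinuousSMul {B B' : Type*} (f : B' → B) (V : B → Type*)
    [∀ x, AddCommGroup (V x)] [∀ x, Module ℝ (V x)] [∀ x, TopologicalSpace (V x)]
    [∀ x, ContinuousSMul ℝ (V x)] (x : B') : ContinuousSMul ℝ ((f *ᵖ V) x) :=
  inferInstanceAs (ContinuousSMul ℝ (V (f x)))

/-! ### Lie algebroids -/

section LieAlgebroid

variable (E : Type*) [NormedAddCommGroup E] [NormedSpace ℝ E]
  {M : Type*} [TopologicalSpace M] [ChartedSpace E M] [IsManifold 𝓘(ℝ, E) ∞ M]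
  (F : Type*) [NormedAddCommGroup F] [NormedSpace ℝ F]
  (V : M → Type*) [TopologicalSpace (TotalSpace F V)]
  [∀ x, AddCommGroup (V x)] [∀ x, Module ℝ (V x)] [∀ x, TopologicalSpace (V x)]
  [∀ x, IsTopologicalAddGroup (V x)] [∀ x, ContinuousSMul ℝ (V x)]
  [FiberBundle F V] [VectorBundle ℝ F V] [ContMDiffVectorBundle ∞ F V 𝓘(ℝ, E)]

/-- A Lie algebroid structure on the smooth vector bundle `V → M` (with model fibre `F`, over a
manifold modelled on `E`): an anchor `V → TM` and a Lie bracket on the smooth sections. -/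
structure LieAlgebroid where
  /-- The anchor, a smooth vector bundle map `V → TM` over the identity. -/
  anchor (x : M) : V x →L[ℝ] TangentSpace 𝓘(ℝ, E) x
  anchor_contMDiff : ContMDiff 𝓘(ℝ, E) (𝓘(ℝ, E).prod 𝓘(ℝ, F →L[ℝ] E)) ∞
    (fun x ↦ TotalSpace.mk' (F →L[ℝ] E) (E := fun x ↦ V x →L[ℝ] TangentSpace 𝓘(ℝ, E) x)
      x (anchor x))
  /-- The bracket of smooth sections. -/
  bracket : Cₛ^∞⟮𝓘(ℝ, E); F, V⟯ →ₗ[ℝ] Cₛ^∞⟮𝓘(ℝ, E); F, V⟯ →ₗ[ℝ] Cₛ^∞⟮𝓘(ℝ, E); F, V⟯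
  bracket_self (s : Cₛ^∞⟮𝓘(ℝ, E); F, V⟯) : bracket s s = 0
  jacobi (s t w : Cₛ^∞⟮𝓘(ℝ, E); F, V⟯) :
    bracket s (bracket t w) = bracket (bracket s t) w + bracket t (bracket s w)
  anchor_bracket (s t : Cₛ^∞⟮𝓘(ℝ, E); F, V⟯) (x : M) :
    anchor x (bracket s t x) =
      mlieBracket 𝓘(ℝ, E) (fun y ↦ anchor y (s y)) (fun y ↦ anchor y (t y)) x
  /-- `[s, f t] = f [s, t] + (ρ(s) f) t`, the section `f t` being called `ft`. -/
  leibniz (s t ft : Cₛ^∞⟮𝓘(ℝ, E); F, V⟯) (f : M → ℝ) (hf : ContMDiff 𝓘(ℝ, E) 𝓘(ℝ, ℝ) ∞ f)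
    (hft : ∀ x, ft x = f x • t x) (x : M) :
    bracket s ft x = f x • bracket s t x + mvfderiv 𝓘(ℝ, E) f x (anchor x (s x)) • t x

variable {E F V}

/-- A symplectic form on a Lie algebroid: a smooth, fibrewise alternating and nondegenerate
2-form whose Lie algebroid differential vanishes. -/
structure SymplecticForm (𝒜 : LieAlgebroid E F V) where
  form (x : M) : V x →L[ℝ] V x →L[ℝ] ℝ
  contMDiff : ContMDiff 𝓘(ℝ, E) (𝓘(ℝ, E).prod 𝓘(ℝ, F →L[ℝ] F →L[ℝ] ℝ)) ∞
    (fun x ↦ TotalSpace.mk' (F →L[ℝ] F →L[ℝ] ℝ) (E := fun x ↦ V x →L[ℝ] V x →L[ℝ] ℝ)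
      x (form x))
  alternating (x : M) (a : V x) : form x a a = 0
  nondegenerate (x : M) (a : V x) (h : ∀ b, form x a b = 0) : a = 0
  closed (s₀ s₁ s₂ : Cₛ^∞⟮𝓘(ℝ, E); F, V⟯) (x : M) :
    mvfderiv 𝓘(ℝ, E) (fun y ↦ form y (s₁ y) (s₂ y)) x (𝒜.anchor x (s₀ x))
      - mvfderiv 𝓘(ℝ, E) (fun y ↦ form y (s₀ y) (s₂ y)) x (𝒜.anchor x (s₁ x))
      + mvfderiv 𝓘(ℝ, E) (fun y ↦ form y (s₀ y) (s₁ y)) x (𝒜.anchor x (s₂ x))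
      - form x (𝒜.bracket s₀ s₁ x) (s₂ x) + form x (𝒜.bracket s₀ s₂ x) (s₁ x)
      - form x (𝒜.bracket s₁ s₂ x) (s₀ x) = 0

/-- A compatible triple `(ω, J, g)` on a Lie algebroid. -/
structure CompatibleTriple (𝒜 : LieAlgebroid E F V) where
  /-- The symplectic form `ω`. -/
  Ω : SymplecticForm 𝒜
  /-- The almost complex structure. -/
  J (x : M) : V x →L[ℝ] V x
  J_contMDiff : ContMDiff 𝓘(ℝ, E) (𝓘(ℝ, E).prod 𝓘(ℝ, F →L[ℝ] F)) ∞
    (fun x ↦ TotalSpace.mk' (F →L[ℝ] F) (E := fun x ↦ V x →L[ℝ] V x) x (J x))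
  J_J (x : M) (a : V x) : J x (J x a) = -a
  /-- The Riemannian metric on the bundle `V`. -/
  g : ContMDiffRiemannianMetric 𝓘(ℝ, E) ∞ F V
  g_J_J (x : M) (a b : V x) : g.inner x (J x a) (J x b) = g.inner x a b
  form_eq (x : M) (a b : V x) : Ω.form x a b = g.inner x a (J x b)

/-- The `ω`-complement `S^ω` of a subspace `S` of the fibre at `x`. -/
def SymplecticForm.compl {𝒜 : LieAlgebroid E F V} (Ω : SymplecticForm 𝒜) {x : M}
    (S : Submodule ℝ (V x)) : Submodule ℝ (V x) where
  carrier := {a | ∀ b ∈ S, Ω.form x a b = 0}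
  add_mem' := fun ha hb c hc ↦ by simp [ha c hc, hb c hc]
  zero_mem' := fun c _ ↦ by simp
  smul_mem' := fun r a ha c hc ↦ by simp [ha c hc]

/-- `L_x`, the kernel of the anchor at `x`. -/
def LieAlgebroid.isotropy (𝒜 : LieAlgebroid E F V) (x : M) : Submodule ℝ (V x) :=
  LinearMap.ker (𝒜.anchor x : V x →ₗ[ℝ] TangentSpace 𝓘(ℝ, E) x)

namespace CompatibleTriple

variable {𝒜 : LieAlgebroid E F V} (T : CompatibleTriple 𝒜) (x : M)

/-- `L¹ = L ∩ L^ω`. -/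
def L1 : Submodule ℝ (V x) := 𝒜.isotropy x ⊓ T.Ω.compl (𝒜.isotropy x)

/-- `L²`, the `g`-orthogonal complement of `L¹` inside `L`. -/
def L2 : Submodule ℝ (V x) where
  carrier := {a | a ∈ 𝒜.isotropy x ∧ ∀ b ∈ T.L1 x, T.g.inner x a b = 0}
  add_mem' := fun ha hb ↦ ⟨add_mem ha.1 hb.1, fun c hc ↦ by simp [ha.2 c hc, hb.2 c hc]⟩
  zero_mem' := ⟨zero_mem _, fun c _ ↦ by simp⟩
  smul_mem' := fun r a ha ↦ ⟨Submodule.smul_mem _ r ha.1, fun c hc ↦ by simp [ha.2 c hc]⟩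

/-- `E¹ = J(L¹)`. -/
def E1 : Submodule ℝ (V x) := (T.L1 x).map (T.J x : V x →ₗ[ℝ] V x)

/-- `E² = (L + E¹)^ω`. -/
def E2 : Submodule ℝ (V x) := T.Ω.compl (𝒜.isotropy x ⊔ T.E1 x)

/-- The direct sum decomposition `V_x = (E¹ ⊕ E²) ⊕ (L¹ ⊕ L²)` with `L¹ ⊕ L² = L`. -/
structure HasDecomposition : Prop where
  disjoint_E : Disjoint (T.E1 x) (T.E2 x)
  disjoint_L : Disjoint (T.L1 x) (T.L2 x)
  sup_L : T.L1 x ⊔ T.L2 x = 𝒜.isotropy x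
  isCompl : IsCompl (T.E1 x ⊔ T.E2 x) (𝒜.isotropy x)

end CompatibleTriple

/-- `S` is a smooth vector subbundle of `V`: near every point its fibres have a frame of smooth
sections of `V`. -/
def IsSmoothSubbundle (E : Type*) [NormedAddCommGroup E] [NormedSpace ℝ E]
    {M : Type*} [TopologicalSpace M] [ChartedSpace E M]
    (F : Type*) [NormedAddCommGroup F] [NormedSpace ℝ F]
    {V : M → Type*} [TopologicalSpace (TotalSpace F V)]
    [∀ x, AddCommGroup (V x)] [∀ x, Module ℝ (V x)] [∀ x, TopologicalSpace (V x)]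
    [FiberBundle F V] (S : ∀ x, Submodule ℝ (V x)) : Prop :=
  ∀ x₀ : M, ∃ (k : ℕ) (e : Fin k → Cₛ^∞⟮𝓘(ℝ, E); F, V⟯), ∀ᶠ x in 𝓝 x₀,
    LinearIndependent ℝ (fun i ↦ e i x) ∧ Submodule.span ℝ (range fun i ↦ e i x) = S x

/-- `S` is a Lie subalgebroid of `𝒜` over the same base; it is then itself a Lie algebroid with
the restricted anchor and bracket. -/
structure LieAlgebroid.IsSubalgebroid (𝒜 : LieAlgebroid E F V) (S : ∀ x, Submodule ℝ (V x)) :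
    Prop where
  isSmoothSubbundle : IsSmoothSubbundle E F S
  bracket_mem (s t : Cₛ^∞⟮𝓘(ℝ, E); F, V⟯) (hs : ∀ x, s x ∈ S x) (ht : ∀ x, t x ∈ S x) (x : M) :
    𝒜.bracket s t x ∈ S x

/-- The restriction of the fibrewise linear map `ψ` to the Lie subalgebroid `S` of `𝒜` is an
isomorphism of Lie algebroids over the identity of `M` from `S` onto `ℬ`: a fibrewise linear
bijection, smooth with smooth inverse (it matches the smooth local sections of `S` with those
of `W`), which respects the anchors and the brackets. -/
structure LieAlgebroid.IsIsoOnSubalgebroid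
    {G : Type*} [NormedAddCommGroup G] [NormedSpace ℝ G]
    {W : M → Type*} [TopologicalSpace (TotalSpace G W)]
    [∀ x, AddCommGroup (W x)] [∀ x, Module ℝ (W x)] [∀ x, TopologicalSpace (W x)]
    [∀ x, IsTopologicalAddGroup (W x)] [∀ x, ContinuousSMul ℝ (W x)]
    [FiberBundle G W] [VectorBundle ℝ G W] [ContMDiffVectorBundle ∞ G W 𝓘(ℝ, E)]
    (𝒜 : LieAlgebroid E F V) (S : ∀ x, Submodule ℝ (V x)) (ℬ : LieAlgebroid E G W)
    (ψ : ∀ x, V x →ₗ[ℝ] W x) : Prop where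
  isSubalgebroid : 𝒜.IsSubalgebroid S
  bijective (x : M) : Function.Bijective ((ψ x).domRestrict (S x))
  contMDiffOn_iff (U : Set M) (hU : IsOpen U) (s : ∀ x, V x) (hs : ∀ x ∈ U, s x ∈ S x) :
    ContMDiffOn 𝓘(ℝ, E) (𝓘(ℝ, E).prod 𝓘(ℝ, F)) ∞ (fun x ↦ TotalSpace.mk' F x (s x)) U ↔
      ContMDiffOn 𝓘(ℝ, E) (𝓘(ℝ, E).prod 𝓘(ℝ, G)) ∞ (fun x ↦ TotalSpace.mk' G x (ψ x (s x))) U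
  anchor_eq (x : M) (a : V x) (ha : a ∈ S x) : ℬ.anchor x (ψ x a) = 𝒜.anchor x a
  bracket_eq (s t : Cₛ^∞⟮𝓘(ℝ, E); F, V⟯) (hs : ∀ x, s x ∈ S x) (ht : ∀ x, t x ∈ S x)
    (α β : Cₛ^∞⟮𝓘(ℝ, E); G, W⟯) (hα : ∀ x, α x = ψ x (s x)) (hβ : ∀ x, β x = ψ x (t x))
    (x : M) : ℬ.bracket α β x = ψ x (𝒜.bracket s t x)

end LieAlgebroid

/-! ### Poisson structures and the cotangent Lie algebroid -/

section Poisson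

variable (E : Type*) [NormedAddCommGroup E] [NormedSpace ℝ E]
  (M : Type*) [TopologicalSpace M] [ChartedSpace E M] [IsManifold 𝓘(ℝ, E) ∞ M]

/-- A Poisson structure on `M`, given by its bivector field `π`; the Poisson bracket is
`{f, g} = π(df, dg)`. -/
structure PoissonStructure where
  bivector (x : M) : (TangentSpace 𝓘(ℝ, E) x →L[ℝ] ℝ) →L[ℝ] (TangentSpace 𝓘(ℝ, E) x →L[ℝ] ℝ) →L[ℝ] ℝ
  /-- Smoothness: `π(α, β)` is a smooth function for all smooth 1-forms `α`, `β`. -/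
  contMDiff
    (α β : Cₛ^∞⟮𝓘(ℝ, E); E →L[ℝ] ℝ, (fun x : M ↦ TangentSpace 𝓘(ℝ, E) x →L[ℝ] ℝ)⟯) :
    ContMDiff 𝓘(ℝ, E) 𝓘(ℝ, ℝ) ∞ (fun x ↦ bivector x (α x) (β x))
  alternating (x : M) (α : TangentSpace 𝓘(ℝ, E) x →L[ℝ] ℝ) : bivector x α α = 0
  jacobi (f g h : M → ℝ) (hf : ContMDiff 𝓘(ℝ, E) 𝓘(ℝ, ℝ) ∞ f)
    (hg : ContMDiff 𝓘(ℝ, E) 𝓘(ℝ, ℝ) ∞ g) (hh : ContMDiff 𝓘(ℝ, E) 𝓘(ℝ, ℝ) ∞ h) (x : M) :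
    bivector x (mvfderiv 𝓘(ℝ, E) f x) (mvfderiv 𝓘(ℝ, E)
        (fun y ↦ bivector y (mvfderiv 𝓘(ℝ, E) g y) (mvfderiv 𝓘(ℝ, E) h y)) x)
      + bivector x (mvfderiv 𝓘(ℝ, E) g x) (mvfderiv 𝓘(ℝ, E)
        (fun y ↦ bivector y (mvfderiv 𝓘(ℝ, E) h y) (mvfderiv 𝓘(ℝ, E) f y)) x)
      + bivector x (mvfderiv 𝓘(ℝ, E) h x) (mvfderiv 𝓘(ℝ, E)
        (fun y ↦ bivector y (mvfderiv 𝓘(ℝ, E) f y) (mvfderiv 𝓘(ℝ, E) g y)) x) = 0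

variable {E M}

/-- `(ℒ_Y β)(X) = Y(β(X)) - β([Y, X])` at `x`, for vector fields `X`, `Y` and a 1-form `β`. -/
def lieDerivOneForm (Y : ∀ x : M, TangentSpace 𝓘(ℝ, E) x)
    (β : ∀ x : M, TangentSpace 𝓘(ℝ, E) x →L[ℝ] ℝ) (X : ∀ x : M, TangentSpace 𝓘(ℝ, E) x)
    (x : M) : ℝ :=
  mvfderiv 𝓘(ℝ, E) (fun y ↦ β y (X y)) x (Y x) - β x (mlieBracket 𝓘(ℝ, E) Y X x)

/-- `𝒞` is the cotangent Lie algebroid `(T*M, π^♯, [ , ]_π)` of the Poisson structure `π`, where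
`π^♯ α = π(α, ·)` and `[α, β]_π = ℒ_{π^♯ α} β - ℒ_{π^♯ β} α - d(π(α, β))`. -/
structure LieAlgebroid.IsCotangent
    (𝒞 : LieAlgebroid E (E →L[ℝ] ℝ) (fun x : M ↦ TangentSpace 𝓘(ℝ, E) x →L[ℝ] ℝ))
    (P : PoissonStructure E M) : Prop where
  anchor_eq (x : M) (α β : TangentSpace 𝓘(ℝ, E) x →L[ℝ] ℝ) : β (𝒞.anchor x α) = P.bivector x α β
  bracket_eq
    (α β : Cₛ^∞⟮𝓘(ℝ, E); E →L[ℝ] ℝ, (fun x : M ↦ TangentSpace 𝓘(ℝ, E) x →L[ℝ] ℝ)⟯)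
    (X : Cₛ^∞⟮𝓘(ℝ, E); E, (TangentSpace 𝓘(ℝ, E) : M → Type _)⟯) (x : M) :
    𝒞.bracket α β x (X x) =
      lieDerivOneForm (fun y ↦ 𝒞.anchor y (α y)) β X x
        - lieDerivOneForm (fun y ↦ 𝒞.anchor y (β y)) α X x
        - mvfderiv 𝓘(ℝ, E) (fun y ↦ P.bivector y (α y) (β y)) x (X x)

variable {F : Type*} [NormedAddCommGroup F] [NormedSpace ℝ F]
  {V : M → Type*} [TopologicalSpace (TotalSpace F V)]
  [∀ x, AddCommGroup (V x)] [∀ x, Module ℝ (V x)] [∀ x, TopologicalSpace (V x)]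
  [∀ x, IsTopologicalAddGroup (V x)] [∀ x, ContinuousSMul ℝ (V x)]
  [FiberBundle F V] [VectorBundle ℝ F V] [ContMDiffVectorBundle ∞ F V 𝓘(ℝ, E)]

/-- `s` is a Hamiltonian section of `f`: `d_𝒜 f (b) = ω(s, b)` for all `b`, where
`d_𝒜 f (b) = df(ρ(b))`. -/
def SymplecticForm.IsHamiltonian {𝒜 : LieAlgebroid E F V} (Ω : SymplecticForm 𝒜) (f : M → ℝ)
    (s : Cₛ^∞⟮𝓘(ℝ, E); F, V⟯) : Prop :=
  ∀ (x : M) (b : V x), mvfderiv 𝓘(ℝ, E) f x (𝒜.anchor x b) = Ω.form x (s x) b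

/-- `P` is the Poisson structure on the base induced by the symplectic Lie algebroid `(𝒜, ω)`:
every smooth function has exactly one Hamiltonian section, and `{f, g} = ω(a_f, a_g)`. -/
structure PoissonStructure.IsInducedBy (P : PoissonStructure E M) {𝒜 : LieAlgebroid E F V}
    (Ω : SymplecticForm 𝒜) : Prop where
  existsUnique_hamiltonian (f : M → ℝ) (hf : ContMDiff 𝓘(ℝ, E) 𝓘(ℝ, ℝ) ∞ f) :
    ∃! s : Cₛ^∞⟮𝓘(ℝ, E); F, V⟯, Ω.IsHamiltonian f s
  bracket_eq (f g : M → ℝ) (hf : ContMDiff 𝓘(ℝ, E) 𝓘(ℝ, ℝ) ∞ f)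
    (hg : ContMDiff 𝓘(ℝ, E) 𝓘(ℝ, ℝ) ∞ g) (a b : Cₛ^∞⟮𝓘(ℝ, E); F, V⟯)
    (ha : Ω.IsHamiltonian f a) (hb : Ω.IsHamiltonian g b) (x : M) :
    P.bivector x (mvfderiv 𝓘(ℝ, E) f x) (mvfderiv 𝓘(ℝ, E) g x) = Ω.form x (a x) (b x)

end Poisson

/-! ### Leaves of the characteristic foliation and restriction to a leaf -/

section Leaf

variable {E : Type*} [NormedAddCommGroup E] [NormedSpace ℝ E]
  {M : Type u} [TopologicalSpace M] [ChartedSpace E M] [IsManifold 𝓘(ℝ, E) ∞ M]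
  {F : Type*} [NormedAddCommGroup F] [NormedSpace ℝ F]
  {V : M → Type*} [TopologicalSpace (TotalSpace F V)]
  [∀ x, AddCommGroup (V x)] [∀ x, Module ℝ (V x)] [∀ x, TopologicalSpace (V x)]
  [∀ x, IsTopologicalAddGroup (V x)] [∀ x, ContinuousSMul ℝ (V x)]
  [FiberBundle F V] [VectorBundle ℝ F V] [ContMDiffVectorBundle ∞ F V 𝓘(ℝ, E)]
  {E' : Type*} [NormedAddCommGroup E'] [NormedSpace ℝ E']
  {N : Type v} [TopologicalSpace N] [ChartedSpace E' N] [IsManifold 𝓘(ℝ, E') ∞ N]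

/-- The injectively immersed manifold `ι : N → M` is an integral submanifold of the generalized
distribution `ρ(V) ⊆ TM`. -/
structure LieAlgebroid.IsIntegralSubmanifold (𝒜 : LieAlgebroid E F V)
    (ι : C^∞⟮𝓘(ℝ, E'), N; 𝓘(ℝ, E), M⟯) : Prop where
  injective : Function.Injective ι
  immersion (x : N) : Function.Injective (mfderiv 𝓘(ℝ, E') 𝓘(ℝ, E) ι x)
  tangent (x : N) :
    range (mfderiv 𝓘(ℝ, E') 𝓘(ℝ, E) ι x) = range (𝒜.anchor (ι x))

/-- `ι : N → M` is (the inclusion of) a leaf of the characteristic foliation of `𝒜`: a maximal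
connected integral submanifold of `ρ(V)`. A competitor meeting `N` has the same dimension as `N`
and injects into `M`, so it suffices to let it be modelled on the same space `E'` and to live in
the universe of `M`. -/
structure LieAlgebroid.IsLeaf (𝒜 : LieAlgebroid E F V)
    (ι : C^∞⟮𝓘(ℝ, E'), N; 𝓘(ℝ, E), M⟯) : Prop where
  connected : ConnectedSpace N
  integral : 𝒜.IsIntegralSubmanifold ι
  maximal (N' : Type u) [TopologicalSpace N'] [ChartedSpace E' N'] [IsManifold 𝓘(ℝ, E') ∞ N']
    [T2Space N'] [SecondCountableTopology N'] [ConnectedSpace N']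
    (j : C^∞⟮𝓘(ℝ, E'), N'; 𝓘(ℝ, E), M⟯) (hj : 𝒜.IsIntegralSubmanifold j)
    (hmeet : (range j ∩ range ι).Nonempty) : range j ⊆ range ι

/-- `𝒜N` is the restriction of the Lie algebroid `𝒜` to `N`, a Lie algebroid structure on the
restricted (pulled back) vector bundle: its anchor is that of `𝒜`, viewed in `TN ⊆ TM`, and the
bracket of the restrictions of two sections is the restriction of their bracket. -/
structure LieAlgebroid.IsRestriction (𝒜 : LieAlgebroid E F V)
    (ι : C^∞⟮𝓘(ℝ, E'), N; 𝓘(ℝ, E), M⟯) (𝒜N : LieAlgebroid E' F (ι *ᵖ V)) : Prop where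
  anchor_eq (x : N) (a : (ι *ᵖ V) x) :
    mfderiv 𝓘(ℝ, E') 𝓘(ℝ, E) ι x (𝒜N.anchor x a) = 𝒜.anchor (ι x) a
  bracket_eq (s t : Cₛ^∞⟮𝓘(ℝ, E); F, V⟯) (s' t' : Cₛ^∞⟮𝓘(ℝ, E'); F, (ι *ᵖ V)⟯)
    (hs : ∀ x, s' x = s (ι x)) (ht : ∀ x, t' x = t (ι x)) (x : N) :
    𝒜N.bracket s' t' x = 𝒜.bracket s t (ι x)

namespace CompatibleTriple

variable {𝒜 : LieAlgebroid E F V} (T : CompatibleTriple 𝒜) (ι : C^∞⟮𝓘(ℝ, E'), N; 𝓘(ℝ, E), M⟯)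

/-- The fibres of `(E² + L¹)_N`. -/
def restrictedE2L1 (x : N) : Submodule ℝ ((ι *ᵖ V) x) := T.E2 (ι x) ⊔ T.L1 (ι x)

/-- `lam` is the fibrewise linear splitting `TN → 𝒜_N` of the anchor of `𝒜_N` that belongs to the
decomposition `𝒜_N = (E¹ + E²)_N ⊕ L_N`. -/
def IsSplitting (𝒜N : LieAlgebroid E' F (ι *ᵖ V))
    (lam : ∀ x : N, TangentSpace 𝓘(ℝ, E') x →L[ℝ] (ι *ᵖ V) x) : Prop :=
  ∀ (x : N) (v : TangentSpace 𝓘(ℝ, E') x),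
    lam x v ∈ T.E1 (ι x) ⊔ T.E2 (ι x) ∧ 𝒜N.anchor x (lam x v) = v

end CompatibleTriple

/-- The map `a ↦ -λ^*(i_a ω)` from the fibre at `x` to the cotangent space of the base. -/
def SymplecticForm.negPullContraction {𝒜 : LieAlgebroid E F V} (Ω : SymplecticForm 𝒜)
    (lam : ∀ x : M, TangentSpace 𝓘(ℝ, E) x →L[ℝ] V x) (x : M) :
    V x →ₗ[ℝ] (TangentSpace 𝓘(ℝ, E) x →L[ℝ] ℝ) where
  toFun a := -((Ω.form x a).comp (lam x))
  map_add' a b := by ext v; simp [add_comm]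
  map_smul' r a := by ext v; simp

end Leaf

end

/-! Over an integral submanifold the restricted anchor ρ is onto TN with kernel L, and the whole
theorem is governed by the map ♯ : T*N → 𝒜_N with ω(♯α, b) = -α(ρ b) (`sharp`). It is injective
because ρ is onto, and its image is L^ω, which is E² + L¹ by a dimension count (`E2_sup_L1`). For a
in L^ω the number ω(a, b) depends only on ρ b, so it equals ω(a, λ(ρ b)). Hence ψ = -λ^*(i_a ω) is
the inverse of ♯ on L^ω, for any right inverse λ of the anchor (`sharp_negPullContraction`).

The Hamiltonian section of f is -♯(df), and π(α, β) = ω(♯α, ♯β) = β(ρ♯α), so ρ∘♯ = π^♯. Evaluating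
dω = 0 on three Hamiltonian sections gives the Jacobi identity of π. Evaluating it on ♯α, ♯β and an
arbitrary section c gives -ω([♯α, ♯β], c) = (ℒ_{π^♯α}β - ℒ_{π^♯β}α - d(π(α, β)))(ρ c), which is
`form_bracket_sharp`. The right side sees only ρ c, so L^ω is closed under the bracket, and ψ[♯α,
♯β] = [α, β]_π. The axioms of the cotangent Lie algebroid are therefore inherited from 𝒜_N through
the injection ♯.

The restricted bracket comes from extending derivations. A section of the pullback bundle is locally
a combination of pullbacks with smooth coefficients, so a derivation with symbol dι(v) extends along
ι by the Leibniz rule (`extendDerivation`). Doing this in one argument of the bracket and then in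
the other gives [s, t]_N. Uniqueness, the axioms and dω_N = 0 are then reduced to pulled-back
sections by `pullback_section_induction`, since the expressions concerned obey Leibniz rules or are
tensorial.

No choice made fibre by fibre needs to be smooth: smoothness always descends along an injective
smooth bundle map (dι, ω^♭ or ♯), by `contMDiffAt_section_of_injective_inCoordinates`. -/

set_option linter.unusedSectionVars false

/-! ### Smooth families of linear maps -/

section Smoothness

variable {E : Type*} [NormedAddCommGroup E] [NormedSpace ℝ E]
  {M : Type*} [TopologicalSpace M] [ChartedSpace E M]

theorem exists_contMDiff_bump [FiniteDimensional ℝ E] [IsManifold 𝓘(ℝ, E) ∞ M] [T2Space M]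
    {x₀ : M} {U : Set M} (hU : U ∈ 𝓝 x₀) :
    ∃ χ : C^∞⟮𝓘(ℝ, E), M; 𝓘(ℝ, ℝ), ℝ⟯, (∀ᶠ x in 𝓝 x₀, χ x = 1) ∧ tsupport χ ⊆ U := by
  obtain ⟨f, hf, -⟩ := (SmoothBumpFunction.nhds_basis_support (I := 𝓘(ℝ, E)) hU).mem_iff.1
    (univ_mem : (univ : Set M) ∈ 𝓝 x₀)
  exact ⟨⟨f, f.contMDiff⟩, f.eventuallyEq_one, hf⟩

/-- In finite dimension an operator is the sum of the rank-one operators built from a fixed basis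
and its values on that basis. -/
theorem contMDiffAt_clm_of_apply {F G : Type*} [NormedAddCommGroup F] [NormedSpace ℝ F]
    [FiniteDimensional ℝ F] [NormedAddCommGroup G] [NormedSpace ℝ G] {A : M → F →L[ℝ] G} {x₀ : M}
    (h : ∀ v, ContMDiffAt 𝓘(ℝ, E) 𝓘(ℝ, G) ∞ (fun x ↦ A x v) x₀) :
    ContMDiffAt 𝓘(ℝ, E) 𝓘(ℝ, F →L[ℝ] G) ∞ A x₀ := by
  let b := Module.finBasis ℝ F
  have hA : A = fun x ↦ ∑ i, ContinuousLinearMap.smulRightL ℝ F G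
      (LinearMap.toContinuousLinearMap (b.coord i)) (A x (b i)) := by
    ext x v
    have hv : A x v = ∑ i, b.repr v i • A x (b i) := by
      conv_lhs => rw [← b.sum_repr v, map_sum]
      simp only [map_smul]
    simpa [ContinuousLinearMap.smulRightL] using hv
  rw [hA]
  refine contMDiffAt_finsetSum fun i _ ↦ ?_
  exact (ContinuousLinearMap.contDiff _).contMDiff.contMDiffAt.comp x₀ (h (b i))

/-- With a constant left inverse B of A x₀, the operators B ∘ A x are invertible near x₀, so u = (B
∘ A)⁻¹ B (A u) there, and operator inversion is smooth. -/
theorem contMDiffAt_of_clm_apply {F G : Type*} [NormedAddCommGroup F] [NormedSpace ℝ F]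
    [FiniteDimensional ℝ F] [NormedAddCommGroup G] [NormedSpace ℝ G] [FiniteDimensional ℝ G]
    {A : M → F →L[ℝ] G} {u : M → F} {x₀ : M}
    (hA : ContMDiffAt 𝓘(ℝ, E) 𝓘(ℝ, F →L[ℝ] G) ∞ A x₀) (hinj : Function.Injective (A x₀))
    (h : ContMDiffAt 𝓘(ℝ, E) 𝓘(ℝ, G) ∞ (fun x ↦ A x (u x)) x₀) :
    ContMDiffAt 𝓘(ℝ, E) 𝓘(ℝ, F) ∞ u x₀ := by
  obtain ⟨B, hB⟩ := LinearMap.exists_leftInverse_of_injective (A x₀ : F →ₗ[ℝ] G)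
    (LinearMap.ker_eq_bot.2 hinj)
  let B' : G →L[ℝ] F := LinearMap.toContinuousLinearMap B
  have hBA : B'.comp (A x₀) = ContinuousLinearMap.id ℝ F := by
    ext v; exact LinearMap.congr_fun hB v
  have h1 : ContMDiffAt 𝓘(ℝ, E) 𝓘(ℝ, F →L[ℝ] F) ∞ (fun x ↦ B'.comp (A x)) x₀ :=
    contMDiffAt_const.clm_comp hA
  have hinv : (B'.comp (A x₀)).IsInvertible := by
    rw [hBA]; exact ⟨ContinuousLinearEquiv.refl ℝ F, rfl⟩
  have h2 : ContMDiffAt 𝓘(ℝ, E) 𝓘(ℝ, F →L[ℝ] F) ∞ (fun x ↦ (B'.comp (A x)).inverse) x₀ :=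
    hinv.contDiffAt_map_inverse.contMDiffAt.comp x₀ h1
  have h3 : ContMDiffAt 𝓘(ℝ, E) 𝓘(ℝ, F) ∞
      (fun x ↦ (B'.comp (A x)).inverse (B' (A x (u x)))) x₀ :=
    h2.clm_apply (contMDiffAt_const.clm_apply h)
  refine h3.congr_of_eventuallyEq ?_
  have hev : ∀ᶠ x in 𝓝 x₀, (B'.comp (A x)).IsInvertible := by
    obtain ⟨e, he⟩ := hinv
    have := ContinuousLinearEquiv.nhds e
    rw [he] at this
    exact h1.continuousAt this
  filter_upwards [hev] with x hx
  exact (hx.inverse_apply_eq.2 rfl).symm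

end Smoothness

/-! ### Smoothness criteria for sections -/

section Bundles

variable {E : Type*} [NormedAddCommGroup E] [NormedSpace ℝ E]
  {M : Type*} [TopologicalSpace M] [ChartedSpace E M]
  {E' : Type*} [NormedAddCommGroup E'] [NormedSpace ℝ E']
  {M' : Type*} [TopologicalSpace M'] [ChartedSpace E' M']
  {F : Type*} [NormedAddCommGroup F] [NormedSpace ℝ F]
  {V : M → Type*} [TopologicalSpace (TotalSpace F V)]
  [∀ x, AddCommGroup (V x)] [∀ x, Module ℝ (V x)] [∀ x, TopologicalSpace (V x)]
  [FiberBundle F V] [VectorBundle ℝ F V]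
  {G : Type*} [NormedAddCommGroup G] [NormedSpace ℝ G]
  {W' : M' → Type*} [TopologicalSpace (TotalSpace G W')]
  [∀ x, AddCommGroup (W' x)] [∀ x, Module ℝ (W' x)] [∀ x, TopologicalSpace (W' x)]
  [FiberBundle G W'] [VectorBundle ℝ G W']
  {W : M → Type*} [TopologicalSpace (TotalSpace G W)]
  [∀ x, AddCommGroup (W x)] [∀ x, Module ℝ (W x)] [∀ x, TopologicalSpace (W x)]
  [FiberBundle G W] [VectorBundle ℝ G W]

/-- A section is smooth at a point if its image under an injective smooth bundle map (possibly
over a map of the base) is. -/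
theorem contMDiffAt_section_of_injective_inCoordinates [FiniteDimensional ℝ F]
    [FiniteDimensional ℝ G] {b : M → M'} {x₀ : M} {φ : ∀ x, V x →L[ℝ] W' (b x)}
    {s : ∀ x, V x}
    (hφ : ContMDiffAt 𝓘(ℝ, E) 𝓘(ℝ, F →L[ℝ] G) ∞
      (fun x ↦ ContinuousLinearMap.inCoordinates F V G W' x₀ x (b x₀) (b x) (φ x)) x₀)
    (hinj : Function.Injective (φ x₀))
    (hs : ContMDiffAt 𝓘(ℝ, E) (𝓘(ℝ, E').prod 𝓘(ℝ, G)) ∞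
      (fun x ↦ TotalSpace.mk' G (b x) (φ x (s x))) x₀) :
    ContMDiffAt 𝓘(ℝ, E) (𝓘(ℝ, E).prod 𝓘(ℝ, F)) ∞ (fun x ↦ TotalSpace.mk' F x (s x)) x₀ := by
  rw [contMDiffAt_section]
  rw [contMDiffAt_totalSpace] at hs
  have hx₀ : x₀ ∈ (trivializationAt F V x₀).baseSet := FiberBundle.mem_baseSet_trivializationAt' x₀
  have hb₀ : b x₀ ∈ (trivializationAt G W' (b x₀)).baseSet :=
    FiberBundle.mem_baseSet_trivializationAt' (b x₀)
  refine contMDiffAt_of_clm_apply hφ ?_ (hs.2.congr_of_eventuallyEq ?_)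
  · rw [ContinuousLinearMap.inCoordinates_eq hx₀ hb₀]
    simp only [ContinuousLinearMap.coe_comp, ContinuousLinearEquiv.coe_coe]
    exact (ContinuousLinearEquiv.injective _).comp (hinj.comp (ContinuousLinearEquiv.injective _))
  · have h1 : ∀ᶠ x in 𝓝 x₀, x ∈ (trivializationAt F V x₀).baseSet :=
      (trivializationAt F V x₀).open_baseSet.mem_nhds hx₀
    have h2 : ∀ᶠ x in 𝓝 x₀, b x ∈ (trivializationAt G W' (b x₀)).baseSet :=
      hs.1.continuousAt ((trivializationAt G W' (b x₀)).open_baseSet.mem_nhds hb₀)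
    filter_upwards [h1, h2] with x hx hx'
    rw [ContinuousLinearMap.inCoordinates_eq hx hx']
    simp [hx]

variable [∀ x, IsTopologicalAddGroup (W x)] [∀ x, ContinuousSMul ℝ (W x)]

theorem contMDiffAt_section_of_injective [FiniteDimensional ℝ F]
    [FiniteDimensional ℝ G] {x₀ : M} {φ : ∀ x, V x →L[ℝ] W x} {s : ∀ x, V x}
    (hφ : ContMDiffAt 𝓘(ℝ, E) (𝓘(ℝ, E).prod 𝓘(ℝ, F →L[ℝ] G)) ∞
      (fun x ↦ TotalSpace.mk' (F →L[ℝ] G) (E := fun x ↦ V x →L[ℝ] W x) x (φ x)) x₀)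
    (hinj : Function.Injective (φ x₀))
    (hs : ContMDiffAt 𝓘(ℝ, E) (𝓘(ℝ, E).prod 𝓘(ℝ, G)) ∞
      (fun x ↦ TotalSpace.mk' G x (φ x (s x))) x₀) :
    ContMDiffAt 𝓘(ℝ, E) (𝓘(ℝ, E).prod 𝓘(ℝ, F)) ∞ (fun x ↦ TotalSpace.mk' F x (s x)) x₀ :=
  contMDiffAt_section_of_injective_inCoordinates (b := id) ((contMDiffAt_hom_bundle _).1 hφ).2
    hinj hs

/-- A section of a bundle of homomorphisms is smooth at a point if it maps sections that are
smooth there to sections that are smooth there. -/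
theorem contMDiffAt_hom_of_apply [FiniteDimensional ℝ F] [ContMDiffVectorBundle ∞ F V 𝓘(ℝ, E)]
    {x₀ : M} {φ : ∀ x, V x →L[ℝ] W x}
    (h : ∀ s : ∀ x, V x,
      ContMDiffAt 𝓘(ℝ, E) (𝓘(ℝ, E).prod 𝓘(ℝ, F)) ∞ (fun x ↦ TotalSpace.mk' F x (s x)) x₀ →
      ContMDiffAt 𝓘(ℝ, E) (𝓘(ℝ, E).prod 𝓘(ℝ, G)) ∞ (fun x ↦ TotalSpace.mk' G x (φ x (s x))) x₀) :
    ContMDiffAt 𝓘(ℝ, E) (𝓘(ℝ, E).prod 𝓘(ℝ, F →L[ℝ] G)) ∞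
      (fun x ↦ TotalSpace.mk' (F →L[ℝ] G) (E := fun x ↦ V x →L[ℝ] W x) x (φ x)) x₀ := by
  rw [contMDiffAt_hom_bundle]
  refine ⟨contMDiffAt_id, contMDiffAt_clm_of_apply fun v ↦ ?_⟩
  have hx₀ : x₀ ∈ (trivializationAt F V x₀).baseSet := FiberBundle.mem_baseSet_trivializationAt' x₀
  have hy₀ : x₀ ∈ (trivializationAt G W x₀).baseSet := FiberBundle.mem_baseSet_trivializationAt' x₀
  -- The test section is constant in the trivialization. It is only known to be smooth near x₀,
  -- which is why the hypothesis quantifies over sections smooth at the point.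
  have hs : ContMDiffAt 𝓘(ℝ, E) (𝓘(ℝ, E).prod 𝓘(ℝ, F)) ∞
      (fun x ↦ TotalSpace.mk' F x ((trivializationAt F V x₀).symm x v)) x₀ := by
    rw [contMDiffAt_section]
    refine (contMDiffAt_const (c := v)).congr_of_eventuallyEq ?_
    filter_upwards [(trivializationAt F V x₀).open_baseSet.mem_nhds hx₀] with x hx
    simp [(trivializationAt F V x₀).apply_mk_symm hx]
  have h2 := h _ hs
  rw [contMDiffAt_section] at h2
  refine h2.congr_of_eventuallyEq ?_
  filter_upwards [(trivializationAt F V x₀).open_baseSet.mem_nhds hx₀,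
    (trivializationAt G W x₀).open_baseSet.mem_nhds hy₀] with x hx hy
  rw [ContinuousLinearMap.inCoordinates_eq hx hy]
  simp

theorem contMDiffAt_section_trivial {f : M → G} {x₀ : M} :
    ContMDiffAt 𝓘(ℝ, E) (𝓘(ℝ, E).prod 𝓘(ℝ, G)) ∞
      (fun x ↦ TotalSpace.mk' G (E := fun _ : M ↦ G) x (f x)) x₀ ↔
    ContMDiffAt 𝓘(ℝ, E) 𝓘(ℝ, G) ∞ f x₀ := by
  rw [contMDiffAt_section]
  rfl

theorem contMDiffAt_trivial_iff {f : M → G} {b : M → M'} {x₀ : M}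
    (hb : ContMDiffAt 𝓘(ℝ, E) 𝓘(ℝ, E') ∞ b x₀) :
    ContMDiffAt 𝓘(ℝ, E) (𝓘(ℝ, E').prod 𝓘(ℝ, G)) ∞
      (fun x ↦ TotalSpace.mk' G (E := fun _ : M' ↦ G) (b x) (f x)) x₀ ↔
    ContMDiffAt 𝓘(ℝ, E) 𝓘(ℝ, G) ∞ f x₀ := by
  rw [contMDiffAt_totalSpace]
  exact and_iff_right hb

end Bundles

/-! ### Differentials of functions and Lie brackets of vector fields -/

section Calculus

variable {E : Type*} [NormedAddCommGroup E] [NormedSpace ℝ E]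
  {M : Type*} [TopologicalSpace M] [ChartedSpace E M]

/-- Both terms on the right contain D²f(X, Y); these cancel by symmetry, leaving the terms with the
derivatives of X and Y. -/
theorem fderiv_lieBracket {f : E → ℝ} {X Y : E → E} {z : E} (hf : ContDiffAt ℝ ∞ f z)
    (hX : DifferentiableAt ℝ X z) (hY : DifferentiableAt ℝ Y z) :
    fderiv ℝ f z (lieBracket ℝ X Y z) =
      fderiv ℝ (fun y ↦ fderiv ℝ f y (Y y)) z (X z)
        - fderiv ℝ (fun y ↦ fderiv ℝ f y (X y)) z (Y z) := by
  have hdf : DifferentiableAt ℝ (fderiv ℝ f) z :=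
    (hf.fderiv_right (m := 1) (by norm_num; exact ENat.LEInfty.out)).differentiableAt one_ne_zero
  have hsymm : IsSymmSndFDerivAt ℝ f z := hf.isSymmSndFDerivAt (by simp; exact ENat.LEInfty.out)
  rw [fderiv_clm_apply hdf hY, fderiv_clm_apply hdf hX, lieBracket]
  simp [hsymm.eq (X z) (Y z)]

theorem Filter.EventuallyEq.mvfderiv_eq {f g : M → ℝ} {x : M} (h : f =ᶠ[𝓝 x] g) :
    mvfderiv 𝓘(ℝ, E) f x = mvfderiv 𝓘(ℝ, E) g x := by
  ext v
  exact congrArg (fun L : TangentSpace 𝓘(ℝ, E) x →L[ℝ] ℝ ↦ L v) h.mfderiv_eq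

variable [IsManifold 𝓘(ℝ, E) ∞ M]

theorem mvfderiv_comp_extChartAt {x y : M} (hy : y ∈ (extChartAt 𝓘(ℝ, E) x).source) {g : E → ℝ}
    (hg : DifferentiableAt ℝ g (extChartAt 𝓘(ℝ, E) x y)) (v : TangentSpace 𝓘(ℝ, E) y) :
    mvfderiv 𝓘(ℝ, E) (g ∘ extChartAt 𝓘(ℝ, E) x) y v =
      fderiv ℝ g (extChartAt 𝓘(ℝ, E) x y)
        (mfderiv 𝓘(ℝ, E) 𝓘(ℝ, E) (extChartAt 𝓘(ℝ, E) x) y v) := by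
  have h1 : MDifferentiableAt 𝓘(ℝ, E) 𝓘(ℝ, E) (extChartAt 𝓘(ℝ, E) x) y :=
    mdifferentiableAt_extChartAt (by simpa using hy)
  rw [mvfderiv_comp_apply y hg.mdifferentiableAt h1]
  simp only [mvfderiv, mfderiv_eq_fderiv]
  rfl

theorem fderiv_mpullbackWithin_extChartAt {x y : M} (hy : y ∈ (extChartAt 𝓘(ℝ, E) x).source)
    (g : E → ℝ) (hg : DifferentiableAt ℝ g (extChartAt 𝓘(ℝ, E) x y))
    (X : ∀ y : M, TangentSpace 𝓘(ℝ, E) y) :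
    mvfderiv 𝓘(ℝ, E) (g ∘ extChartAt 𝓘(ℝ, E) x) y (X y) =
      fderiv ℝ g (extChartAt 𝓘(ℝ, E) x y)
        (mpullbackWithin 𝓘(ℝ, E) 𝓘(ℝ, E) (extChartAt 𝓘(ℝ, E) x).symm X (range 𝓘(ℝ, E))
          (extChartAt 𝓘(ℝ, E) x y)) := by
  rw [mvfderiv_comp_extChartAt hy hg, mpullbackWithin_apply]
  congr 1
  symm
  have hinv := isInvertible_mfderivWithin_extChartAt_symm (I := 𝓘(ℝ, E))
    ((extChartAt 𝓘(ℝ, E) x).map_source hy)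
  refine hinv.inverse_apply_eq.2 ?_
  -- The two values lie in tangent spaces at different expressions for the same point, so the
  -- equality is stated in the model space.
  have h1 : (X ((extChartAt 𝓘(ℝ, E) x).symm (extChartAt 𝓘(ℝ, E) x y)) : E) = X y :=
    congrArg (fun z ↦ (X z : E)) ((extChartAt 𝓘(ℝ, E) x).left_inv hy)
  exact h1.trans (congrArg (fun L : E →L[ℝ] E ↦ L (X y))
    (mfderivWithin_extChartAt_symm_comp_mfderiv_extChartAt' (I := 𝓘(ℝ, E)) hy)).symm

/-- The Lie bracket of vector fields acts on functions as the commutator. -/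
theorem mvfderiv_mlieBracket [CompleteSpace E] {f : M → ℝ}
    {X Y : ∀ x : M, TangentSpace 𝓘(ℝ, E) x} {x : M}
    (hf : ContMDiff 𝓘(ℝ, E) 𝓘(ℝ, ℝ) ∞ f)
    (hX : MDifferentiableAt 𝓘(ℝ, E) (𝓘(ℝ, E).prod 𝓘(ℝ, E)) (fun x ↦ TotalSpace.mk' E x (X x)) x)
    (hY : MDifferentiableAt 𝓘(ℝ, E) (𝓘(ℝ, E).prod 𝓘(ℝ, E)) (fun x ↦ TotalSpace.mk' E x (Y x)) x) :
    mvfderiv 𝓘(ℝ, E) f x (mlieBracket 𝓘(ℝ, E) X Y x) =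
      mvfderiv 𝓘(ℝ, E) (fun y ↦ mvfderiv 𝓘(ℝ, E) f y (Y y)) x (X x)
        - mvfderiv 𝓘(ℝ, E) (fun y ↦ mvfderiv 𝓘(ℝ, E) f y (X y)) x (Y x) := by
  set φ := extChartAt 𝓘(ℝ, E) x with hφ
  set f' : E → ℝ := f ∘ φ.symm with hf'
  set X' : E → E := mpullbackWithin 𝓘(ℝ, E) 𝓘(ℝ, E) φ.symm X (range 𝓘(ℝ, E)) with hX'
  set Y' : E → E := mpullbackWithin 𝓘(ℝ, E) 𝓘(ℝ, E) φ.symm Y (range 𝓘(ℝ, E)) with hY'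
  have hsrc : ∀ᶠ y in 𝓝 x, y ∈ φ.source := extChartAt_source_mem_nhds x
  have hxs : x ∈ φ.source := mem_extChartAt_source x
  have hf'c : ∀ z ∈ φ.target, ContDiffAt ℝ ∞ f' z := fun z hz ↦ by
    have h1 : ContMDiffAt 𝓘(ℝ, E) 𝓘(ℝ, E) ∞ φ.symm z :=
      (contMDiffOn_extChartAt_symm x).contMDiffAt ((isOpen_extChartAt_target x).mem_nhds hz)
    exact (hf.contMDiffAt.comp z h1).contDiffAt
  have hff' : ∀ y ∈ φ.source, mvfderiv 𝓘(ℝ, E) f y = mvfderiv 𝓘(ℝ, E) (f' ∘ φ) y := fun y hy ↦ by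
    have : f =ᶠ[𝓝 y] f' ∘ φ := by
      filter_upwards [(isOpen_extChartAt_source x).mem_nhds hy] with z hz
      simp [hf', φ.left_inv hz]
    exact this.mvfderiv_eq
  have hdiff : ∀ y ∈ φ.source, DifferentiableAt ℝ f' (φ y) := fun y hy ↦
    (hf'c _ (φ.map_source hy)).differentiableAt (by simp)
  have hXd : DifferentiableAt ℝ X' (φ x) := by
    have := MDifferentiableWithinAt.differentiableWithinAt_mpullbackWithin_vectorField
      (mdifferentiableWithinAt_univ.2 hX)
    exact this.differentiableAt (by simp)
  have hYd : DifferentiableAt ℝ Y' (φ x) := by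
    have := MDifferentiableWithinAt.differentiableWithinAt_mpullbackWithin_vectorField
      (mdifferentiableWithinAt_univ.2 hY)
    exact this.differentiableAt (by simp)
  have hdf : DifferentiableAt ℝ (fderiv ℝ f') (φ x) :=
    ((hf'c _ (φ.map_source hxs)).fderiv_right (m := 1)
      (by norm_num; exact ENat.LEInfty.out)).differentiableAt one_ne_zero
  -- In the chart the function Z f is the derivative of f' along Z'; a second application turns both
  -- second derivatives into derivatives in the model space.
  have key : ∀ (Z : ∀ x : M, TangentSpace 𝓘(ℝ, E) x) (Z' : E → E),
      Z' = mpullbackWithin 𝓘(ℝ, E) 𝓘(ℝ, E) φ.symm Z (range 𝓘(ℝ, E)) →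
      ∀ y ∈ φ.source, mvfderiv 𝓘(ℝ, E) f y (Z y) = fderiv ℝ f' (φ y) (Z' (φ y)) := by
    intro Z Z' hZ y hy
    rw [hff' y hy, hZ]
    exact fderiv_mpullbackWithin_extChartAt hy f' (hdiff y hy) Z
  have key2 : ∀ (Z W : ∀ x : M, TangentSpace 𝓘(ℝ, E) x) (Z' W' : E → E),
      Z' = mpullbackWithin 𝓘(ℝ, E) 𝓘(ℝ, E) φ.symm Z (range 𝓘(ℝ, E)) →
      W' = mpullbackWithin 𝓘(ℝ, E) 𝓘(ℝ, E) φ.symm W (range 𝓘(ℝ, E)) →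
      DifferentiableAt ℝ Z' (φ x) →
      mvfderiv 𝓘(ℝ, E) (fun y ↦ mvfderiv 𝓘(ℝ, E) f y (Z y)) x (W x) =
        fderiv ℝ (fun z ↦ fderiv ℝ f' z (Z' z)) (φ x) (W' (φ x)) := by
    intro Z W Z' W' hZ hW hZd
    have heq : (fun y ↦ mvfderiv 𝓘(ℝ, E) f y (Z y)) =ᶠ[𝓝 x]
        (fun z ↦ fderiv ℝ f' z (Z' z)) ∘ φ := by
      filter_upwards [hsrc] with y hy
      exact key Z Z' hZ y hy
    have h1 : mvfderiv 𝓘(ℝ, E) (fun y ↦ mvfderiv 𝓘(ℝ, E) f y (Z y)) x =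
        mvfderiv 𝓘(ℝ, E) ((fun z ↦ fderiv ℝ f' z (Z' z)) ∘ φ) x := heq.mvfderiv_eq
    rw [h1, hW]
    exact fderiv_mpullbackWithin_extChartAt hxs _ (hdf.clm_apply hZd) W
  rw [key2 Y X Y' X' hY' hX' hYd, key2 X Y X' Y' hX' hY' hXd,
    ← fderiv_lieBracket (hf'c _ (φ.map_source hxs)) hXd hYd, hff' x hxs,
    mvfderiv_comp_extChartAt hxs (hdiff x hxs)]
  congr 1
  -- The manifold bracket is the chart bracket pulled back by the derivative of the chart, so
  -- applying that derivative returns the chart bracket.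
  have hinv := isInvertible_mfderiv_extChartAt (I := 𝓘(ℝ, E)) hxs
  rw [mlieBracket, mlieBracketWithin_apply]
  obtain ⟨e, he⟩ := hinv
  rw [← hφ, ← he, ContinuousLinearMap.inverse_equiv]
  have hset : φ.symm ⁻¹' univ ∩ range 𝓘(ℝ, E) = univ := by simp
  have hlie : lieBracketWithin ℝ X' Y' (φ.symm ⁻¹' univ ∩ range 𝓘(ℝ, E)) (φ x) =
      lieBracket ℝ X' Y' (φ x) := by rw [hset, lieBracketWithin_univ]
  exact (e.apply_symm_apply _).trans hlie

theorem ContMDiffAt.mvfderiv_apply {f : M → ℝ} (hf : ContMDiff 𝓘(ℝ, E) 𝓘(ℝ, ℝ) ∞ f)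
    {X : ∀ x : M, TangentSpace 𝓘(ℝ, E) x} {x₀ : M}
    (hX : ContMDiffAt 𝓘(ℝ, E) (𝓘(ℝ, E).prod 𝓘(ℝ, E)) ∞ (fun x ↦ TotalSpace.mk' E x (X x)) x₀) :
    ContMDiffAt 𝓘(ℝ, E) 𝓘(ℝ, ℝ) ∞ (fun x ↦ mvfderiv 𝓘(ℝ, E) f x (X x)) x₀ := by
  have h1 : ContMDiff (𝓘(ℝ, E).prod 𝓘(ℝ, E)) (𝓘(ℝ, ℝ).prod 𝓘(ℝ, ℝ)) ∞
      (tangentMap 𝓘(ℝ, E) 𝓘(ℝ, ℝ) f) := hf.contMDiff_tangentMap (by simp)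
  have h2 := (contMDiff_snd_tangentBundle_modelSpace (n := ∞) ℝ 𝓘(ℝ, ℝ)).contMDiffAt.comp x₀
    (h1.contMDiffAt.comp x₀ hX)
  exact h2

theorem contMDiffAt_mvfderiv [FiniteDimensional ℝ E] {f : M → ℝ}
    (hf : ContMDiff 𝓘(ℝ, E) 𝓘(ℝ, ℝ) ∞ f) (x₀ : M) :
    ContMDiffAt 𝓘(ℝ, E) (𝓘(ℝ, E).prod 𝓘(ℝ, E →L[ℝ] ℝ)) ∞
      (fun x ↦ TotalSpace.mk' (E →L[ℝ] ℝ) (E := fun x : M ↦ TangentSpace 𝓘(ℝ, E) x →L[ℝ] ℝ) x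
        (mvfderiv 𝓘(ℝ, E) f x)) x₀ :=
  contMDiffAt_hom_of_apply (W := fun _ : M ↦ ℝ) fun _ hX ↦
    contMDiffAt_section_trivial.2 (ContMDiffAt.mvfderiv_apply hf hX)

/-- Every covector is the differential of a smooth function. -/
theorem exists_mvfderiv_eq [FiniteDimensional ℝ E] [T2Space M] (x : M)
    (ξ : TangentSpace 𝓘(ℝ, E) x →L[ℝ] ℝ) :
    ∃ f : M → ℝ, ContMDiff 𝓘(ℝ, E) 𝓘(ℝ, ℝ) ∞ f ∧ mvfderiv 𝓘(ℝ, E) f x = ξ := by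
  obtain ⟨χ, hχ1, hχ2⟩ := exists_contMDiff_bump (E := E) (extChartAt_source_mem_nhds (I := 𝓘(ℝ, E)) x)
  -- The function is the covector, read as a linear function of the chart and cut off by a bump.
  let η : E →L[ℝ] ℝ := ξ
  let g : M → ℝ := η ∘ extChartAt 𝓘(ℝ, E) x
  have hg : ContMDiffOn 𝓘(ℝ, E) 𝓘(ℝ, ℝ) ∞ g (extChartAt 𝓘(ℝ, E) x).source := by
    have := contMDiffOn_extChartAt (I := 𝓘(ℝ, E)) (n := ∞) (x := x)
    rw [← extChartAt_source 𝓘(ℝ, E)] at this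
    exact η.contDiff.contMDiff.comp_contMDiffOn this
  refine ⟨fun y ↦ χ y * g y, ?_, ?_⟩
  · refine contMDiff_of_tsupport fun y hy ↦ ?_
    have hy' : y ∈ (extChartAt 𝓘(ℝ, E) x).source := hχ2 (closure_mono
      (fun z hz ↦ by
        simp only [Function.mem_support] at hz ⊢
        exact left_ne_zero_of_mul hz) hy)
    exact χ.contMDiff.contMDiffAt.mul
      (hg.contMDiffAt ((isOpen_extChartAt_source x).mem_nhds hy'))
  · have heq : (fun y ↦ χ y * g y) =ᶠ[𝓝 x] g := by
      filter_upwards [hχ1] with y hy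
      simp [hy]
    rw [heq.mvfderiv_eq]
    ext v
    -- The preferred chart at x has identity derivative at x.
    rw [mvfderiv_comp_extChartAt (mem_extChartAt_source x) η.differentiableAt, η.fderiv,
      mfderiv_extChartAt_self]
    rfl

/-- A vector field along an immersion that is tangent to it is smooth if its image is. -/
theorem contMDiffAt_vectorField_of_mfderiv {E' : Type*} [NormedAddCommGroup E'] [NormedSpace ℝ E']
    {M' : Type*} [TopologicalSpace M'] [ChartedSpace E' M'] [IsManifold 𝓘(ℝ, E') ∞ M']
    [FiniteDimensional ℝ E] [FiniteDimensional ℝ E']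
    {j : M → M'} (hj : ContMDiff 𝓘(ℝ, E) 𝓘(ℝ, E') ∞ j) {x₀ : M}
    (hinj : Function.Injective (mfderiv 𝓘(ℝ, E) 𝓘(ℝ, E') j x₀))
    {X : ∀ x : M, TangentSpace 𝓘(ℝ, E) x}
    (hX : ContMDiffAt 𝓘(ℝ, E) (𝓘(ℝ, E').prod 𝓘(ℝ, E')) ∞
      (fun x ↦ TotalSpace.mk' E' (E := (TangentSpace 𝓘(ℝ, E') : M' → Type _)) (j x)
        (mfderiv 𝓘(ℝ, E) 𝓘(ℝ, E') j x (X x))) x₀) :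
    ContMDiffAt 𝓘(ℝ, E) (𝓘(ℝ, E).prod 𝓘(ℝ, E)) ∞ (fun x ↦ TotalSpace.mk' E x (X x)) x₀ :=
  contMDiffAt_section_of_injective_inCoordinates
    (V := (TangentSpace 𝓘(ℝ, E) : M → Type _)) (W' := (TangentSpace 𝓘(ℝ, E') : M' → Type _))
    (φ := fun x ↦ mfderiv 𝓘(ℝ, E) 𝓘(ℝ, E') j x)
    (hj.contMDiffAt.mfderiv_const (m := ∞) (by simp)) hinj hX

end Calculus

/-! ### Global sections that form a frame near a point -/

noncomputable section

section Frames

variable {E : Type*} [NormedAddCommGroup E] [NormedSpace ℝ E]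
  {M : Type*} [TopologicalSpace M] [ChartedSpace E M]
  {F : Type*} [NormedAddCommGroup F] [NormedSpace ℝ F]
  {V : M → Type*} [TopologicalSpace (TotalSpace F V)]
  [∀ x, AddCommGroup (V x)] [∀ x, Module ℝ (V x)] [∀ x, TopologicalSpace (V x)]
  [FiberBundle F V] [VectorBundle ℝ F V]

namespace ContMDiffSection

/-- The product of a smooth section with a smooth function. -/
def funSMul (f : C^∞⟮𝓘(ℝ, E), M; 𝓘(ℝ, ℝ), ℝ⟯) (s : Cₛ^∞⟮𝓘(ℝ, E); F, V⟯) :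
    Cₛ^∞⟮𝓘(ℝ, E); F, V⟯ :=
  ⟨fun x ↦ f x • s x, f.contMDiff.smul_section s.contMDiff⟩

@[simp]
theorem funSMul_apply (f : C^∞⟮𝓘(ℝ, E), M; 𝓘(ℝ, ℝ), ℝ⟯) (s : Cₛ^∞⟮𝓘(ℝ, E); F, V⟯) (x : M) :
    s.funSMul f x = f x • s x := rfl

@[simp]
theorem add_apply (s t : Cₛ^∞⟮𝓘(ℝ, E); F, V⟯) (x : M) : (s + t) x = s x + t x := rfl

@[simp]
theorem sub_apply (s t : Cₛ^∞⟮𝓘(ℝ, E); F, V⟯) (x : M) : (s - t) x = s x - t x := rfl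

@[simp]
theorem neg_apply (s : Cₛ^∞⟮𝓘(ℝ, E); F, V⟯) (x : M) : (-s) x = -s x := rfl

@[simp]
theorem zero_apply (x : M) : (0 : Cₛ^∞⟮𝓘(ℝ, E); F, V⟯) x = 0 := rfl

@[simp]
theorem smul_apply (r : ℝ) (s : Cₛ^∞⟮𝓘(ℝ, E); F, V⟯) (x : M) : (r • s) x = r • s x := rfl

@[simp]
theorem sum_apply {ι : Type*} (t : Finset ι) (s : ι → Cₛ^∞⟮𝓘(ℝ, E); F, V⟯) (x : M) :
    (∑ i ∈ t, s i) x = ∑ i ∈ t, s i x := by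
  classical
  induction t using Finset.induction_on with
  | empty => simp
  | insert a t ha h => simp [Finset.sum_insert ha, h]

end ContMDiffSection

variable (E F V) in
/-- A global frame near `x₀`: smooth sections `e i` and smooth sections `c i` of the dual bundle
that are dual bases of the fibres near `x₀`. -/
structure LocalDualFrame (x₀ : M) where
  e : Fin (Module.finrank ℝ F) → Cₛ^∞⟮𝓘(ℝ, E); F, V⟯
  c : Fin (Module.finrank ℝ F) → ∀ x, V x →L[ℝ] ℝ
  contMDiff_c (i) : ContMDiff 𝓘(ℝ, E) (𝓘(ℝ, E).prod 𝓘(ℝ, F →L[ℝ] ℝ)) ∞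
    (fun x ↦ TotalSpace.mk' (F →L[ℝ] ℝ) (E := fun x ↦ V x →L[ℝ] ℝ) x (c i x))
  sum_c : ∀ᶠ x in 𝓝 x₀, ∀ v : V x, ∑ i, c i x v • e i x = v
  linearIndependent : ∀ᶠ x in 𝓝 x₀, LinearIndependent ℝ fun i ↦ e i x

theorem LocalDualFrame.contMDiff_c_apply {x₀ : M} (B : LocalDualFrame E F V x₀)
    (i : Fin (Module.finrank ℝ F)) (s : Cₛ^∞⟮𝓘(ℝ, E); F, V⟯) :
    ContMDiff 𝓘(ℝ, E) 𝓘(ℝ, ℝ) ∞ (fun x ↦ B.c i x (s x)) := fun x ↦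
  contMDiffAt_section_trivial.1
    (ContMDiffAt.clm_bundle_apply (E₂ := fun _ : M ↦ ℝ) (B.contMDiff_c i x) (s.contMDiff x))

/-- The coefficients of a section with respect to a frame. -/
def LocalDualFrame.coeff {x₀ : M} (B : LocalDualFrame E F V x₀)
    (i : Fin (Module.finrank ℝ F)) (s : Cₛ^∞⟮𝓘(ℝ, E); F, V⟯) :
    C^∞⟮𝓘(ℝ, E), M; 𝓘(ℝ, ℝ), ℝ⟯ :=
  ⟨fun x ↦ B.c i x (s x), B.contMDiff_c_apply i s⟩

theorem LocalDualFrame.coeff_apply {x₀ : M} (B : LocalDualFrame E F V x₀)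
    (i : Fin (Module.finrank ℝ F)) (s : Cₛ^∞⟮𝓘(ℝ, E); F, V⟯) (x : M) :
    B.coeff i s x = B.c i x (s x) := rfl

variable [FiniteDimensional ℝ E] [IsManifold 𝓘(ℝ, E) ∞ M] [T2Space M]
  [FiniteDimensional ℝ F] [ContMDiffVectorBundle ∞ F V 𝓘(ℝ, E)]

/-- The frame of a trivialization and its coordinate functionals are both multiplied by one bump
function: they become globally smooth and remain dual where the bump equals 1. -/
theorem nonempty_localDualFrame (x₀ : M) : Nonempty (LocalDualFrame E F V x₀) := by
  let t := trivializationAt F V x₀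
  have hx₀ : x₀ ∈ t.baseSet := FiberBundle.mem_baseSet_trivializationAt' x₀
  obtain ⟨χ, hχ1, hχ2⟩ := exists_contMDiff_bump (E := E) (t.open_baseSet.mem_nhds hx₀)
  let b := Module.finBasis ℝ F
  have hbase : ∀ᶠ x in 𝓝 x₀, x ∈ t.baseSet := t.open_baseSet.mem_nhds hx₀
  refine ⟨⟨fun i ↦ ⟨(χ : M → ℝ) • t.localFrame b i, χ.contMDiff.contMDiffOn.smul_section_of_tsupport
      t.open_baseSet hχ2 (t.contMDiffOn_localFrame_baseSet _ b i)⟩,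
    fun i x ↦ χ x • (LinearMap.toContinuousLinearMap (b.coord i)).comp
      (t.continuousLinearMapAt ℝ x), fun i y ↦ ?_, ?_, ?_⟩⟩
  · refine contMDiffAt_hom_of_apply (W := fun _ : M ↦ ℝ) fun s hs ↦
      contMDiffAt_section_trivial.2 ?_
    by_cases hy : y ∈ tsupport χ
    · have h1 : ContMDiffAt 𝓘(ℝ, E) 𝓘(ℝ, F) ∞ (fun x ↦ (t ⟨x, s x⟩).2) y :=
        (t.contMDiffAt_section_iff (hχ2 hy)).1 hs
      have h2 : ContMDiffAt 𝓘(ℝ, E) 𝓘(ℝ, ℝ) ∞ (fun x ↦ b.coord i (t ⟨x, s x⟩).2) y :=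
        (LinearMap.toContinuousLinearMap (b.coord i)).contDiff.contMDiff.contMDiffAt.comp y h1
      refine (χ.contMDiff.contMDiffAt.mul h2).congr_of_eventuallyEq ?_
      filter_upwards [t.open_baseSet.mem_nhds (hχ2 hy)] with x hx
      simp [t.coe_linearMapAt_of_mem hx]
    · refine (contMDiffAt_const (c := (0 : ℝ))).congr_of_eventuallyEq ?_
      filter_upwards [(isClosed_tsupport χ).isOpen_compl.mem_nhds hy] with x hx
      simp [image_eq_zero_of_notMem_tsupport hx]
  · filter_upwards [hχ1, hbase] with x hx hxb v
    have h := (t.basisAt b hxb).sum_repr v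
    simpa [hx, hxb, t.coe_linearMapAt_of_mem hxb, Bundle.Trivialization.basisAt] using h
  · filter_upwards [hχ1, hbase] with x hx hxb
    have h := (t.basisAt b hxb).linearIndependent
    simpa [hx, hxb] using h

theorem exists_section_eq (x : M) (v : V x) : ∃ s : Cₛ^∞⟮𝓘(ℝ, E); F, V⟯, s x = v := by
  obtain ⟨B⟩ := nonempty_localDualFrame (E := E) (F := F) (V := V) x
  exact ⟨∑ i, B.c i x v • B.e i, by simpa using B.sum_c.self_of_nhds v⟩

end Frames

end

/-! ### Pointwise derivations on sections -/

noncomputable section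

section Derivations

variable {E : Type*} [NormedAddCommGroup E] [NormedSpace ℝ E] [FiniteDimensional ℝ E]
  {M : Type*} [TopologicalSpace M] [ChartedSpace E M] [IsManifold 𝓘(ℝ, E) ∞ M] [T2Space M]
  {F : Type*} [NormedAddCommGroup F] [NormedSpace ℝ F]
  {V : M → Type*} [TopologicalSpace (TotalSpace F V)]
  [∀ x, AddCommGroup (V x)] [∀ x, Module ℝ (V x)] [∀ x, TopologicalSpace (V x)]
  [FiberBundle F V] [VectorBundle ℝ F V]

/-- `K` is a derivation at `x` on the sections of `V`, with symbol the tangent vector `w`. -/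
def IsDerivationAt {x : M} (w : TangentSpace 𝓘(ℝ, E) x) (K : Cₛ^∞⟮𝓘(ℝ, E); F, V⟯ →ₗ[ℝ] V x) :
    Prop :=
  ∀ (f : C^∞⟮𝓘(ℝ, E), M; 𝓘(ℝ, ℝ), ℝ⟯) (t : Cₛ^∞⟮𝓘(ℝ, E); F, V⟯),
    K (t.funSMul f) = f x • K t + mvfderiv 𝓘(ℝ, E) f x w • t x

namespace IsDerivationAt

variable {x : M} {w : TangentSpace 𝓘(ℝ, E) x} {K : Cₛ^∞⟮𝓘(ℝ, E); F, V⟯ →ₗ[ℝ] V x}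

/-- If the bump χ is supported where t = t', then χ(t - t') = 0. The Leibniz rule at x, where χ = 1
and t - t' vanishes, turns this into K(t - t') = 0. -/
theorem congr (hK : IsDerivationAt w K) {t t' : Cₛ^∞⟮𝓘(ℝ, E); F, V⟯}
    (h : ∀ᶠ y in 𝓝 x, t y = t' y) : K t = K t' := by
  obtain ⟨χ, hχ1, hχ2⟩ := exists_contMDiff_bump (E := E) h
  have h0 : (t - t').funSMul χ = 0 := by
    ext y
    by_cases hy : y ∈ tsupport χ
    · have : t y = t' y := hχ2 hy
      simp [this]
    · simp [image_eq_zero_of_notMem_tsupport hy]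
  have h1 := hK χ (t - t')
  rw [h0, map_zero, hχ1.self_of_nhds, ContMDiffSection.sub_apply, h.self_of_nhds, sub_self,
    smul_zero, add_zero, one_smul, map_sub] at h1
  exact (sub_eq_zero.1 h1.symm)

/-- By locality t may be replaced by its frame expansion. The frame may be centred at another point
x₀, so one frame serves all x near x₀. -/
theorem eq_sum (hK : IsDerivationAt w K) {x₀ : M} (B : LocalDualFrame E F V x₀)
    (hx : ∀ᶠ y in 𝓝 x, ∀ v : V y, ∑ i, B.c i y v • B.e i y = v)
    (t : Cₛ^∞⟮𝓘(ℝ, E); F, V⟯) :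
    K t = ∑ i, (B.coeff i t x • K (B.e i) + mvfderiv 𝓘(ℝ, E) (B.coeff i t) x w • B.e i x) := by
  have h1 : K t = K (∑ i, (B.e i).funSMul (B.coeff i t)) := by
    refine hK.congr ?_
    filter_upwards [hx] with y hy
    rw [ContMDiffSection.sum_apply]
    exact (hy (t y)).symm
  rw [h1, map_sum]
  exact Finset.sum_congr rfl fun i _ ↦ hK _ _

end IsDerivationAt

end Derivations

/-! ### First consequences of the Lie algebroid axioms -/

section Algebroid

variable {E : Type*} [NormedAddCommGroup E] [NormedSpace ℝ E]
  {M : Type*} [TopologicalSpace M] [ChartedSpace E M] [IsManifold 𝓘(ℝ, E) ∞ M]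
  {F : Type*} [NormedAddCommGroup F] [NormedSpace ℝ F]
  {V : M → Type*} [TopologicalSpace (TotalSpace F V)]
  [∀ x, AddCommGroup (V x)] [∀ x, Module ℝ (V x)] [∀ x, TopologicalSpace (V x)]
  [∀ x, IsTopologicalAddGroup (V x)] [∀ x, ContinuousSMul ℝ (V x)]
  [FiberBundle F V] [VectorBundle ℝ F V] [ContMDiffVectorBundle ∞ F V 𝓘(ℝ, E)]

namespace LieAlgebroid

theorem ext {𝒜 ℬ : LieAlgebroid E F V} (h₁ : ∀ x a, 𝒜.anchor x a = ℬ.anchor x a)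
    (h₂ : ∀ s t x, 𝒜.bracket s t x = ℬ.bracket s t x) : 𝒜 = ℬ := by
  have e₁ : 𝒜.anchor = ℬ.anchor := funext fun x ↦ ContinuousLinearMap.ext (h₁ x)
  have e₂ : 𝒜.bracket = ℬ.bracket :=
    LinearMap.ext fun s ↦ LinearMap.ext fun t ↦ ContMDiffSection.ext (h₂ s t)
  cases 𝒜; cases ℬ
  congr

variable (𝒜 : LieAlgebroid E F V)

theorem bracket_swap (s t : Cₛ^∞⟮𝓘(ℝ, E); F, V⟯) : 𝒜.bracket s t = -𝒜.bracket t s := by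
  have h := 𝒜.bracket_self (s + t)
  simp only [map_add, LinearMap.add_apply, 𝒜.bracket_self, zero_add, add_zero] at h
  exact eq_neg_of_add_eq_zero_right h

theorem bracket_swap_apply (s t : Cₛ^∞⟮𝓘(ℝ, E); F, V⟯) (x : M) :
    𝒜.bracket s t x = -𝒜.bracket t s x := by
  rw [𝒜.bracket_swap s t]; rfl

theorem contMDiff_anchor_apply (s : Cₛ^∞⟮𝓘(ℝ, E); F, V⟯) :
    ContMDiff 𝓘(ℝ, E) (𝓘(ℝ, E).prod 𝓘(ℝ, E)) ∞
      (fun x ↦ TotalSpace.mk' E x (𝒜.anchor x (s x))) :=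
  𝒜.anchor_contMDiff.clm_bundle_apply s.contMDiff

theorem mdifferentiableAt_anchor_apply (s : Cₛ^∞⟮𝓘(ℝ, E); F, V⟯) (x : M) :
    MDifferentiableAt 𝓘(ℝ, E) (𝓘(ℝ, E).prod 𝓘(ℝ, E))
      (fun x ↦ TotalSpace.mk' E x (𝒜.anchor x (s x))) x :=
  (𝒜.contMDiff_anchor_apply s).mdifferentiableAt (by simp)

theorem bracket_funSMul_right (f : C^∞⟮𝓘(ℝ, E), M; 𝓘(ℝ, ℝ), ℝ⟯) (s t : Cₛ^∞⟮𝓘(ℝ, E); F, V⟯)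
    (x : M) : 𝒜.bracket s (t.funSMul f) x =
      f x • 𝒜.bracket s t x + mvfderiv 𝓘(ℝ, E) f x (𝒜.anchor x (s x)) • t x :=
  𝒜.leibniz s t _ f f.contMDiff (fun _ ↦ rfl) x

theorem bracket_funSMul_left (f : C^∞⟮𝓘(ℝ, E), M; 𝓘(ℝ, ℝ), ℝ⟯) (s t : Cₛ^∞⟮𝓘(ℝ, E); F, V⟯)
    (x : M) : 𝒜.bracket (s.funSMul f) t x =
      f x • 𝒜.bracket s t x - mvfderiv 𝓘(ℝ, E) f x (𝒜.anchor x (t x)) • s x := by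
  rw [bracket_swap_apply, bracket_funSMul_right, 𝒜.bracket_swap_apply s t]
  module

variable (E F V) in
/-- Evaluation of sections at a point. -/
def _root_.ContMDiffSection.evalAt (x : M) : Cₛ^∞⟮𝓘(ℝ, E); F, V⟯ →ₗ[ℝ] V x where
  toFun s := s x
  map_add' _ _ := rfl
  map_smul' _ _ := rfl

theorem isDerivationAt_bracket (s : Cₛ^∞⟮𝓘(ℝ, E); F, V⟯) (x : M) :
    IsDerivationAt (𝒜.anchor x (s x)) ((ContMDiffSection.evalAt E F V x).comp (𝒜.bracket s)) :=
  fun f t ↦ 𝒜.bracket_funSMul_right f s t x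

variable [FiniteDimensional ℝ E] [T2Space M]

theorem bracket_congr_right (s : Cₛ^∞⟮𝓘(ℝ, E); F, V⟯) {t t' : Cₛ^∞⟮𝓘(ℝ, E); F, V⟯} {x : M}
    (h : ∀ᶠ y in 𝓝 x, t y = t' y) : 𝒜.bracket s t x = 𝒜.bracket s t' x :=
  (𝒜.isDerivationAt_bracket s x).congr h

end LieAlgebroid

end Algebroid

/-! ### Sections of pullback bundles -/

section Pullback

variable {E : Type*} [NormedAddCommGroup E] [NormedSpace ℝ E]
  {M : Type u} [TopologicalSpace M] [ChartedSpace E M] [IsManifold 𝓘(ℝ, E) ∞ M]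
  {F : Type*} [NormedAddCommGroup F] [NormedSpace ℝ F]
  {V : M → Type*} [TopologicalSpace (TotalSpace F V)]
  [∀ x, AddCommGroup (V x)] [∀ x, Module ℝ (V x)] [∀ x, TopologicalSpace (V x)]
  [FiberBundle F V] [VectorBundle ℝ F V]
  {E' : Type*} [NormedAddCommGroup E'] [NormedSpace ℝ E']
  {N : Type v} [TopologicalSpace N] [ChartedSpace E' N] [IsManifold 𝓘(ℝ, E') ∞ N]
  (ι : C^∞⟮𝓘(ℝ, E'), N; 𝓘(ℝ, E), M⟯)

/-- Pullback trivializations are those of V read along ι, so both sides are the same condition on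
the fibre coordinate. -/
theorem contMDiffAt_pullback_section {s : ∀ x : N, (ι *ᵖ V) x} {x₀ : N} :
    ContMDiffAt 𝓘(ℝ, E') (𝓘(ℝ, E').prod 𝓘(ℝ, F)) ∞ (fun x ↦ TotalSpace.mk' F x (s x)) x₀ ↔
      ContMDiffAt 𝓘(ℝ, E') (𝓘(ℝ, E).prod 𝓘(ℝ, F)) ∞
        (fun x ↦ TotalSpace.mk' F (E := V) (ι x) (s x)) x₀ := by
  rw [contMDiffAt_section, contMDiffAt_totalSpace]
  exact (and_iff_right ι.contMDiff.contMDiffAt).symm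

/-- The pullback of a smooth section along a smooth map of the base. -/
def ContMDiffSection.pullback (a : Cₛ^∞⟮𝓘(ℝ, E); F, V⟯) : Cₛ^∞⟮𝓘(ℝ, E'); F, (ι *ᵖ V)⟯ :=
  ⟨fun x ↦ a (ι x), fun x ↦ (contMDiffAt_pullback_section ι).2
    (a.contMDiff.contMDiffAt.comp x ι.contMDiff.contMDiffAt)⟩

theorem contMDiff_pullback_dual {c : ∀ x, V x →L[ℝ] ℝ} [FiniteDimensional ℝ F]
    [ContMDiffVectorBundle ∞ F V 𝓘(ℝ, E)]
    (hc : ContMDiff 𝓘(ℝ, E) (𝓘(ℝ, E).prod 𝓘(ℝ, F →L[ℝ] ℝ)) ∞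
      (fun x ↦ TotalSpace.mk' (F →L[ℝ] ℝ) (E := fun x ↦ V x →L[ℝ] ℝ) x (c x))) :
    ContMDiff 𝓘(ℝ, E') (𝓘(ℝ, E').prod 𝓘(ℝ, F →L[ℝ] ℝ)) ∞
      (fun x : N ↦ TotalSpace.mk' (F →L[ℝ] ℝ) (E := fun x : N ↦ (ι *ᵖ V) x →L[ℝ] ℝ) x
        (c (ι x))) := fun x₀ ↦ by
  refine contMDiffAt_hom_of_apply (V := ι *ᵖ V) (W := fun _ : N ↦ ℝ) fun s hs ↦
    contMDiffAt_section_trivial.2 ?_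
  replace hs := (contMDiffAt_pullback_section ι).1 hs
  exact (contMDiffAt_trivial_iff ι.contMDiff.contMDiffAt).1
    (ContMDiffAt.clm_bundle_apply (E₂ := fun _ : M ↦ ℝ)
      (hc.contMDiffAt.comp x₀ ι.contMDiff.contMDiffAt) hs)

/-- The pullback of a frame. -/
def LocalDualFrame.pullback [FiniteDimensional ℝ F] [ContMDiffVectorBundle ∞ F V 𝓘(ℝ, E)] {x₀ : N}
    (B : LocalDualFrame E F V (ι x₀)) : LocalDualFrame E' F (ι *ᵖ V) x₀ where
  e i := (B.e i).pullback ι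
  c i x := B.c i (ι x)
  contMDiff_c i := contMDiff_pullback_dual ι (B.contMDiff_c i)
  sum_c := ι.contMDiff.continuous.continuousAt.eventually B.sum_c
  linearIndependent := ι.contMDiff.continuous.continuousAt.eventually B.linearIndependent

variable [FiniteDimensional ℝ E] [T2Space M] [FiniteDimensional ℝ E'] [T2Space N]
  [FiniteDimensional ℝ F] [ContMDiffVectorBundle ∞ F V 𝓘(ℝ, E)]

/-- Near a point, every section of a pullback bundle is a combination of pullbacks of sections, so
that a local property can be checked on those. -/
theorem pullback_section_induction (x : N) {Q : Cₛ^∞⟮𝓘(ℝ, E'); F, (ι *ᵖ V)⟯ → Prop}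
    (pullback : ∀ a : Cₛ^∞⟮𝓘(ℝ, E); F, V⟯, Q (a.pullback ι))
    (add : ∀ s t, Q s → Q t → Q (s + t))
    (smul : ∀ f s, Q s → Q (ContMDiffSection.funSMul f s))
    (congr : ∀ s t : Cₛ^∞⟮𝓘(ℝ, E'); F, (ι *ᵖ V)⟯, (∀ᶠ y in 𝓝 x, s y = t y) → Q s → Q t)
    (s : Cₛ^∞⟮𝓘(ℝ, E'); F, (ι *ᵖ V)⟯) : Q s := by
  obtain ⟨B₀⟩ := nonempty_localDualFrame (E := E) (F := F) (V := V) (ι x)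
  let B := B₀.pullback ι
  have hsum : ∀ t : Finset (Fin (Module.finrank ℝ F)),
      Q (∑ i ∈ t, (B.e i).funSMul (B.coeff i s)) := by
    classical
    intro t
    induction t using Finset.induction_on with
    -- The zero section is the pullback of the zero section.
    | empty => exact pullback 0
    | insert i t hi h =>
      rw [Finset.sum_insert hi]
      exact add _ _ (smul _ _ (pullback _)) h
  refine congr _ _ ?_ (hsum Finset.univ)
  filter_upwards [B.sum_c] with y hy
  rw [ContMDiffSection.sum_apply]
  exact hy (s y)

end Pullback
end

/-! ### Related vector fields, and extension of derivations along a map -/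

noncomputable section

section Extension

variable {E : Type*} [NormedAddCommGroup E] [NormedSpace ℝ E] [FiniteDimensional ℝ E]
  {M : Type u} [TopologicalSpace M] [ChartedSpace E M] [IsManifold 𝓘(ℝ, E) ∞ M] [T2Space M]
  {F : Type*} [NormedAddCommGroup F] [NormedSpace ℝ F] [FiniteDimensional ℝ F]
  {V : M → Type*} [TopologicalSpace (TotalSpace F V)]
  [∀ x, AddCommGroup (V x)] [∀ x, Module ℝ (V x)] [∀ x, TopologicalSpace (V x)]
  [FiberBundle F V] [VectorBundle ℝ F V] [ContMDiffVectorBundle ∞ F V 𝓘(ℝ, E)]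
  {E' : Type*} [NormedAddCommGroup E'] [NormedSpace ℝ E'] [FiniteDimensional ℝ E']
  {N : Type v} [TopologicalSpace N] [ChartedSpace E' N] [IsManifold 𝓘(ℝ, E') ∞ N] [T2Space N]
  (ι : C^∞⟮𝓘(ℝ, E'), N; 𝓘(ℝ, E), M⟯)

theorem mvfderiv_comp_contMDiffMap {f : M → ℝ} (hf : ContMDiff 𝓘(ℝ, E) 𝓘(ℝ, ℝ) ∞ f) (x : N)
    (v : TangentSpace 𝓘(ℝ, E') x) :
    mvfderiv 𝓘(ℝ, E') (fun y ↦ f (ι y)) x v =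
      mvfderiv 𝓘(ℝ, E) f (ι x) (mfderiv 𝓘(ℝ, E') 𝓘(ℝ, E) ι x v) :=
  mvfderiv_comp_apply x (hf.mdifferentiableAt (by simp)) (ι.contMDiff.mdifferentiableAt (by simp)) v

/-- Lie brackets of related vector fields are related. -/
theorem mfderiv_mlieBracket_of_related {X Y : ∀ x : N, TangentSpace 𝓘(ℝ, E') x}
    {X' Y' : ∀ x : M, TangentSpace 𝓘(ℝ, E) x}
    (hX : ContMDiff 𝓘(ℝ, E') (𝓘(ℝ, E').prod 𝓘(ℝ, E')) ∞ (fun x ↦ TotalSpace.mk' E' x (X x)))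
    (hY : ContMDiff 𝓘(ℝ, E') (𝓘(ℝ, E').prod 𝓘(ℝ, E')) ∞ (fun x ↦ TotalSpace.mk' E' x (Y x)))
    (hX' : ContMDiff 𝓘(ℝ, E) (𝓘(ℝ, E).prod 𝓘(ℝ, E)) ∞ (fun x ↦ TotalSpace.mk' E x (X' x)))
    (hY' : ContMDiff 𝓘(ℝ, E) (𝓘(ℝ, E).prod 𝓘(ℝ, E)) ∞ (fun x ↦ TotalSpace.mk' E x (Y' x)))
    (hXX' : ∀ x, mfderiv 𝓘(ℝ, E') 𝓘(ℝ, E) ι x (X x) = X' (ι x))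
    (hYY' : ∀ x, mfderiv 𝓘(ℝ, E') 𝓘(ℝ, E) ι x (Y x) = Y' (ι x)) (x : N) :
    mfderiv 𝓘(ℝ, E') 𝓘(ℝ, E) ι x (mlieBracket 𝓘(ℝ, E') X Y x) =
      mlieBracket 𝓘(ℝ, E) X' Y' (ι x) := by
  by_contra hne
  -- A covector that separates the two vectors is the differential of a function f; both brackets
  -- then act as commutators, on f ∘ ι and on f, and relatedness makes the commutators agree.
  obtain ⟨ξ, hξ⟩ : ∃ ξ : E →L[ℝ] ℝ,
      ξ (mfderiv 𝓘(ℝ, E') 𝓘(ℝ, E) ι x (mlieBracket 𝓘(ℝ, E') X Y x)) ≠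
        ξ (mlieBracket 𝓘(ℝ, E) X' Y' (ι x)) := by
    by_contra! h
    exact hne ((SeparatingDual.eq_iff_forall_dual_eq (R := ℝ) (V := E)).2 h)
  obtain ⟨f, hf, hfξ⟩ := exists_mvfderiv_eq (ι x) ξ
  have hfι : ContMDiff 𝓘(ℝ, E') 𝓘(ℝ, ℝ) ∞ (fun y ↦ f (ι y)) := hf.comp ι.contMDiff
  apply hξ
  have key : ∀ {Z W : ∀ x : N, TangentSpace 𝓘(ℝ, E') x} {Z' W' : ∀ x : M, TangentSpace 𝓘(ℝ, E) x},
      ContMDiff 𝓘(ℝ, E) (𝓘(ℝ, E).prod 𝓘(ℝ, E)) ∞ (fun x ↦ TotalSpace.mk' E x (Z' x)) →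
      (∀ x, mfderiv 𝓘(ℝ, E') 𝓘(ℝ, E) ι x (Z x) = Z' (ι x)) →
      (∀ x, mfderiv 𝓘(ℝ, E') 𝓘(ℝ, E) ι x (W x) = W' (ι x)) →
      mvfderiv 𝓘(ℝ, E') (fun y ↦ mvfderiv 𝓘(ℝ, E') (fun y ↦ f (ι y)) y (Z y)) x (W x) =
        mvfderiv 𝓘(ℝ, E) (fun y ↦ mvfderiv 𝓘(ℝ, E) f y (Z' y)) (ι x) (W' (ι x)) := by
    intro Z W Z' W' hZ' hZ hW
    rw [← hW, ← mvfderiv_comp_contMDiffMap ι fun z ↦ ContMDiffAt.mvfderiv_apply hf (hZ' z)]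
    congr 2
    ext y
    rw [mvfderiv_comp_contMDiffMap ι hf, hZ]
  have h1 := mvfderiv_mlieBracket (x := x) hfι (hX.mdifferentiableAt (by simp))
    (hY.mdifferentiableAt (by simp))
  have h2 := mvfderiv_mlieBracket (x := ι x) hf (hX'.mdifferentiableAt (by simp))
    (hY'.mdifferentiableAt (by simp))
  rw [key hY' hYY' hXX', key hX' hXX' hYY', ← h2, mvfderiv_comp_contMDiffMap ι hf, hfξ] at h1
  exact h1

variable (E F V) in
/-- A choice of a frame near each point. -/
def localDualFrameAt (x : M) : LocalDualFrame E F V x := (nonempty_localDualFrame x).some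

variable {ι}

theorem LocalDualFrame.sum_coeff {x : M} (B : LocalDualFrame E F V x)
    (s : Cₛ^∞⟮𝓘(ℝ, E); F, V⟯) : ∑ i, B.coeff i s x • B.e i x = s x :=
  B.sum_c.self_of_nhds (s x)

variable (ι) in
/-- The extension of a derivation on the sections of `V` to one on the sections of its pullback. -/
def extendDerivation {x : N} (v : TangentSpace 𝓘(ℝ, E') x)
    (K : Cₛ^∞⟮𝓘(ℝ, E); F, V⟯ →ₗ[ℝ] (ι *ᵖ V) x) :
    Cₛ^∞⟮𝓘(ℝ, E'); F, (ι *ᵖ V)⟯ →ₗ[ℝ] (ι *ᵖ V) x where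
  toFun s := ∑ i, (((localDualFrameAt E F V (ι x)).pullback ι).coeff i s x •
      K ((localDualFrameAt E F V (ι x)).e i) +
    mvfderiv 𝓘(ℝ, E') (((localDualFrameAt E F V (ι x)).pullback ι).coeff i s) x v •
      ((localDualFrameAt E F V (ι x)).e i).pullback ι x)
  map_add' s t := by
    rw [← Finset.sum_add_distrib]
    refine Finset.sum_congr rfl fun i _ ↦ ?_
    set B := (localDualFrameAt E F V (ι x)).pullback ι
    have h : (B.coeff i (s + t) : N → ℝ) = (B.coeff i s : N → ℝ) + B.coeff i t := by
      ext y; simp [LocalDualFrame.coeff_apply]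
    rw [h, mvfderiv_add ((B.coeff i s).contMDiff.mdifferentiableAt (by simp))
      ((B.coeff i t).contMDiff.mdifferentiableAt (by simp))]
    simp only [Pi.add_apply, _root_.add_apply]
    module
  map_smul' r s := by
    rw [RingHom.id_apply, Finset.smul_sum]
    refine Finset.sum_congr rfl fun i _ ↦ ?_
    set B := (localDualFrameAt E F V (ι x)).pullback ι
    have h : (B.coeff i (r • s) : N → ℝ) = (fun _ : N ↦ r) * (B.coeff i s : N → ℝ) := by
      ext y; simp [LocalDualFrame.coeff_apply]
    rw [h, mvfderiv_mul mdifferentiableAt_const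
      ((B.coeff i s).contMDiff.mdifferentiableAt (by simp)), mvfderiv_const]
    simp only [Pi.mul_apply, _root_.smul_apply, smul_zero, add_zero, smul_eq_mul]
    module

theorem extendDerivation_apply {x : N} (v : TangentSpace 𝓘(ℝ, E') x)
    (K : Cₛ^∞⟮𝓘(ℝ, E); F, V⟯ →ₗ[ℝ] (ι *ᵖ V) x) (s : Cₛ^∞⟮𝓘(ℝ, E'); F, (ι *ᵖ V)⟯) :
    extendDerivation ι v K s =
      ∑ i, (((localDualFrameAt E F V (ι x)).pullback ι).coeff i s x •
        K ((localDualFrameAt E F V (ι x)).e i) +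
      mvfderiv 𝓘(ℝ, E') (((localDualFrameAt E F V (ι x)).pullback ι).coeff i s) x v •
        ((localDualFrameAt E F V (ι x)).e i).pullback ι x) := rfl

/-- The Leibniz term comes from differentiating the coefficients alone, so nothing is asked of K
here. -/
theorem isDerivationAt_extendDerivation {x : N} (v : TangentSpace 𝓘(ℝ, E') x)
    (K : Cₛ^∞⟮𝓘(ℝ, E); F, V⟯ →ₗ[ℝ] (ι *ᵖ V) x) : IsDerivationAt v (extendDerivation ι v K) := by
  intro f s
  rw [extendDerivation_apply, extendDerivation_apply]
  rw [← ((localDualFrameAt E F V (ι x)).pullback ι).sum_coeff s, Finset.smul_sum, Finset.smul_sum,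
    ← Finset.sum_add_distrib]
  refine Finset.sum_congr rfl fun i _ ↦ ?_
  change _ = _ + _ • (_ • ((localDualFrameAt E F V (ι x)).e i).pullback ι x)
  set B := (localDualFrameAt E F V (ι x)).pullback ι
  have h : (B.coeff i (s.funSMul f) : N → ℝ) = (f : N → ℝ) * (B.coeff i s : N → ℝ) := by
    ext y; simp [LocalDualFrame.coeff_apply]
  rw [h, mvfderiv_mul (f.contMDiff.mdifferentiableAt (by simp))
    ((B.coeff i s).contMDiff.mdifferentiableAt (by simp))]
  simp only [Pi.mul_apply, _root_.add_apply, _root_.smul_apply,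
    smul_eq_mul]
  module

/-- The coefficients of a pulled-back section are coefficients composed with ι. The chain rule then
matches the defining sum with the expansion of K a in the frame, which requires K to have symbol
dι(v). -/
theorem extendDerivation_pullback {x : N} {v : TangentSpace 𝓘(ℝ, E') x}
    {K : Cₛ^∞⟮𝓘(ℝ, E); F, V⟯ →ₗ[ℝ] (ι *ᵖ V) x}
    (hK : IsDerivationAt (mfderiv 𝓘(ℝ, E') 𝓘(ℝ, E) ι x v) (V := V) K) (a : Cₛ^∞⟮𝓘(ℝ, E); F, V⟯) :
    extendDerivation ι v K (a.pullback ι) = K a := by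
  rw [extendDerivation_apply]
  refine Eq.trans ?_ (hK.eq_sum (localDualFrameAt E F V (ι x))
    (localDualFrameAt E F V (ι x)).sum_c a).symm
  refine Finset.sum_congr rfl fun i _ ↦ ?_
  rw [← mvfderiv_comp_contMDiffMap ι (ContMDiffMap.contMDiff _)]
  rfl

theorem extendDerivation_add {x : N} (v v' : TangentSpace 𝓘(ℝ, E') x)
    (K K' : Cₛ^∞⟮𝓘(ℝ, E); F, V⟯ →ₗ[ℝ] (ι *ᵖ V) x) (s : Cₛ^∞⟮𝓘(ℝ, E'); F, (ι *ᵖ V)⟯) :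
    extendDerivation ι (v + v') (K + K') s =
      extendDerivation ι v K s + extendDerivation ι v' K' s := by
  simp only [extendDerivation_apply, ← Finset.sum_add_distrib, map_add, LinearMap.add_apply]
  refine Finset.sum_congr rfl fun i _ ↦ ?_
  module

theorem extendDerivation_smul {x : N} (r : ℝ) (v : TangentSpace 𝓘(ℝ, E') x)
    (K : Cₛ^∞⟮𝓘(ℝ, E); F, V⟯ →ₗ[ℝ] (ι *ᵖ V) x) (s : Cₛ^∞⟮𝓘(ℝ, E'); F, (ι *ᵖ V)⟯) :
    extendDerivation ι (r • v) (r • K) s = r • extendDerivation ι v K s := by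
  simp only [extendDerivation_apply, Finset.smul_sum, map_smul, LinearMap.smul_apply]
  refine Finset.sum_congr rfl fun i _ ↦ ?_
  simp only [smul_eq_mul]
  module

/-- The frame in the definition is chosen anew at each x. Since the extension is a derivation, its
value can be recomputed in one frame fixed near x₀, where every ingredient is smooth. -/
theorem contMDiff_extendDerivation {X : ∀ x : N, TangentSpace 𝓘(ℝ, E') x}
    (hX : ContMDiff 𝓘(ℝ, E') (𝓘(ℝ, E').prod 𝓘(ℝ, E')) ∞ (fun x ↦ TotalSpace.mk' E' x (X x)))
    {K : ∀ x : N, Cₛ^∞⟮𝓘(ℝ, E); F, V⟯ →ₗ[ℝ] (ι *ᵖ V) x}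
    (hK : ∀ x, IsDerivationAt (mfderiv 𝓘(ℝ, E') 𝓘(ℝ, E) ι x (X x)) (V := V) (K x))
    (hKs : ∀ a : Cₛ^∞⟮𝓘(ℝ, E); F, V⟯, ContMDiff 𝓘(ℝ, E') (𝓘(ℝ, E').prod 𝓘(ℝ, F)) ∞
      (fun x ↦ TotalSpace.mk' F (E := ι *ᵖ V) x (K x a)))
    (s : Cₛ^∞⟮𝓘(ℝ, E'); F, (ι *ᵖ V)⟯) :
    ContMDiff 𝓘(ℝ, E') (𝓘(ℝ, E').prod 𝓘(ℝ, F)) ∞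
      (fun x ↦ TotalSpace.mk' F (E := ι *ᵖ V) x (extendDerivation ι (X x) (K x) s)) := by
  intro x₀
  let B := (localDualFrameAt E F V (ι x₀)).pullback ι
  have h1 : ContMDiffAt 𝓘(ℝ, E') (𝓘(ℝ, E').prod 𝓘(ℝ, F)) ∞
      (fun x ↦ TotalSpace.mk' F (E := ι *ᵖ V) x
        (∑ i, (B.coeff i s x • (K x ((localDualFrameAt E F V (ι x₀)).e i) : (ι *ᵖ V) x) +
          mvfderiv 𝓘(ℝ, E') (B.coeff i s) x (X x) • B.e i x))) x₀ := by
    refine ContMDiffAt.sum_section fun i _ ↦ ?_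
    exact ContMDiffAt.add_section
      ((B.coeff i s).contMDiff.contMDiffAt.smul_section (hKs _ x₀))
      ((ContMDiffAt.mvfderiv_apply (B.coeff i s).contMDiff (hX x₀)).smul_section
        ((B.e i).contMDiff x₀))
  refine h1.congr_of_eventuallyEq ?_
  -- The expansion at x needs the frame identity on a neighbourhood of x, hence the iterated filter.
  filter_upwards [eventually_eventually_nhds.2 B.sum_c] with x hx
  congr 1
  rw [(isDerivationAt_extendDerivation (X x) (K x)).eq_sum B hx]
  refine Finset.sum_congr rfl fun i _ ↦ ?_
  congr 2
  exact extendDerivation_pullback (hK x) _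

end Extension
end

/-! ### Anchor and bracket of the restricted Lie algebroid -/

noncomputable section

section Restriction

variable {E : Type*} [NormedAddCommGroup E] [NormedSpace ℝ E] [FiniteDimensional ℝ E]
  {M : Type u} [TopologicalSpace M] [ChartedSpace E M] [IsManifold 𝓘(ℝ, E) ∞ M] [T2Space M]
  {F : Type*} [NormedAddCommGroup F] [NormedSpace ℝ F] [FiniteDimensional ℝ F]
  {V : M → Type*} [TopologicalSpace (TotalSpace F V)]
  [∀ x, AddCommGroup (V x)] [∀ x, Module ℝ (V x)] [∀ x, TopologicalSpace (V x)]
  [∀ x, IsTopologicalAddGroup (V x)] [∀ x, ContinuousSMul ℝ (V x)]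
  [FiberBundle F V] [VectorBundle ℝ F V] [ContMDiffVectorBundle ∞ F V 𝓘(ℝ, E)]
  {E' : Type*} [NormedAddCommGroup E'] [NormedSpace ℝ E'] [FiniteDimensional ℝ E']
  {N : Type v} [TopologicalSpace N] [ChartedSpace E' N] [IsManifold 𝓘(ℝ, E') ∞ N] [T2Space N]
  {ι : C^∞⟮𝓘(ℝ, E'), N; 𝓘(ℝ, E), M⟯} {𝒜 : LieAlgebroid E F V}

/-- A function of three sections of a pullback bundle that is cyclically symmetric and tensorial
in the last argument vanishes if it vanishes on pullbacks of sections. -/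
theorem pullback_section_induction₃ {A : Type*} [AddCommGroup A] [Module ℝ A] (x : N)
    {J : Cₛ^∞⟮𝓘(ℝ, E'); F, (ι *ᵖ V)⟯ → Cₛ^∞⟮𝓘(ℝ, E'); F, (ι *ᵖ V)⟯ →
      Cₛ^∞⟮𝓘(ℝ, E'); F, (ι *ᵖ V)⟯ → A}
    (cyclic : ∀ s t w, J s t w = J t w s)
    (add : ∀ s t w w', J s t (w + w') = J s t w + J s t w')
    (smul : ∀ s t f w, J s t (ContMDiffSection.funSMul f w) = f x • J s t w)
    (congr : ∀ s t w w', (∀ᶠ y in 𝓝 x, w y = w' y) → J s t w = J s t w')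
    (pullback : ∀ a b c : Cₛ^∞⟮𝓘(ℝ, E); F, V⟯,
      J (a.pullback ι) (b.pullback ι) (c.pullback ι) = 0)
    (s t w : Cₛ^∞⟮𝓘(ℝ, E'); F, (ι *ᵖ V)⟯) : J s t w = 0 := by
  have step : ∀ s t, (∀ c : Cₛ^∞⟮𝓘(ℝ, E); F, V⟯, J s t (c.pullback ι) = 0) → ∀ w, J s t w = 0 := by
    intro s t h w
    refine pullback_section_induction ι x (Q := fun w ↦ J s t w = 0) h ?_ ?_ ?_ w
    · intro w w' hw hw'
      rw [add, hw, hw', add_zero]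
    · intro f w hw
      rw [smul, hw, smul_zero]
    · intro w w' hww' hw
      rw [← congr s t w w' hww', hw]
  -- Each application of `step` frees the last argument, and a cyclic rotation brings the next
  -- restricted one into that place.
  have h1 : ∀ (a b : Cₛ^∞⟮𝓘(ℝ, E); F, V⟯) w, J (a.pullback ι) (b.pullback ι) w = 0 :=
    fun a b w ↦ step _ _ (pullback a b) w
  have h2 : ∀ (a : Cₛ^∞⟮𝓘(ℝ, E); F, V⟯) t w, J w (a.pullback ι) t = 0 :=
    fun a t w ↦ step _ _ (fun b ↦ by rw [cyclic, h1]) t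
  exact step s t (fun a ↦ by rw [cyclic, h2]) w

namespace LieAlgebroid.IsIntegralSubmanifold

variable (h𝒜 : 𝒜.IsIntegralSubmanifold ι)

/-- The anchor of the restriction of a Lie algebroid. -/
def restrictAnchor (x : N) : (ι *ᵖ V) x →L[ℝ] TangentSpace 𝓘(ℝ, E') x :=
  haveI : T2Space (TangentSpace 𝓘(ℝ, E) (ι x)) := inferInstanceAs (T2Space E)
  haveI : FiniteDimensional ℝ (TangentSpace 𝓘(ℝ, E) (ι x)) :=
    inferInstanceAs (FiniteDimensional ℝ E)
  (LinearMap.toContinuousLinearMap (E := TangentSpace 𝓘(ℝ, E) (ι x))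
    (LinearMap.exists_leftInverse_of_injective
      (mfderiv 𝓘(ℝ, E') 𝓘(ℝ, E) ι x : TangentSpace 𝓘(ℝ, E') x →ₗ[ℝ] TangentSpace 𝓘(ℝ, E) (ι x))
      (LinearMap.ker_eq_bot.2 (h𝒜.immersion x))).choose).comp (𝒜.anchor (ι x))

/-- The left inverse of dι is arbitrary, but the anchor takes values in the range of dι, where every
left inverse is the true inverse. -/
theorem mfderiv_restrictAnchor (x : N) (a : (ι *ᵖ V) x) :
    mfderiv 𝓘(ℝ, E') 𝓘(ℝ, E) ι x (h𝒜.restrictAnchor x a) = 𝒜.anchor (ι x) a := by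
  obtain ⟨v, hv⟩ : 𝒜.anchor (ι x) a ∈ range (mfderiv 𝓘(ℝ, E') 𝓘(ℝ, E) ι x) := by
    rw [h𝒜.tangent x]; exact mem_range_self a
  have hL := (LinearMap.exists_leftInverse_of_injective
      (mfderiv 𝓘(ℝ, E') 𝓘(ℝ, E) ι x : TangentSpace 𝓘(ℝ, E') x →ₗ[ℝ] TangentSpace 𝓘(ℝ, E) (ι x))
      (LinearMap.ker_eq_bot.2 (h𝒜.immersion x))).choose_spec
  have h1 : h𝒜.restrictAnchor x a = v :=
    (congrArg (LinearMap.exists_leftInverse_of_injective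
      (mfderiv 𝓘(ℝ, E') 𝓘(ℝ, E) ι x : TangentSpace 𝓘(ℝ, E') x →ₗ[ℝ] TangentSpace 𝓘(ℝ, E) (ι x))
      (LinearMap.ker_eq_bot.2 (h𝒜.immersion x))).choose hv.symm).trans (LinearMap.congr_fun hL v)
  rw [h1, hv]

/-- The left inverses were chosen without regard to smoothness. Composing with the injective dι
gives back the smooth anchor along ι, and smoothness descends. -/
theorem contMDiff_restrictAnchor : ContMDiff 𝓘(ℝ, E') (𝓘(ℝ, E').prod 𝓘(ℝ, F →L[ℝ] E')) ∞
    (fun x ↦ TotalSpace.mk' (F →L[ℝ] E') (E := fun x ↦ (ι *ᵖ V) x →L[ℝ] TangentSpace 𝓘(ℝ, E') x)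
      x (h𝒜.restrictAnchor x)) := by
  intro x₀
  refine contMDiffAt_hom_of_apply (V := ι *ᵖ V) (W := (TangentSpace 𝓘(ℝ, E') : N → Type _))
    fun s hs ↦ contMDiffAt_vectorField_of_mfderiv ι.contMDiff (h𝒜.immersion x₀) ?_
  simp only [h𝒜.mfderiv_restrictAnchor]
  exact ContMDiffAt.clm_bundle_apply (E₁ := V) (b := ι)
    (𝒜.anchor_contMDiff.contMDiffAt.comp x₀ ι.contMDiff.contMDiffAt)
    ((contMDiffAt_pullback_section ι).1 hs)

theorem contMDiff_restrictAnchor_apply (s : Cₛ^∞⟮𝓘(ℝ, E'); F, (ι *ᵖ V)⟯) :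
    ContMDiff 𝓘(ℝ, E') (𝓘(ℝ, E').prod 𝓘(ℝ, E')) ∞
      (fun x ↦ TotalSpace.mk' E' x (h𝒜.restrictAnchor x (s x))) :=
  h𝒜.contMDiff_restrictAnchor.clm_bundle_apply s.contMDiff

variable (𝒜 ι) in
/-- The map `a ↦ [b, a](ι x)`. -/
def bracketAt (b : Cₛ^∞⟮𝓘(ℝ, E); F, V⟯) (x : N) : Cₛ^∞⟮𝓘(ℝ, E); F, V⟯ →ₗ[ℝ] (ι *ᵖ V) x where
  toFun a := (𝒜.bracket b a).pullback ι x
  map_add' a a' := by rw [map_add]; rfl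
  map_smul' r a := by rw [map_smul]; rfl

variable (𝒜 ι) in
theorem bracketAt_apply (a b : Cₛ^∞⟮𝓘(ℝ, E); F, V⟯) (x : N) :
    bracketAt ι 𝒜 b x a = (𝒜.bracket b a).pullback ι x := rfl

/-- The bracket of the restriction of the section `b` with a section of the restricted bundle. -/
def halfBracket (b : Cₛ^∞⟮𝓘(ℝ, E); F, V⟯) (s : Cₛ^∞⟮𝓘(ℝ, E'); F, (ι *ᵖ V)⟯) (x : N) :
    (ι *ᵖ V) x :=
  extendDerivation ι (h𝒜.restrictAnchor x (b.pullback ι x)) (bracketAt ι 𝒜 b x) s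

theorem isDerivationAt_bracketAt (b : Cₛ^∞⟮𝓘(ℝ, E); F, V⟯) (x : N) :
    IsDerivationAt (mfderiv 𝓘(ℝ, E') 𝓘(ℝ, E) ι x (h𝒜.restrictAnchor x (b.pullback ι x)))
      (V := V) (bracketAt ι 𝒜 b x) := by
  rw [h𝒜.mfderiv_restrictAnchor]
  exact 𝒜.isDerivationAt_bracket b (ι x)

theorem halfBracket_pullback (a b : Cₛ^∞⟮𝓘(ℝ, E); F, V⟯) (x : N) :
    h𝒜.halfBracket b (a.pullback ι) x = (𝒜.bracket b a).pullback ι x :=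
  extendDerivation_pullback (h𝒜.isDerivationAt_bracketAt b x) a

theorem contMDiff_halfBracket (b : Cₛ^∞⟮𝓘(ℝ, E); F, V⟯) (s : Cₛ^∞⟮𝓘(ℝ, E'); F, (ι *ᵖ V)⟯) :
    ContMDiff 𝓘(ℝ, E') (𝓘(ℝ, E').prod 𝓘(ℝ, F)) ∞
      (fun x ↦ TotalSpace.mk' F (E := ι *ᵖ V) x (h𝒜.halfBracket b s x)) :=
  contMDiff_extendDerivation (h𝒜.contMDiff_restrictAnchor_apply _) (h𝒜.isDerivationAt_bracketAt b)
    (fun a ↦ ((𝒜.bracket b a).pullback ι).contMDiff) s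

theorem halfBracket_funSMul (b : Cₛ^∞⟮𝓘(ℝ, E); F, V⟯) (f : C^∞⟮𝓘(ℝ, E'), N; 𝓘(ℝ, ℝ), ℝ⟯)
    (s : Cₛ^∞⟮𝓘(ℝ, E'); F, (ι *ᵖ V)⟯) (x : N) :
    h𝒜.halfBracket b (s.funSMul f) x = f x • h𝒜.halfBracket b s x +
      mvfderiv 𝓘(ℝ, E') f x (h𝒜.restrictAnchor x (b.pullback ι x)) • s x :=
  isDerivationAt_extendDerivation _ _ f s

/-- The corrections -(ρ(e_i)f) b, weighted by the coefficients of s, add up to -(ρ(s)f) b. This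
makes b ↦ -[b, s] a derivation with symbol dι(ρ_N s), ready for the second extension. -/
theorem halfBracket_funSMul_left (f : C^∞⟮𝓘(ℝ, E), M; 𝓘(ℝ, ℝ), ℝ⟯) (b : Cₛ^∞⟮𝓘(ℝ, E); F, V⟯)
    (s : Cₛ^∞⟮𝓘(ℝ, E'); F, (ι *ᵖ V)⟯) (x : N) :
    h𝒜.halfBracket (b.funSMul f) s x = f (ι x) • h𝒜.halfBracket b s x -
      mvfderiv 𝓘(ℝ, E) f (ι x) (mfderiv 𝓘(ℝ, E') 𝓘(ℝ, E) ι x (h𝒜.restrictAnchor x (s x))) •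
        b.pullback ι x := by
  simp only [halfBracket, extendDerivation_apply]
  set B := localDualFrameAt E F V (ι x)
  rw [← (B.pullback ι).sum_coeff s, map_sum, map_sum, map_sum, Finset.sum_smul, Finset.smul_sum,
    ← Finset.sum_sub_distrib]
  refine Finset.sum_congr rfl fun i _ ↦ ?_
  have h1 : (b.funSMul f).pullback ι x = f (ι x) • b.pullback ι x := rfl
  have h2 : bracketAt ι 𝒜 (b.funSMul f) x (B.e i) =
      f (ι x) • bracketAt ι 𝒜 b x (B.e i) -
      mvfderiv 𝓘(ℝ, E) f (ι x) (𝒜.anchor (ι x) (B.e i (ι x))) • b.pullback ι x :=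
    𝒜.bracket_funSMul_left f b (B.e i) (ι x)
  have h3 : mfderiv 𝓘(ℝ, E') 𝓘(ℝ, E) ι x (h𝒜.restrictAnchor x ((B.pullback ι).e i x)) =
    𝒜.anchor (ι x) (B.e i (ι x)) := h𝒜.mfderiv_restrictAnchor x _
  rw [h1, h2, map_smul, map_smul, map_smul, map_smul, map_smul, h3]
  simp only [smul_eq_mul]
  module

/-- `b ↦ [s, b]`, where `s` is a section of the restricted bundle. -/
def bracketPullback (s : Cₛ^∞⟮𝓘(ℝ, E'); F, (ι *ᵖ V)⟯) (x : N) :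
    Cₛ^∞⟮𝓘(ℝ, E); F, V⟯ →ₗ[ℝ] (ι *ᵖ V) x where
  toFun b := -h𝒜.halfBracket b s x
  map_add' b b' := by
    have h1 : (b + b').pullback ι x = b.pullback ι x + b'.pullback ι x := rfl
    have h2 : bracketAt ι 𝒜 (b + b') x = bracketAt ι 𝒜 b x + bracketAt ι 𝒜 b' x := by
      ext a
      simp only [LinearMap.add_apply, bracketAt_apply, map_add]
      rfl
    simp only [halfBracket]
    rw [h1, h2, map_add, extendDerivation_add, neg_add]
  map_smul' r b := by
    have h1 : (r • b).pullback ι x = r • b.pullback ι x := rfl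
    have h2 : bracketAt ι 𝒜 (r • b) x = r • bracketAt ι 𝒜 b x := by
      ext a
      simp only [LinearMap.smul_apply, bracketAt_apply, map_smul]
      rfl
    simp only [halfBracket]
    rw [h1, h2, map_smul, extendDerivation_smul, RingHom.id_apply, smul_neg]

theorem bracketPullback_apply (s : Cₛ^∞⟮𝓘(ℝ, E'); F, (ι *ᵖ V)⟯) (x : N)
    (b : Cₛ^∞⟮𝓘(ℝ, E); F, V⟯) : h𝒜.bracketPullback s x b = -h𝒜.halfBracket b s x := rfl

theorem isDerivationAt_bracketPullback (s : Cₛ^∞⟮𝓘(ℝ, E'); F, (ι *ᵖ V)⟯) (x : N) :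
    IsDerivationAt (mfderiv 𝓘(ℝ, E') 𝓘(ℝ, E) ι x (h𝒜.restrictAnchor x (s x)))
      (V := V) (h𝒜.bracketPullback s x) := by
  intro f b
  have h : -h𝒜.halfBracket (b.funSMul f) s x = f (ι x) • -h𝒜.halfBracket b s x +
      mvfderiv 𝓘(ℝ, E) f (ι x) (mfderiv 𝓘(ℝ, E') 𝓘(ℝ, E) ι x (h𝒜.restrictAnchor x (s x))) •
        b.pullback ι x := by
    rw [halfBracket_funSMul_left]
    module
  exact h

/-- The bracket of the restriction of a Lie algebroid to an integral submanifold. -/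
def restrictBracketFun (s t : Cₛ^∞⟮𝓘(ℝ, E'); F, (ι *ᵖ V)⟯) : Cₛ^∞⟮𝓘(ℝ, E'); F, (ι *ᵖ V)⟯ :=
  ⟨fun x ↦ extendDerivation ι (h𝒜.restrictAnchor x (s x)) (h𝒜.bracketPullback s x) t,
    contMDiff_extendDerivation (h𝒜.contMDiff_restrictAnchor_apply s)
      (h𝒜.isDerivationAt_bracketPullback s)
      (fun b ↦ (-(⟨_, h𝒜.contMDiff_halfBracket b s⟩ : Cₛ^∞⟮𝓘(ℝ, E'); F, (ι *ᵖ V)⟯)).contMDiff) t⟩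

theorem restrictBracketFun_apply (s t : Cₛ^∞⟮𝓘(ℝ, E'); F, (ι *ᵖ V)⟯) (x : N) :
    h𝒜.restrictBracketFun s t x =
      extendDerivation ι (h𝒜.restrictAnchor x (s x)) (h𝒜.bracketPullback s x) t := rfl

/-- The bracket of the restriction of a Lie algebroid to an integral submanifold, as a bilinear
map. -/
def restrictBracket : Cₛ^∞⟮𝓘(ℝ, E'); F, (ι *ᵖ V)⟯ →ₗ[ℝ] Cₛ^∞⟮𝓘(ℝ, E'); F, (ι *ᵖ V)⟯ →ₗ[ℝ]
    Cₛ^∞⟮𝓘(ℝ, E'); F, (ι *ᵖ V)⟯ :=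
  LinearMap.mk₂ ℝ h𝒜.restrictBracketFun
    (fun s s' t ↦ by
      ext x
      rw [ContMDiffSection.add_apply]
      simp only [restrictBracketFun_apply]
      rw [ContMDiffSection.add_apply, ← extendDerivation_add, ← map_add]
      congr 2
      ext b
      simp only [LinearMap.add_apply, bracketPullback_apply, halfBracket, map_add, neg_add])
    (fun r s t ↦ by
      ext x
      rw [ContMDiffSection.smul_apply]
      simp only [restrictBracketFun_apply]
      rw [ContMDiffSection.smul_apply, ← extendDerivation_smul, ← map_smul]
      congr 2
      ext b
      simp only [LinearMap.smul_apply, bracketPullback_apply, halfBracket, map_smul, smul_neg])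
    (fun s t t' ↦ by
      ext x
      rw [ContMDiffSection.add_apply]
      simp only [restrictBracketFun_apply, map_add])
    (fun r s t ↦ by
      ext x
      rw [ContMDiffSection.smul_apply]
      simp only [restrictBracketFun_apply, map_smul])

theorem restrictBracket_apply (s t : Cₛ^∞⟮𝓘(ℝ, E'); F, (ι *ᵖ V)⟯) (x : N) :
    h𝒜.restrictBracket s t x =
      extendDerivation ι (h𝒜.restrictAnchor x (s x)) (h𝒜.bracketPullback s x) t := rfl

theorem restrictBracket_pullback_right (s : Cₛ^∞⟮𝓘(ℝ, E'); F, (ι *ᵖ V)⟯)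
    (b : Cₛ^∞⟮𝓘(ℝ, E); F, V⟯) (x : N) :
    h𝒜.restrictBracket s (b.pullback ι) x = -h𝒜.halfBracket b s x :=
  extendDerivation_pullback (h𝒜.isDerivationAt_bracketPullback s x) b

/-- Both sides extend derivations with the same symbol, and these agree on V because [b, a] = -[a,
b] there. -/
theorem restrictBracket_pullback_left (b : Cₛ^∞⟮𝓘(ℝ, E); F, V⟯)
    (s : Cₛ^∞⟮𝓘(ℝ, E'); F, (ι *ᵖ V)⟯) (x : N) :
    h𝒜.restrictBracket (b.pullback ι) s x = h𝒜.halfBracket b s x := by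
  rw [restrictBracket_apply, halfBracket]
  congr 2
  ext a
  rw [bracketPullback_apply, halfBracket_pullback, bracketAt_apply, 𝒜.bracket_swap b a]
  rfl

theorem restrictBracket_pullback (a b : Cₛ^∞⟮𝓘(ℝ, E); F, V⟯) :
    h𝒜.restrictBracket (a.pullback ι) (b.pullback ι) = (𝒜.bracket a b).pullback ι := by
  ext x
  rw [restrictBracket_pullback_left, halfBracket_pullback]

theorem restrictBracket_funSMul_right (f : C^∞⟮𝓘(ℝ, E'), N; 𝓘(ℝ, ℝ), ℝ⟯)
    (s t : Cₛ^∞⟮𝓘(ℝ, E'); F, (ι *ᵖ V)⟯) (x : N) :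
    h𝒜.restrictBracket s (t.funSMul f) x = f x • h𝒜.restrictBracket s t x +
      mvfderiv 𝓘(ℝ, E') f x (h𝒜.restrictAnchor x (s x)) • t x :=
  isDerivationAt_extendDerivation _ _ f t

theorem restrictBracket_congr_right (s : Cₛ^∞⟮𝓘(ℝ, E'); F, (ι *ᵖ V)⟯)
    {t t' : Cₛ^∞⟮𝓘(ℝ, E'); F, (ι *ᵖ V)⟯} {x : N} (h : ∀ᶠ y in 𝓝 x, t y = t' y) :
    h𝒜.restrictBracket s t x = h𝒜.restrictBracket s t' x :=
  (isDerivationAt_extendDerivation _ _).congr h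

/-- Read off from the frame expansion: skew-symmetry of the restricted bracket is not yet available,
and its proof uses this rule. -/
theorem restrictBracket_funSMul_left (f : C^∞⟮𝓘(ℝ, E'), N; 𝓘(ℝ, ℝ), ℝ⟯)
    (s t : Cₛ^∞⟮𝓘(ℝ, E'); F, (ι *ᵖ V)⟯) (x : N) :
    h𝒜.restrictBracket (s.funSMul f) t x = f x • h𝒜.restrictBracket s t x -
      mvfderiv 𝓘(ℝ, E') f x (h𝒜.restrictAnchor x (t x)) • s x := by
  simp only [restrictBracket_apply, extendDerivation_apply]
  set B := localDualFrameAt E F V (ι x)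
  rw [← (B.pullback ι).sum_coeff t, map_sum, map_sum, Finset.sum_smul, Finset.smul_sum,
    ← Finset.sum_sub_distrib]
  refine Finset.sum_congr rfl fun i _ ↦ ?_
  have h3 : (B.e i).pullback ι x = (B.pullback ι).e i x := rfl
  rw [bracketPullback_apply, bracketPullback_apply, halfBracket_funSMul,
    ContMDiffSection.funSMul_apply, map_smul, map_smul, map_smul, map_smul, h3]
  simp only [smul_eq_mul]
  module

theorem restrictBracket_congr_left {s s' : Cₛ^∞⟮𝓘(ℝ, E'); F, (ι *ᵖ V)⟯}
    (t : Cₛ^∞⟮𝓘(ℝ, E'); F, (ι *ᵖ V)⟯) {x : N} (h : ∀ᶠ y in 𝓝 x, s y = s' y) :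
    h𝒜.restrictBracket s t x = h𝒜.restrictBracket s' t x := by
  rw [restrictBracket_apply, restrictBracket_apply, h.self_of_nhds]
  congr 2
  ext b
  rw [bracketPullback_apply, bracketPullback_apply, halfBracket, halfBracket,
    (isDerivationAt_extendDerivation _ _).congr h]

/-- For a pulled-back t both orders give the half bracket by construction, and the Leibniz rules in
the two arguments are opposite to each other. -/
theorem restrictBracket_swap (s t : Cₛ^∞⟮𝓘(ℝ, E'); F, (ι *ᵖ V)⟯) :
    h𝒜.restrictBracket s t = -h𝒜.restrictBracket t s := by
  ext x
  refine pullback_section_induction ι x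
    (Q := fun t ↦ h𝒜.restrictBracket s t x = (-h𝒜.restrictBracket t s) x) ?_ ?_ ?_ ?_ t
  · intro b
    rw [restrictBracket_pullback_right, ContMDiffSection.neg_apply, restrictBracket_pullback_left]
  · intro t t' h h'
    simp only [map_add, LinearMap.add_apply, ContMDiffSection.add_apply,
      ContMDiffSection.neg_apply, neg_add] at h h' ⊢
    rw [h, h']
  · intro f t h
    rw [ContMDiffSection.neg_apply] at h ⊢
    rw [restrictBracket_funSMul_right, restrictBracket_funSMul_left, h]
    module
  · intro t t' h ht
    rw [ContMDiffSection.neg_apply] at ht ⊢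
    rw [← h𝒜.restrictBracket_congr_right s h, ← h𝒜.restrictBracket_congr_left s h, ht]

theorem restrictBracket_self (s : Cₛ^∞⟮𝓘(ℝ, E'); F, (ι *ᵖ V)⟯) : h𝒜.restrictBracket s s = 0 := by
  have h := h𝒜.restrictBracket_swap s s
  rw [eq_neg_iff_add_eq_zero, ← two_smul ℝ] at h
  rw [← one_smul ℝ (h𝒜.restrictBracket s s), show (1 : ℝ) = 2⁻¹ * 2 by norm_num, mul_smul, h,
    smul_zero]

end LieAlgebroid.IsIntegralSubmanifold
end Restriction
end

/-! ### Lie algebroid axioms and uniqueness of the restriction -/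

noncomputable section

section Restriction

variable {E : Type*} [NormedAddCommGroup E] [NormedSpace ℝ E] [FiniteDimensional ℝ E]
  {M : Type u} [TopologicalSpace M] [ChartedSpace E M] [IsManifold 𝓘(ℝ, E) ∞ M] [T2Space M]
  {F : Type*} [NormedAddCommGroup F] [NormedSpace ℝ F] [FiniteDimensional ℝ F]
  {V : M → Type*} [TopologicalSpace (TotalSpace F V)]
  [∀ x, AddCommGroup (V x)] [∀ x, Module ℝ (V x)] [∀ x, TopologicalSpace (V x)]
  [∀ x, IsTopologicalAddGroup (V x)] [∀ x, ContinuousSMul ℝ (V x)]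
  [FiberBundle F V] [VectorBundle ℝ F V] [ContMDiffVectorBundle ∞ F V 𝓘(ℝ, E)]
  {E' : Type*} [NormedAddCommGroup E'] [NormedSpace ℝ E'] [FiniteDimensional ℝ E']
  {N : Type v} [TopologicalSpace N] [ChartedSpace E' N] [IsManifold 𝓘(ℝ, E') ∞ N] [T2Space N]
  {ι : C^∞⟮𝓘(ℝ, E'), N; 𝓘(ℝ, E), M⟯} {𝒜 : LieAlgebroid E F V}

namespace LieAlgebroid.IsIntegralSubmanifold

variable (h𝒜 : 𝒜.IsIntegralSubmanifold ι)

theorem mdifferentiableAt_restrictAnchor_apply (s : Cₛ^∞⟮𝓘(ℝ, E'); F, (ι *ᵖ V)⟯) (x : N) :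
    MDifferentiableAt 𝓘(ℝ, E') (𝓘(ℝ, E').prod 𝓘(ℝ, E'))
      (fun x ↦ TotalSpace.mk' E' x (h𝒜.restrictAnchor x (s x))) x :=
  (h𝒜.contMDiff_restrictAnchor_apply s).mdifferentiableAt (by simp)

/-- Both sides obey the same Leibniz rule in t, so pulled-back sections suffice. -/
theorem restrictAnchor_restrictBracket_induction (s : Cₛ^∞⟮𝓘(ℝ, E'); F, (ι *ᵖ V)⟯) (x : N)
    (h : ∀ b : Cₛ^∞⟮𝓘(ℝ, E); F, V⟯, h𝒜.restrictAnchor x (h𝒜.restrictBracket s (b.pullback ι) x) =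
      mlieBracket 𝓘(ℝ, E') (fun y ↦ h𝒜.restrictAnchor y (s y))
        (fun y ↦ h𝒜.restrictAnchor y (b.pullback ι y)) x)
    (t : Cₛ^∞⟮𝓘(ℝ, E'); F, (ι *ᵖ V)⟯) :
    h𝒜.restrictAnchor x (h𝒜.restrictBracket s t x) =
      mlieBracket 𝓘(ℝ, E') (fun y ↦ h𝒜.restrictAnchor y (s y))
        (fun y ↦ h𝒜.restrictAnchor y (t y)) x := by
  refine pullback_section_induction ι x (Q := fun t ↦
    h𝒜.restrictAnchor x (h𝒜.restrictBracket s t x) =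
      mlieBracket 𝓘(ℝ, E') (fun y ↦ h𝒜.restrictAnchor y (s y))
        (fun y ↦ h𝒜.restrictAnchor y (t y)) x) h ?_ ?_ ?_ t
  · intro t t' ht ht'
    have e : (fun y ↦ h𝒜.restrictAnchor y ((t + t') y)) =
        (fun y ↦ h𝒜.restrictAnchor y (t y)) + fun y ↦ h𝒜.restrictAnchor y (t' y) := by
      ext y
      rw [ContMDiffSection.add_apply, map_add]; rfl
    rw [e, mlieBracket_add_right (h𝒜.mdifferentiableAt_restrictAnchor_apply t x)
      (h𝒜.mdifferentiableAt_restrictAnchor_apply t' x), map_add, ContMDiffSection.add_apply,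
      map_add, ht, ht']
  · intro f t ht
    have e : (fun y ↦ h𝒜.restrictAnchor y (t.funSMul f y)) =
        (f : N → ℝ) • fun y ↦ h𝒜.restrictAnchor y (t y) := by
      ext y
      rw [ContMDiffSection.funSMul_apply, map_smul]; rfl
    rw [e, mlieBracket_smul_right (f.contMDiff.mdifferentiableAt (by simp))
      (h𝒜.mdifferentiableAt_restrictAnchor_apply t x), restrictBracket_funSMul_right,
      map_add, map_smul, map_smul, ht, add_comm]
  · intro t t' htt' ht
    rw [← h𝒜.restrictBracket_congr_right s htt', ht]
    refine Filter.EventuallyEq.mlieBracket_vectorField_eq (EventuallyEq.refl _ _) ?_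
    filter_upwards [htt'] with y hy
    rw [hy]

theorem restrictAnchor_restrictBracket_swap {s t : Cₛ^∞⟮𝓘(ℝ, E'); F, (ι *ᵖ V)⟯} {x : N}
    (h : h𝒜.restrictAnchor x (h𝒜.restrictBracket s t x) =
      mlieBracket 𝓘(ℝ, E') (fun y ↦ h𝒜.restrictAnchor y (s y))
        (fun y ↦ h𝒜.restrictAnchor y (t y)) x) :
    h𝒜.restrictAnchor x (h𝒜.restrictBracket t s x) =
      mlieBracket 𝓘(ℝ, E') (fun y ↦ h𝒜.restrictAnchor y (t y))
        (fun y ↦ h𝒜.restrictAnchor y (s y)) x := by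
  rw [mlieBracket_swap_apply, restrictBracket_swap, ContMDiffSection.neg_apply, map_neg, h]

/-- After reducing each argument to a pullback, the vector fields on N and M are ι-related, hence so
are their brackets, and dι is injective. -/
theorem restrictAnchor_restrictBracket (s t : Cₛ^∞⟮𝓘(ℝ, E'); F, (ι *ᵖ V)⟯) (x : N) :
    h𝒜.restrictAnchor x (h𝒜.restrictBracket s t x) =
      mlieBracket 𝓘(ℝ, E') (fun y ↦ h𝒜.restrictAnchor y (s y))
        (fun y ↦ h𝒜.restrictAnchor y (t y)) x := by
  refine h𝒜.restrictAnchor_restrictBracket_induction s x (fun b ↦ ?_) t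
  refine h𝒜.restrictAnchor_restrictBracket_swap ?_
  refine h𝒜.restrictAnchor_restrictBracket_induction _ x (fun a ↦ ?_) s
  apply h𝒜.immersion x
  rw [mfderiv_mlieBracket_of_related ι (h𝒜.contMDiff_restrictAnchor_apply _)
    (h𝒜.contMDiff_restrictAnchor_apply _) (𝒜.contMDiff_anchor_apply b)
    (𝒜.contMDiff_anchor_apply a) (fun y ↦ h𝒜.mfderiv_restrictAnchor y _)
    (fun y ↦ h𝒜.mfderiv_restrictAnchor y _), mfderiv_restrictAnchor, restrictBracket_pullback]
  exact 𝒜.anchor_bracket b a (ι x)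

/-- The derivative of a function along the image of a section under the anchor. -/
def anchorDeriv (s : Cₛ^∞⟮𝓘(ℝ, E'); F, (ι *ᵖ V)⟯) (f : C^∞⟮𝓘(ℝ, E'), N; 𝓘(ℝ, ℝ), ℝ⟯) :
    C^∞⟮𝓘(ℝ, E'), N; 𝓘(ℝ, ℝ), ℝ⟯ :=
  ⟨fun x ↦ mvfderiv 𝓘(ℝ, E') f x (h𝒜.restrictAnchor x (s x)), fun x ↦
    ContMDiffAt.mvfderiv_apply f.contMDiff (h𝒜.contMDiff_restrictAnchor_apply s x)⟩

theorem restrictBracket_funSMul (f : C^∞⟮𝓘(ℝ, E'), N; 𝓘(ℝ, ℝ), ℝ⟯)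
    (s t : Cₛ^∞⟮𝓘(ℝ, E'); F, (ι *ᵖ V)⟯) :
    h𝒜.restrictBracket s (t.funSMul f) = (h𝒜.restrictBracket s t).funSMul f +
      t.funSMul (h𝒜.anchorDeriv s f) := by
  ext x
  exact h𝒜.restrictBracket_funSMul_right f s t x

theorem anchorDeriv_restrictBracket (f : C^∞⟮𝓘(ℝ, E'), N; 𝓘(ℝ, ℝ), ℝ⟯)
    (s t : Cₛ^∞⟮𝓘(ℝ, E'); F, (ι *ᵖ V)⟯) (x : N) :
    h𝒜.anchorDeriv (h𝒜.restrictBracket s t) f x =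
      h𝒜.anchorDeriv s (h𝒜.anchorDeriv t f) x - h𝒜.anchorDeriv t (h𝒜.anchorDeriv s f) x := by
  change mvfderiv 𝓘(ℝ, E') f x (h𝒜.restrictAnchor x (h𝒜.restrictBracket s t x)) = _
  rw [restrictAnchor_restrictBracket, mvfderiv_mlieBracket f.contMDiff
    (h𝒜.mdifferentiableAt_restrictAnchor_apply s x) (h𝒜.mdifferentiableAt_restrictAnchor_apply t x)]
  rfl

/-- The Jacobiator is cyclic. It is linear over functions in its last argument because the
derivative terms cancel: the anchor sends brackets to commutators. So it is determined by pullbacks,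
where it is the Jacobiator of 𝒜. -/
theorem restrictBracket_cyclic (s t w : Cₛ^∞⟮𝓘(ℝ, E'); F, (ι *ᵖ V)⟯) (x : N) :
    h𝒜.restrictBracket s (h𝒜.restrictBracket t w) x +
      h𝒜.restrictBracket t (h𝒜.restrictBracket w s) x +
      h𝒜.restrictBracket w (h𝒜.restrictBracket s t) x = 0 := by
  refine pullback_section_induction₃ (ι := ι) (V := V) x (J := fun s t w ↦
    h𝒜.restrictBracket s (h𝒜.restrictBracket t w) x +
      h𝒜.restrictBracket t (h𝒜.restrictBracket w s) x +
      h𝒜.restrictBracket w (h𝒜.restrictBracket s t) x) ?_ ?_ ?_ ?_ ?_ s t w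
  · intro s t w
    abel
  · intro s t w w'
    simp only [map_add, LinearMap.add_apply, ContMDiffSection.add_apply]
    abel
  · intro s t f w
    have h1 := h𝒜.anchorDeriv_restrictBracket f s t x
    have h2 : h𝒜.restrictBracket (w.funSMul f) (h𝒜.restrictBracket s t) x =
        f x • h𝒜.restrictBracket w (h𝒜.restrictBracket s t) x -
          h𝒜.anchorDeriv (h𝒜.restrictBracket s t) f x • w x :=
      h𝒜.restrictBracket_funSMul_left f w _ x
    rw [h2, h1, h𝒜.restrictBracket_swap _ s, h𝒜.restrictBracket_swap w s]
    simp only [map_neg, restrictBracket_funSMul, map_add, ContMDiffSection.add_apply,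
      ContMDiffSection.neg_apply, ContMDiffSection.funSMul_apply]
    module
  · intro s t w w' h
    have h' : ∀ᶠ y in 𝓝 x, h𝒜.restrictBracket t w y = h𝒜.restrictBracket t w' y := by
      filter_upwards [eventually_eventually_nhds.2 h] with y hy
      exact h𝒜.restrictBracket_congr_right t hy
    have h'' : ∀ᶠ y in 𝓝 x, h𝒜.restrictBracket w s y = h𝒜.restrictBracket w' s y := by
      filter_upwards [eventually_eventually_nhds.2 h] with y hy
      exact h𝒜.restrictBracket_congr_left s hy
    rw [h𝒜.restrictBracket_congr_right s h', h𝒜.restrictBracket_congr_right t h'',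
      h𝒜.restrictBracket_congr_left _ h]
  · intro a b c
    simp only [restrictBracket_pullback]
    have h := 𝒜.jacobi a b c
    rw [𝒜.bracket_swap (𝒜.bracket a b) c, 𝒜.bracket_swap a c, map_neg] at h
    have hcyc : 𝒜.bracket a (𝒜.bracket b c) + 𝒜.bracket b (𝒜.bracket c a) +
        𝒜.bracket c (𝒜.bracket a b) = 0 := by rw [h]; abel
    exact congrArg (fun s : Cₛ^∞⟮𝓘(ℝ, E); F, V⟯ ↦ s.pullback ι x) hcyc

/-- The restriction of a Lie algebroid to an integral submanifold of its characteristic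
foliation. -/
def restrict : LieAlgebroid E' F (ι *ᵖ V) where
  anchor := h𝒜.restrictAnchor
  anchor_contMDiff := h𝒜.contMDiff_restrictAnchor
  bracket := h𝒜.restrictBracket
  bracket_self := h𝒜.restrictBracket_self
  jacobi s t w := by
    ext x
    have h := h𝒜.restrictBracket_cyclic s t w x
    rw [h𝒜.restrictBracket_swap w s, h𝒜.restrictBracket_swap w (h𝒜.restrictBracket s t), map_neg]
      at h
    rw [ContMDiffSection.add_apply, ← sub_eq_zero, ← h, ContMDiffSection.neg_apply,
      ContMDiffSection.neg_apply]
    abel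
  anchor_bracket := h𝒜.restrictAnchor_restrictBracket
  leibniz s t ft f hf hft x := by
    have e : ft = t.funSMul ⟨f, hf⟩ := by
      ext y
      exact hft y
    rw [e]
    exact h𝒜.restrictBracket_funSMul_right _ s t x

theorem isRestriction_restrict : 𝒜.IsRestriction ι h𝒜.restrict where
  anchor_eq := h𝒜.mfderiv_restrictAnchor
  bracket_eq s t s' t' hs ht x := by
    obtain rfl : s' = s.pullback ι := by
      ext y
      exact hs y
    obtain rfl : t' = t.pullback ι := by
      ext y
      exact ht y
    exact congrArg (fun w : Cₛ^∞⟮𝓘(ℝ, E'); F, (ι *ᵖ V)⟯ ↦ w x) (h𝒜.restrictBracket_pullback s t)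

end LieAlgebroid.IsIntegralSubmanifold

namespace LieAlgebroid.IsRestriction

theorem bracket_pullback {𝒜N : LieAlgebroid E' F (ι *ᵖ V)} (h : 𝒜.IsRestriction ι 𝒜N)
    (a b : Cₛ^∞⟮𝓘(ℝ, E); F, V⟯) :
    𝒜N.bracket (a.pullback ι) (b.pullback ι) = (𝒜.bracket a b).pullback ι := by
  ext x
  exact h.bracket_eq a b _ _ (fun _ ↦ rfl) (fun _ ↦ rfl) x

/-- Injectivity of dι fixes the anchor. The Leibniz rule then fixes the bracket from its values on
pullbacks, with skew-symmetry used to treat the first argument. -/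
theorem eq {𝒜₁ 𝒜₂ : LieAlgebroid E' F (ι *ᵖ V)} (h𝒜 : 𝒜.IsIntegralSubmanifold ι)
    (h₁ : 𝒜.IsRestriction ι 𝒜₁) (h₂ : 𝒜.IsRestriction ι 𝒜₂) : 𝒜₁ = 𝒜₂ := by
  have hanchor : ∀ x a, 𝒜₁.anchor x a = 𝒜₂.anchor x a := fun x a ↦ h𝒜.immersion x <| by
    rw [h₁.anchor_eq, h₂.anchor_eq]
  have step : ∀ (x : N) (s : Cₛ^∞⟮𝓘(ℝ, E'); F, (ι *ᵖ V)⟯),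
      (∀ b : Cₛ^∞⟮𝓘(ℝ, E); F, V⟯,
        𝒜₁.bracket s (b.pullback ι) x = 𝒜₂.bracket s (b.pullback ι) x) →
      ∀ t, 𝒜₁.bracket s t x = 𝒜₂.bracket s t x := by
    intro x s h t
    refine pullback_section_induction ι x (Q := fun t ↦ 𝒜₁.bracket s t x = 𝒜₂.bracket s t x)
      h ?_ ?_ ?_ t
    · intro t t' ht ht'
      simp only [map_add, ContMDiffSection.add_apply, ht, ht']
    · intro f t ht
      rw [bracket_funSMul_right, bracket_funSMul_right, ht, hanchor]
    · intro t t' htt' ht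
      rw [← 𝒜₁.bracket_congr_right s htt', ← 𝒜₂.bracket_congr_right s htt', ht]
  refine LieAlgebroid.ext hanchor fun s t x ↦ step x s (fun b ↦ ?_) t
  rw [𝒜₁.bracket_swap_apply, 𝒜₂.bracket_swap_apply]
  congr 1
  refine step x _ (fun a ↦ ?_) s
  rw [h₁.bracket_pullback, h₂.bracket_pullback]

end LieAlgebroid.IsRestriction
end Restriction
end

/-! ### Elementary properties of symplectic forms -/

noncomputable section

section SymplecticForm

variable {E : Type*} [NormedAddCommGroup E] [NormedSpace ℝ E]
  {M : Type*} [TopologicalSpace M] [ChartedSpace E M] [IsManifold 𝓘(ℝ, E) ∞ M]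
  {F : Type*} [NormedAddCommGroup F] [NormedSpace ℝ F]
  {V : M → Type*} [TopologicalSpace (TotalSpace F V)]
  [∀ x, AddCommGroup (V x)] [∀ x, Module ℝ (V x)] [∀ x, TopologicalSpace (V x)]
  [∀ x, IsTopologicalAddGroup (V x)] [∀ x, ContinuousSMul ℝ (V x)]
  [FiberBundle F V] [VectorBundle ℝ F V] [ContMDiffVectorBundle ∞ F V 𝓘(ℝ, E)]

theorem contMDiff_form_apply {Ψ : ∀ x, V x →L[ℝ] V x →L[ℝ] ℝ}
    (hΨ : ContMDiff 𝓘(ℝ, E) (𝓘(ℝ, E).prod 𝓘(ℝ, F →L[ℝ] F →L[ℝ] ℝ)) ∞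
      (fun x ↦ TotalSpace.mk' (F →L[ℝ] F →L[ℝ] ℝ) (E := fun x ↦ V x →L[ℝ] V x →L[ℝ] ℝ) x (Ψ x)))
    (s t : Cₛ^∞⟮𝓘(ℝ, E); F, V⟯) :
    ContMDiff 𝓘(ℝ, E) 𝓘(ℝ, ℝ) ∞ (fun x ↦ Ψ x (s x) (t x)) := fun x ↦
  contMDiffAt_section_trivial.1 (ContMDiffAt.clm_bundle_apply₂ (E₃ := fun _ : M ↦ ℝ) (hΨ x)
    (s.contMDiff x) (t.contMDiff x))

variable {𝒜 : LieAlgebroid E F V}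

namespace SymplecticForm

theorem ext {Ω Ω' : SymplecticForm 𝒜} (h : ∀ x, Ω.form x = Ω'.form x) : Ω = Ω' := by
  have e : Ω.form = Ω'.form := funext h
  cases Ω; cases Ω'
  congr

theorem form_swap (Ω : SymplecticForm 𝒜) {x : M} (a b : V x) : Ω.form x a b = -Ω.form x b a := by
  have h := Ω.alternating x (a + b)
  simp only [map_add, _root_.add_apply, Ω.alternating, zero_add, add_zero] at h
  linarith

end SymplecticForm
end SymplecticForm

/-! ### Restriction of the symplectic form -/

section RestrictForm

variable {E : Type*} [NormedAddCommGroup E] [NormedSpace ℝ E] [FiniteDimensional ℝ E]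
  {M : Type u} [TopologicalSpace M] [ChartedSpace E M] [IsManifold 𝓘(ℝ, E) ∞ M] [T2Space M]
  {F : Type*} [NormedAddCommGroup F] [NormedSpace ℝ F] [FiniteDimensional ℝ F]
  {V : M → Type*} [TopologicalSpace (TotalSpace F V)]
  [∀ x, AddCommGroup (V x)] [∀ x, Module ℝ (V x)] [∀ x, TopologicalSpace (V x)]
  [∀ x, IsTopologicalAddGroup (V x)] [∀ x, ContinuousSMul ℝ (V x)]
  [FiberBundle F V] [VectorBundle ℝ F V] [ContMDiffVectorBundle ∞ F V 𝓘(ℝ, E)]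
  {E' : Type*} [NormedAddCommGroup E'] [NormedSpace ℝ E'] [FiniteDimensional ℝ E']
  {N : Type v} [TopologicalSpace N] [ChartedSpace E' N] [IsManifold 𝓘(ℝ, E') ∞ N] [T2Space N]
  {ι : C^∞⟮𝓘(ℝ, E'), N; 𝓘(ℝ, E), M⟯} {𝒜 : LieAlgebroid E F V}

namespace SymplecticForm

variable (ι) in
/-- The restriction of a symplectic form, as a 2-form on the restricted bundle. -/
def pullbackForm (Ω : SymplecticForm 𝒜) (x : N) : (ι *ᵖ V) x →L[ℝ] (ι *ᵖ V) x →L[ℝ] ℝ :=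
  Ω.form (ι x)

variable (ι) in
theorem contMDiff_pullbackForm (Ω : SymplecticForm 𝒜) :
    ContMDiff 𝓘(ℝ, E') (𝓘(ℝ, E').prod 𝓘(ℝ, F →L[ℝ] F →L[ℝ] ℝ)) ∞
      (fun x : N ↦ TotalSpace.mk' (F →L[ℝ] F →L[ℝ] ℝ)
        (E := fun x : N ↦ (ι *ᵖ V) x →L[ℝ] (ι *ᵖ V) x →L[ℝ] ℝ) x (Ω.pullbackForm ι x)) := by
  intro x₀
  refine contMDiffAt_hom_of_apply (V := ι *ᵖ V) (W := fun x : N ↦ (ι *ᵖ V) x →L[ℝ] ℝ)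
    fun s hs ↦ ?_
  refine contMDiffAt_hom_of_apply (V := ι *ᵖ V) (W := fun _ : N ↦ ℝ) fun t ht ↦
    contMDiffAt_section_trivial.2 ?_
  replace hs := (contMDiffAt_pullback_section ι).1 hs
  replace ht := (contMDiffAt_pullback_section ι).1 ht
  exact (contMDiffAt_trivial_iff ι.contMDiff.contMDiffAt).1
    (ContMDiffAt.clm_bundle_apply₂ (E₃ := fun _ : M ↦ ℝ)
      (Ω.contMDiff.contMDiffAt.comp x₀ ι.contMDiff.contMDiffAt) hs ht)

theorem pullbackForm_swap (Ω : SymplecticForm 𝒜) {x : N} (a b : (ι *ᵖ V) x) :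
    Ω.pullbackForm ι x a b = -Ω.pullbackForm ι x b a :=
  Ω.form_swap (x := ι x) a b

/-- The Lie algebroid differential is cyclic and linear over functions, so it is enough to test
pulled-back sections; there the chain rule reduces it to dω = 0 at ι x. -/
theorem pullbackForm_closed (Ω : SymplecticForm 𝒜) {𝒜N : LieAlgebroid E' F (ι *ᵖ V)}
    (h𝒜N : 𝒜.IsRestriction ι 𝒜N) (s t w : Cₛ^∞⟮𝓘(ℝ, E'); F, (ι *ᵖ V)⟯) (x : N) :
    mvfderiv 𝓘(ℝ, E') (fun y ↦ Ω.pullbackForm ι y (t y) (w y)) x (𝒜N.anchor x (s x))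
      - mvfderiv 𝓘(ℝ, E') (fun y ↦ Ω.pullbackForm ι y (s y) (w y)) x (𝒜N.anchor x (t x))
      + mvfderiv 𝓘(ℝ, E') (fun y ↦ Ω.pullbackForm ι y (s y) (t y)) x (𝒜N.anchor x (w x))
      - Ω.pullbackForm ι x (𝒜N.bracket s t x) (w x) + Ω.pullbackForm ι x (𝒜N.bracket s w x) (t x)
      - Ω.pullbackForm ι x (𝒜N.bracket t w x) (s x) = 0 := by
  have hsmooth : ∀ s t : Cₛ^∞⟮𝓘(ℝ, E'); F, (ι *ᵖ V)⟯, MDifferentiableAt 𝓘(ℝ, E') 𝓘(ℝ, ℝ)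
      (fun y ↦ Ω.pullbackForm ι y (s y) (t y)) x := fun s t ↦
    (contMDiff_form_apply (Ω.contMDiff_pullbackForm ι) s t).mdifferentiableAt (by simp)
  refine pullback_section_induction₃ (ι := ι) (V := V) x (J := fun s t w ↦
    mvfderiv 𝓘(ℝ, E') (fun y ↦ Ω.pullbackForm ι y (t y) (w y)) x (𝒜N.anchor x (s x))
      - mvfderiv 𝓘(ℝ, E') (fun y ↦ Ω.pullbackForm ι y (s y) (w y)) x (𝒜N.anchor x (t x))
      + mvfderiv 𝓘(ℝ, E') (fun y ↦ Ω.pullbackForm ι y (s y) (t y)) x (𝒜N.anchor x (w x))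
      - Ω.pullbackForm ι x (𝒜N.bracket s t x) (w x) + Ω.pullbackForm ι x (𝒜N.bracket s w x) (t x)
      - Ω.pullbackForm ι x (𝒜N.bracket t w x) (s x)) ?_ ?_ ?_ ?_ ?_ s t w
  · intro s t w
    have hneg : ∀ s t : Cₛ^∞⟮𝓘(ℝ, E'); F, (ι *ᵖ V)⟯, ∀ v,
        mvfderiv 𝓘(ℝ, E') (fun y ↦ Ω.pullbackForm ι y (s y) (t y)) x v =
          -mvfderiv 𝓘(ℝ, E') (fun y ↦ Ω.pullbackForm ι y (t y) (s y)) x v := by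
      intro s t v
      have e : (fun y ↦ Ω.pullbackForm ι y (s y) (t y)) =
          -fun y ↦ Ω.pullbackForm ι y (t y) (s y) := by
        ext y
        exact Ω.pullbackForm_swap _ _
      rw [e, mvfderiv_neg]; rfl
    rw [hneg w s, hneg t s, 𝒜N.bracket_swap_apply t s, 𝒜N.bracket_swap_apply w s]
    simp only [map_neg, _root_.neg_apply]
    ring
  · intro s t w w'
    have hadd : ∀ s : Cₛ^∞⟮𝓘(ℝ, E'); F, (ι *ᵖ V)⟯, ∀ v,
        mvfderiv 𝓘(ℝ, E') (fun y ↦ Ω.pullbackForm ι y (s y) ((w + w') y)) x v =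
          mvfderiv 𝓘(ℝ, E') (fun y ↦ Ω.pullbackForm ι y (s y) (w y)) x v +
          mvfderiv 𝓘(ℝ, E') (fun y ↦ Ω.pullbackForm ι y (s y) (w' y)) x v := by
      intro s v
      have e : (fun y ↦ Ω.pullbackForm ι y (s y) ((w + w') y)) =
          (fun y ↦ Ω.pullbackForm ι y (s y) (w y)) +
            fun y ↦ Ω.pullbackForm ι y (s y) (w' y) := by
        ext y
        exact map_add _ _ _
      rw [e, mvfderiv_add (hsmooth _ _) (hsmooth _ _)]; rfl
    rw [hadd, hadd]
    simp only [map_add, ContMDiffSection.add_apply, _root_.add_apply]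
    ring
  · intro s t f w
    have hmul : ∀ s : Cₛ^∞⟮𝓘(ℝ, E'); F, (ι *ᵖ V)⟯, ∀ v,
        mvfderiv 𝓘(ℝ, E') (fun y ↦ Ω.pullbackForm ι y (s y) (w.funSMul f y)) x v =
          f x * mvfderiv 𝓘(ℝ, E') (fun y ↦ Ω.pullbackForm ι y (s y) (w y)) x v +
          Ω.pullbackForm ι x (s x) (w x) * mvfderiv 𝓘(ℝ, E') f x v := by
      intro s v
      have e : (fun y ↦ Ω.pullbackForm ι y (s y) (w.funSMul f y)) =
          (f : N → ℝ) * fun y ↦ Ω.pullbackForm ι y (s y) (w y) := by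
        ext y
        exact map_smul _ _ _
      rw [e, mvfderiv_mul (f.contMDiff.mdifferentiableAt (by simp)) (hsmooth _ _)]; rfl
    rw [hmul, hmul, 𝒜N.bracket_funSMul_right, 𝒜N.bracket_funSMul_right]
    simp only [map_add, map_smul, ContMDiffSection.funSMul_apply, _root_.add_apply,
      _root_.smul_apply, smul_eq_mul]
    rw [Ω.pullbackForm_swap (w x) (t x), Ω.pullbackForm_swap (w x) (s x)]
    ring
  · intro s t w w' h
    have hc : ∀ s : Cₛ^∞⟮𝓘(ℝ, E'); F, (ι *ᵖ V)⟯,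
        mvfderiv 𝓘(ℝ, E') (fun y ↦ Ω.pullbackForm ι y (s y) (w y)) x =
          mvfderiv 𝓘(ℝ, E') (fun y ↦ Ω.pullbackForm ι y (s y) (w' y)) x := by
      intro s
      refine Filter.EventuallyEq.mvfderiv_eq ?_
      filter_upwards [h] with y hy
      rw [hy]
    rw [hc, hc, 𝒜N.bracket_congr_right s h, 𝒜N.bracket_congr_right t h, h.self_of_nhds]
  · intro a b c
    have hp : ∀ a b c : Cₛ^∞⟮𝓘(ℝ, E); F, V⟯,
        mvfderiv 𝓘(ℝ, E') (fun y ↦ Ω.pullbackForm ι y (a.pullback ι y) (b.pullback ι y)) x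
          (𝒜N.anchor x (c.pullback ι x)) =
        mvfderiv 𝓘(ℝ, E) (fun y ↦ Ω.form y (a y) (b y)) (ι x) (𝒜.anchor (ι x) (c (ι x))) := by
      intro a b c
      refine (mvfderiv_comp_contMDiffMap ι (contMDiff_form_apply Ω.contMDiff a b) x _).trans ?_
      rw [h𝒜N.anchor_eq]
      rfl
    rw [hp, hp, hp, h𝒜N.bracket_pullback, h𝒜N.bracket_pullback, h𝒜N.bracket_pullback]
    exact Ω.closed a b c (ι x)

/-- The restriction of a symplectic form on a Lie algebroid. -/
def restrict (Ω : SymplecticForm 𝒜) {𝒜N : LieAlgebroid E' F (ι *ᵖ V)}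
    (h𝒜N : 𝒜.IsRestriction ι 𝒜N) : SymplecticForm 𝒜N where
  form := Ω.pullbackForm ι
  contMDiff := Ω.contMDiff_pullbackForm ι
  alternating x a := Ω.alternating (ι x) a
  nondegenerate x a h := Ω.nondegenerate (ι x) a h
  closed := Ω.pullbackForm_closed h𝒜N

end SymplecticForm
end RestrictForm
end

/-! ### Tensoriality of the Lie derivative of a 1-form -/

noncomputable section

section LieDerivative

variable {E : Type*} [NormedAddCommGroup E] [NormedSpace ℝ E] [FiniteDimensional ℝ E]
  {M : Type*} [TopologicalSpace M] [ChartedSpace E M] [IsManifold 𝓘(ℝ, E) ∞ M]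

/-- For f X the two terms (Y f) β(X), one from the product rule and one from the bracket, cancel. -/
theorem tensorialAt_lieDerivOneForm (Y : ∀ x : M, TangentSpace 𝓘(ℝ, E) x)
    (β : Cₛ^∞⟮𝓘(ℝ, E); E →L[ℝ] ℝ, (fun x : M ↦ TangentSpace 𝓘(ℝ, E) x →L[ℝ] ℝ)⟯) (x : M) :
    TensorialAt 𝓘(ℝ, E) E (fun X ↦ lieDerivOneForm Y β X x) x := by
  have hβ : ∀ X : ∀ x : M, TangentSpace 𝓘(ℝ, E) x,
      MDifferentiableAt 𝓘(ℝ, E) (𝓘(ℝ, E).prod 𝓘(ℝ, E)) (fun x ↦ TotalSpace.mk' E x (X x)) x →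
      MDifferentiableAt 𝓘(ℝ, E) 𝓘(ℝ, ℝ) (fun y ↦ β y (X y)) x := fun X hX ↦
    (mdifferentiableAt_section 𝓘(ℝ, E) (F := ℝ) (E := fun _ : M ↦ ℝ) _).1
      (MDifferentiableAt.clm_bundle_apply (E₂ := fun _ : M ↦ ℝ)
        (β.contMDiff.mdifferentiableAt (by simp)) hX)
  constructor
  · intro f X hf hX
    simp only [lieDerivOneForm]
    have e : (fun y ↦ β y ((f • X) y)) = f * fun y ↦ β y (X y) := by
      ext y
      exact map_smul _ _ _
    rw [e, mvfderiv_mul hf (hβ X hX), mlieBracket_smul_right hf hX]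
    simp only [_root_.add_apply, _root_.smul_apply, map_add, map_smul, smul_eq_mul]
    ring
  · intro X X' hX hX'
    simp only [lieDerivOneForm]
    have e : (fun y ↦ β y ((X + X') y)) = (fun y ↦ β y (X y)) + fun y ↦ β y (X' y) := by
      ext y
      exact map_add _ _ _
    rw [e, mvfderiv_add (hβ X hX) (hβ X' hX'), mlieBracket_add_right hX hX']
    simp only [_root_.add_apply, map_add]
    ring

/-- The Lie derivative `(ℒ_Y β)(X)` at `x` depends on `X` only through its value at `x`. -/
theorem lieDerivOneForm_congr (Y : ∀ x : M, TangentSpace 𝓘(ℝ, E) x)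
    (β : Cₛ^∞⟮𝓘(ℝ, E); E →L[ℝ] ℝ, (fun x : M ↦ TangentSpace 𝓘(ℝ, E) x →L[ℝ] ℝ)⟯) {x : M}
    {X X' : ∀ x : M, TangentSpace 𝓘(ℝ, E) x}
    (hX : ContMDiff 𝓘(ℝ, E) (𝓘(ℝ, E).prod 𝓘(ℝ, E)) ∞ (fun x ↦ TotalSpace.mk' E x (X x)))
    (hX' : ContMDiff 𝓘(ℝ, E) (𝓘(ℝ, E).prod 𝓘(ℝ, E)) ∞ (fun x ↦ TotalSpace.mk' E x (X' x)))
    (h : X x = X' x) : lieDerivOneForm Y β X x = lieDerivOneForm Y β X' x :=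
  haveI : ContMDiffVectorBundle 1 E (TangentSpace 𝓘(ℝ, E) : M → Type _) 𝓘(ℝ, E) :=
    ContMDiffVectorBundle.of_le (m := 1) (n := ∞) (by simp)
  (tensorialAt_lieDerivOneForm Y β x).pointwise (hX.mdifferentiableAt (by simp))
    (hX'.mdifferentiableAt (by simp)) h

end LieDerivative

/-! ### The map ♯, Hamiltonian sections and the Poisson structure -/

section Sharp

variable {E : Type*} [NormedAddCommGroup E] [NormedSpace ℝ E] [FiniteDimensional ℝ E]
  {M : Type*} [TopologicalSpace M] [ChartedSpace E M] [IsManifold 𝓘(ℝ, E) ∞ M]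
  {F : Type*} [NormedAddCommGroup F] [NormedSpace ℝ F] [FiniteDimensional ℝ F]
  {V : M → Type*} [TopologicalSpace (TotalSpace F V)]
  [∀ x, AddCommGroup (V x)] [∀ x, Module ℝ (V x)] [∀ x, TopologicalSpace (V x)]
  [∀ x, IsTopologicalAddGroup (V x)] [∀ x, ContinuousSMul ℝ (V x)]
  [FiberBundle F V] [VectorBundle ℝ F V] [ContMDiffVectorBundle ∞ F V 𝓘(ℝ, E)]
  {𝒜 : LieAlgebroid E F V} (Ω : SymplecticForm 𝒜)

namespace SymplecticForm

/-- The symplectic form on a fibre, as a bilinear form. -/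
def bilinForm (x : M) : LinearMap.BilinForm ℝ (V x) :=
  LinearMap.mk₂ ℝ (fun a b ↦ Ω.form x a b) (fun a a' b ↦ by simp) (fun r a b ↦ by simp)
    (fun a b b' ↦ by simp) (fun r a b ↦ by simp)

theorem bilinForm_apply (x : M) (a b : V x) : Ω.bilinForm x a b = Ω.form x a b := rfl

theorem bilinForm_nondegenerate (x : M) : (Ω.bilinForm x).Nondegenerate :=
  ⟨fun a h ↦ Ω.nondegenerate x a h, fun a h ↦ Ω.nondegenerate x a fun b ↦ by
    rw [Ω.form_swap, ← bilinForm_apply, h b, neg_zero]⟩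

/-- The linear map underlying `sharp`. -/
def sharpₗ (x : M) : (TangentSpace 𝓘(ℝ, E) x →L[ℝ] ℝ) →ₗ[ℝ] V x :=
  haveI := VectorBundle.finiteDimensional ℝ F V x
  ((Ω.bilinForm x).toDual (Ω.bilinForm_nondegenerate x)).symm.toLinearMap ∘ₗ
    { toFun α := -(α.toLinearMap ∘ₗ (𝒜.anchor x).toLinearMap)
      map_add' α β := by ext a; simp [add_comm]
      map_smul' r α := by ext a; simp }

/-- The map `T*M → V` with `ω(sharp α, b) = -α(ρ b)`. -/
def sharp (x : M) : (TangentSpace 𝓘(ℝ, E) x →L[ℝ] ℝ) →L[ℝ] V x :=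
  haveI : FiniteDimensional ℝ (TangentSpace 𝓘(ℝ, E) x →L[ℝ] ℝ) :=
    inferInstanceAs (FiniteDimensional ℝ (E →L[ℝ] ℝ))
  LinearMap.toContinuousLinearMap (Ω.sharpₗ x)

theorem form_sharp {x : M} (α : TangentSpace 𝓘(ℝ, E) x →L[ℝ] ℝ) (b : V x) :
    Ω.form x (Ω.sharp x α) b = -α (𝒜.anchor x b) :=
  haveI := VectorBundle.finiteDimensional ℝ F V x
  LinearMap.BilinForm.apply_toDual_symm_apply (B := Ω.bilinForm x)
    (hB := Ω.bilinForm_nondegenerate x) _ b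

theorem eq_of_form_eq {x : M} {a a' : V x} (h : ∀ b, Ω.form x a b = Ω.form x a' b) : a = a' := by
  rw [← sub_eq_zero]
  refine Ω.nondegenerate x _ fun b ↦ ?_
  rw [map_sub, _root_.sub_apply, h, sub_self]

theorem sharp_eq_iff {x : M} {α : TangentSpace 𝓘(ℝ, E) x →L[ℝ] ℝ} {a : V x} :
    Ω.sharp x α = a ↔ ∀ b, Ω.form x a b = -α (𝒜.anchor x b) := by
  refine ⟨fun h b ↦ by rw [← h, form_sharp], fun h ↦ Ω.eq_of_form_eq fun b ↦ ?_⟩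
  rw [form_sharp, h]

/-- The image ω(♯α, ·) = -α ∘ ρ is smooth when α is, and ω^♭ is an injective smooth bundle map, so
♯α is smooth. -/
theorem contMDiffAt_sharp (x₀ : M) :
    ContMDiffAt 𝓘(ℝ, E) (𝓘(ℝ, E).prod 𝓘(ℝ, (E →L[ℝ] ℝ) →L[ℝ] F)) ∞
      (fun x ↦ TotalSpace.mk' ((E →L[ℝ] ℝ) →L[ℝ] F)
        (E := fun x : M ↦ (TangentSpace 𝓘(ℝ, E) x →L[ℝ] ℝ) →L[ℝ] V x) x (Ω.sharp x)) x₀ := by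
  refine contMDiffAt_hom_of_apply (V := fun x : M ↦ TangentSpace 𝓘(ℝ, E) x →L[ℝ] ℝ) (W := V)
    fun α hα ↦ ?_
  refine contMDiffAt_section_of_injective (W := fun x ↦ V x →L[ℝ] ℝ) (φ := Ω.form)
    Ω.contMDiff.contMDiffAt
    (fun a a' h ↦ Ω.eq_of_form_eq fun b ↦ congrArg (fun l : V x₀ →L[ℝ] ℝ ↦ l b) h) ?_
  refine contMDiffAt_hom_of_apply (V := V) (W := fun _ : M ↦ ℝ) fun s hs ↦
    contMDiffAt_section_trivial.2 ?_
  simp only [form_sharp]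
  exact (contMDiffAt_section_trivial.1 (ContMDiffAt.clm_bundle_apply (E₂ := fun _ : M ↦ ℝ) hα
    (𝒜.anchor_contMDiff.contMDiffAt.clm_bundle_apply hs))).neg

/-- `sharp` on sections. -/
def sharpSection
    (α : Cₛ^∞⟮𝓘(ℝ, E); E →L[ℝ] ℝ, (fun x : M ↦ TangentSpace 𝓘(ℝ, E) x →L[ℝ] ℝ)⟯) :
    Cₛ^∞⟮𝓘(ℝ, E); F, V⟯ :=
  ⟨fun x ↦ Ω.sharp x (α x), fun x ↦ (Ω.contMDiffAt_sharp x).clm_bundle_apply (α.contMDiff x)⟩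

@[simp]
theorem sharpSection_apply
    (α : Cₛ^∞⟮𝓘(ℝ, E); E →L[ℝ] ℝ, (fun x : M ↦ TangentSpace 𝓘(ℝ, E) x →L[ℝ] ℝ)⟯) (x : M) :
    Ω.sharpSection α x = Ω.sharp x (α x) := rfl

/-- The bivector `π(α, β) = ω(sharp α, sharp β)`. -/
def bivector (x : M) : (TangentSpace 𝓘(ℝ, E) x →L[ℝ] ℝ) →L[ℝ]
    (TangentSpace 𝓘(ℝ, E) x →L[ℝ] ℝ) →L[ℝ] ℝ :=
  (ContinuousLinearMap.precomp ℝ (Ω.sharp x)).comp ((Ω.form x).comp (Ω.sharp x))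

theorem bivector_apply {x : M} (α β : TangentSpace 𝓘(ℝ, E) x →L[ℝ] ℝ) :
    Ω.bivector x α β = Ω.form x (Ω.sharp x α) (Ω.sharp x β) := rfl

/-- This says ρ ∘ ♯ = π^♯; the minus sign in the definition of ♯ is there for it. -/
theorem bivector_eq {x : M} (α β : TangentSpace 𝓘(ℝ, E) x →L[ℝ] ℝ) :
    Ω.bivector x α β = β (𝒜.anchor x (Ω.sharp x α)) := by
  rw [bivector_apply, form_swap, form_sharp, neg_neg]

/-- The differential of a smooth function, as a section of the cotangent bundle. -/
def _root_.mvfderivSection {f : M → ℝ} (hf : ContMDiff 𝓘(ℝ, E) 𝓘(ℝ, ℝ) ∞ f) :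
    Cₛ^∞⟮𝓘(ℝ, E); E →L[ℝ] ℝ, (fun x : M ↦ TangentSpace 𝓘(ℝ, E) x →L[ℝ] ℝ)⟯ :=
  ⟨fun x ↦ mvfderiv 𝓘(ℝ, E) f x, contMDiffAt_mvfderiv hf⟩

/-- The Hamiltonian section of a smooth function. -/
def hamiltonian {f : M → ℝ} (hf : ContMDiff 𝓘(ℝ, E) 𝓘(ℝ, ℝ) ∞ f) : Cₛ^∞⟮𝓘(ℝ, E); F, V⟯ :=
  -Ω.sharpSection (mvfderivSection hf)

theorem hamiltonian_apply {f : M → ℝ} (hf : ContMDiff 𝓘(ℝ, E) 𝓘(ℝ, ℝ) ∞ f) (x : M) :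
    Ω.hamiltonian hf x = -Ω.sharp x (mvfderiv 𝓘(ℝ, E) f x) := rfl

theorem isHamiltonian_hamiltonian {f : M → ℝ} (hf : ContMDiff 𝓘(ℝ, E) 𝓘(ℝ, ℝ) ∞ f) :
    Ω.IsHamiltonian f (Ω.hamiltonian hf) := by
  intro x b
  rw [hamiltonian_apply, map_neg, _root_.neg_apply, form_sharp, neg_neg]

variable {Ω} in
theorem IsHamiltonian.eq {f : M → ℝ} {s : Cₛ^∞⟮𝓘(ℝ, E); F, V⟯} (h : Ω.IsHamiltonian f s)
    (hf : ContMDiff 𝓘(ℝ, E) 𝓘(ℝ, ℝ) ∞ f) : s = Ω.hamiltonian hf := by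
  ext x
  refine Ω.eq_of_form_eq fun b ↦ ?_
  rw [← h, ← Ω.isHamiltonian_hamiltonian hf]

theorem bivector_mvfderiv {f g : M → ℝ} (hf : ContMDiff 𝓘(ℝ, E) 𝓘(ℝ, ℝ) ∞ f)
    (hg : ContMDiff 𝓘(ℝ, E) 𝓘(ℝ, ℝ) ∞ g) (x : M) :
    Ω.bivector x (mvfderiv 𝓘(ℝ, E) f x) (mvfderiv 𝓘(ℝ, E) g x) =
      Ω.form x (Ω.hamiltonian hf x) (Ω.hamiltonian hg x) := by
  simp [bivector_apply, hamiltonian_apply]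

/-- `ω([a_f, a_g], a_h) = ρ(a_f)(ω(a_g, a_h)) - ρ(a_g)(ω(a_f, a_h))` for Hamiltonian sections. -/
theorem form_bracket_hamiltonian {f g h : M → ℝ} (hf : ContMDiff 𝓘(ℝ, E) 𝓘(ℝ, ℝ) ∞ f)
    (hg : ContMDiff 𝓘(ℝ, E) 𝓘(ℝ, ℝ) ∞ g) (hh : ContMDiff 𝓘(ℝ, E) 𝓘(ℝ, ℝ) ∞ h) (x : M) :
    Ω.form x (𝒜.bracket (Ω.hamiltonian hf) (Ω.hamiltonian hg) x) (Ω.hamiltonian hh x) =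
      mvfderiv 𝓘(ℝ, E) (fun y ↦ Ω.form y (Ω.hamiltonian hg y) (Ω.hamiltonian hh y)) x
          (𝒜.anchor x (Ω.hamiltonian hf x)) -
        mvfderiv 𝓘(ℝ, E) (fun y ↦ Ω.form y (Ω.hamiltonian hf y) (Ω.hamiltonian hh y)) x
          (𝒜.anchor x (Ω.hamiltonian hg x)) := by
  have key : ∀ {k : M → ℝ} (hk : ContMDiff 𝓘(ℝ, E) 𝓘(ℝ, ℝ) ∞ k) (v : TangentSpace 𝓘(ℝ, E) x),
      mvfderiv 𝓘(ℝ, E) (fun y ↦ mvfderiv 𝓘(ℝ, E) h y (𝒜.anchor y (Ω.hamiltonian hk y))) x v =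
      -mvfderiv 𝓘(ℝ, E) (fun y ↦ Ω.form y (Ω.hamiltonian hk y) (Ω.hamiltonian hh y)) x v := by
    intro k hk v
    have e : (fun y ↦ mvfderiv 𝓘(ℝ, E) h y (𝒜.anchor y (Ω.hamiltonian hk y))) =
        -fun y ↦ Ω.form y (Ω.hamiltonian hk y) (Ω.hamiltonian hh y) := by
      ext y
      rw [Ω.isHamiltonian_hamiltonian hh, form_swap]
      rfl
    rw [e, mvfderiv_neg, _root_.neg_apply]
  -- The left side is -dh(ρ[a_f, a_g]), and ρ[a_f, a_g] acts on h as a commutator of vector fields.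
  rw [form_swap, ← Ω.isHamiltonian_hamiltonian hh, 𝒜.anchor_bracket, mvfderiv_mlieBracket hh
    (𝒜.mdifferentiableAt_anchor_apply _ x) (𝒜.mdifferentiableAt_anchor_apply _ x), key, key]
  ring

/-- The Poisson structure on the base of a symplectic Lie algebroid. -/
def poisson : PoissonStructure E M where
  bivector := Ω.bivector
  contMDiff α β := contMDiff_form_apply Ω.contMDiff (Ω.sharpSection α) (Ω.sharpSection β)
  alternating x α := Ω.alternating x _
  jacobi f g h hf hg hh x := by
    have key : ∀ {f g h : M → ℝ} (hf : ContMDiff 𝓘(ℝ, E) 𝓘(ℝ, ℝ) ∞ f)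
        (hg : ContMDiff 𝓘(ℝ, E) 𝓘(ℝ, ℝ) ∞ g) (hh : ContMDiff 𝓘(ℝ, E) 𝓘(ℝ, ℝ) ∞ h),
        Ω.bivector x (mvfderiv 𝓘(ℝ, E) f x) (mvfderiv 𝓘(ℝ, E)
          (fun y ↦ Ω.bivector y (mvfderiv 𝓘(ℝ, E) g y) (mvfderiv 𝓘(ℝ, E) h y)) x) =
        -mvfderiv 𝓘(ℝ, E) (fun y ↦ Ω.form y (Ω.hamiltonian hg y) (Ω.hamiltonian hh y)) x
          (𝒜.anchor x (Ω.hamiltonian hf x)) := by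
      intro f g h hf hg hh
      rw [bivector_eq, hamiltonian_apply, map_neg, map_neg, neg_neg]
      simp only [Ω.bivector_mvfderiv hg hh]
    have swap : ∀ {f g : M → ℝ} (hf : ContMDiff 𝓘(ℝ, E) 𝓘(ℝ, ℝ) ∞ f)
        (hg : ContMDiff 𝓘(ℝ, E) 𝓘(ℝ, ℝ) ∞ g) (v : TangentSpace 𝓘(ℝ, E) x),
        mvfderiv 𝓘(ℝ, E) (fun y ↦ Ω.form y (Ω.hamiltonian hf y) (Ω.hamiltonian hg y)) x v =
        -mvfderiv 𝓘(ℝ, E) (fun y ↦ Ω.form y (Ω.hamiltonian hg y) (Ω.hamiltonian hf y)) x v := by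
      intro f g hf hg v
      have e : (fun y ↦ Ω.form y (Ω.hamiltonian hf y) (Ω.hamiltonian hg y)) =
          -fun y ↦ Ω.form y (Ω.hamiltonian hg y) (Ω.hamiltonian hf y) := by
        ext y
        exact Ω.form_swap _ _
      rw [e, mvfderiv_neg, _root_.neg_apply]
    -- Let S be the cyclic sum of ρ(a_f)ω(a_g, a_h). The derivative terms of dω add up to S and the
    -- bracket terms to -2S, so closedness reads -S = 0; the Jacobi sum is -S.
    have h1 := Ω.closed (Ω.hamiltonian hf) (Ω.hamiltonian hg) (Ω.hamiltonian hh) x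
    rw [form_bracket_hamiltonian, form_bracket_hamiltonian, form_bracket_hamiltonian,
      swap hf hh, swap hh hg, swap hg hf] at h1
    rw [key hf hg hh, key hg hh hf, key hh hf hg]
    linarith

theorem isInducedBy_poisson : Ω.poisson.IsInducedBy Ω where
  existsUnique_hamiltonian f hf := ⟨Ω.hamiltonian hf, Ω.isHamiltonian_hamiltonian hf,
    fun _ hs ↦ hs.eq hf⟩
  bracket_eq f g hf hg a b ha hb x := by
    rw [ha.eq hf, hb.eq hg]
    exact Ω.bivector_mvfderiv hf hg x

/-- Every covector at x is a differential, so the brackets of functions determine the bivector. -/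
theorem _root_.PoissonStructure.IsInducedBy.bivector_eq [T2Space M] {P : PoissonStructure E M}
    (h : P.IsInducedBy Ω) (x : M) : P.bivector x = Ω.bivector x := by
  ext α β
  obtain ⟨f, hf, rfl⟩ := exists_mvfderiv_eq x α
  obtain ⟨g, hg, rfl⟩ := exists_mvfderiv_eq x β
  rw [h.bracket_eq f g hf hg _ _ (Ω.isHamiltonian_hamiltonian hf) (Ω.isHamiltonian_hamiltonian hg),
    Ω.bivector_mvfderiv hf hg]

theorem existsUnique_poisson [T2Space M] : ∃! P : PoissonStructure E M, P.IsInducedBy Ω := by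
  refine ⟨Ω.poisson, Ω.isInducedBy_poisson, fun P hP ↦ ?_⟩
  have e : P.bivector = Ω.poisson.bivector := funext hP.bivector_eq
  generalize Ω.poisson = Q at e
  cases P; cases Q
  congr

end SymplecticForm
end Sharp
end

/-! ### The cotangent Lie algebroid and the isomorphism with L^ω -/

noncomputable section

section Cotangent

variable {E : Type*} [NormedAddCommGroup E] [NormedSpace ℝ E] [FiniteDimensional ℝ E]
  {M : Type*} [TopologicalSpace M] [ChartedSpace E M] [IsManifold 𝓘(ℝ, E) ∞ M] [T2Space M]
  {F : Type*} [NormedAddCommGroup F] [NormedSpace ℝ F] [FiniteDimensional ℝ F]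
  {V : M → Type*} [TopologicalSpace (TotalSpace F V)]
  [∀ x, AddCommGroup (V x)] [∀ x, Module ℝ (V x)] [∀ x, TopologicalSpace (V x)]
  [∀ x, IsTopologicalAddGroup (V x)] [∀ x, ContinuousSMul ℝ (V x)]
  [FiberBundle F V] [VectorBundle ℝ F V] [ContMDiffVectorBundle ∞ F V 𝓘(ℝ, E)]
  {𝒜 : LieAlgebroid E F V} (Ω : SymplecticForm 𝒜)

namespace SymplecticForm

theorem mem_compl_isotropy {x : M} {a : V x} :
    a ∈ Ω.compl (𝒜.isotropy x) ↔ ∀ b, 𝒜.anchor x b = 0 → Ω.form x a b = 0 := Iff.rfl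

theorem sharp_mem_compl {x : M} (α : TangentSpace 𝓘(ℝ, E) x →L[ℝ] ℝ) :
    Ω.sharp x α ∈ Ω.compl (𝒜.isotropy x) := by
  rw [mem_compl_isotropy]
  intro b hb
  rw [form_sharp, hb, map_zero, neg_zero]

/-- The Lie algebroid differential of `ω` on the images of two 1-forms and a section. -/
theorem form_bracket_sharp
    (α β : Cₛ^∞⟮𝓘(ℝ, E); E →L[ℝ] ℝ, (fun x : M ↦ TangentSpace 𝓘(ℝ, E) x →L[ℝ] ℝ)⟯)
    (c : Cₛ^∞⟮𝓘(ℝ, E); F, V⟯) (x : M) :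
    -Ω.form x (𝒜.bracket (Ω.sharpSection α) (Ω.sharpSection β) x) (c x) =
      lieDerivOneForm (fun y ↦ 𝒜.anchor y (Ω.sharp y (α y))) β (fun y ↦ 𝒜.anchor y (c y)) x
        - lieDerivOneForm (fun y ↦ 𝒜.anchor y (Ω.sharp y (β y))) α (fun y ↦ 𝒜.anchor y (c y)) x
        - mvfderiv 𝓘(ℝ, E) (fun y ↦ Ω.bivector y (α y) (β y)) x (𝒜.anchor x (c x)) := by
  have key : ∀ (α : Cₛ^∞⟮𝓘(ℝ, E); E →L[ℝ] ℝ, (fun x : M ↦ TangentSpace 𝓘(ℝ, E) x →L[ℝ] ℝ)⟯)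
      (v : TangentSpace 𝓘(ℝ, E) x),
      mvfderiv 𝓘(ℝ, E) (fun y ↦ Ω.form y (Ω.sharpSection α y) (c y)) x v =
        -mvfderiv 𝓘(ℝ, E) (fun y ↦ α y (𝒜.anchor y (c y))) x v := by
    intro α v
    have e : (fun y ↦ Ω.form y (Ω.sharpSection α y) (c y)) =
        -fun y ↦ α y (𝒜.anchor y (c y)) := by
      ext y
      exact Ω.form_sharp _ _
    rw [e, mvfderiv_neg, _root_.neg_apply]
  have h := Ω.closed (Ω.sharpSection α) (Ω.sharpSection β) c x
  rw [key α, key β, Ω.form_swap (𝒜.bracket (Ω.sharpSection α) c x),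
    Ω.form_swap (𝒜.bracket (Ω.sharpSection β) c x)] at h
  simp only [sharpSection_apply, form_sharp, 𝒜.anchor_bracket] at h
  simp only [lieDerivOneForm, bivector_apply, form_sharp]
  linarith

/-- In `form_bracket_sharp` the right side depends on c only through ρ(c x). If that vanishes, c may
be exchanged for the zero section. -/
theorem bracket_sharp_mem_compl
    (α β : Cₛ^∞⟮𝓘(ℝ, E); E →L[ℝ] ℝ, (fun x : M ↦ TangentSpace 𝓘(ℝ, E) x →L[ℝ] ℝ)⟯) (x : M) :
    𝒜.bracket (Ω.sharpSection α) (Ω.sharpSection β) x ∈ Ω.compl (𝒜.isotropy x) := by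
  rw [mem_compl_isotropy]
  intro b hb
  obtain ⟨c, rfl⟩ := exists_section_eq (E := E) (F := F) x b
  have h0 : (fun y ↦ 𝒜.anchor y (c y)) x = (fun y ↦ 𝒜.anchor y ((0 : Cₛ^∞⟮𝓘(ℝ, E); F, V⟯) y)) x := by
    simpa using hb
  have h1 := Ω.form_bracket_sharp α β c x
  have h2 := Ω.form_bracket_sharp α β 0 x
  rw [lieDerivOneForm_congr _ β (𝒜.contMDiff_anchor_apply c) (𝒜.contMDiff_anchor_apply 0) h0,
    lieDerivOneForm_congr _ α (𝒜.contMDiff_anchor_apply c) (𝒜.contMDiff_anchor_apply 0) h0] at h1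
  simp only at h0
  rw [h0, ← h2, ContMDiffSection.zero_apply, map_zero, neg_zero, neg_eq_zero] at h1
  exact h1

theorem negPullContraction_apply {lam : ∀ x : M, TangentSpace 𝓘(ℝ, E) x →L[ℝ] V x} {x : M}
    (a : V x) (v : TangentSpace 𝓘(ℝ, E) x) :
    Ω.negPullContraction lam x a v = -Ω.form x a (lam x v) := rfl

variable {lam : ∀ x : M, TangentSpace 𝓘(ℝ, E) x →L[ℝ] V x}
  (hlam : ∀ x v, 𝒜.anchor x (lam x v) = v)

include hlam

theorem negPullContraction_sharp {x : M} (α : TangentSpace 𝓘(ℝ, E) x →L[ℝ] ℝ) :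
    Ω.negPullContraction lam x (Ω.sharp x α) = α := by
  ext v
  rw [negPullContraction_apply, form_sharp, neg_neg, hlam]

/-- The vector b - λ(ρ b) lies in L, so a in L^ω pairs equally with b and with λ(ρ b). -/
theorem sharp_negPullContraction {x : M} {a : V x} (ha : a ∈ Ω.compl (𝒜.isotropy x)) :
    Ω.sharp x (Ω.negPullContraction lam x a) = a := by
  rw [sharp_eq_iff]
  intro b
  rw [negPullContraction_apply, neg_neg]
  have h := Ω.mem_compl_isotropy.1 ha (b - lam x (𝒜.anchor x b)) (by rw [map_sub, hlam, sub_self])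
  rwa [map_sub, sub_eq_zero] at h

theorem sharp_injective (x : M) : Function.Injective (Ω.sharp x) :=
  Function.LeftInverse.injective (Ω.negPullContraction_sharp hlam)

/-- No smoothness of λ is assumed: ♯ carries ψ(s) to the smooth section s, and ♯ is smooth and
injective. -/
theorem contMDiffAt_negPullContraction {s : ∀ x, V x} {x₀ : M}
    (h : ∀ᶠ x in 𝓝 x₀, s x ∈ Ω.compl (𝒜.isotropy x))
    (hs : ContMDiffAt 𝓘(ℝ, E) (𝓘(ℝ, E).prod 𝓘(ℝ, F)) ∞ (fun x ↦ TotalSpace.mk' F x (s x)) x₀) :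
    ContMDiffAt 𝓘(ℝ, E) (𝓘(ℝ, E).prod 𝓘(ℝ, E →L[ℝ] ℝ)) ∞
      (fun x ↦ TotalSpace.mk' (E →L[ℝ] ℝ) (E := fun x : M ↦ TangentSpace 𝓘(ℝ, E) x →L[ℝ] ℝ) x
        (Ω.negPullContraction lam x (s x))) x₀ := by
  refine contMDiffAt_section_of_injective (V := fun x : M ↦ TangentSpace 𝓘(ℝ, E) x →L[ℝ] ℝ)
    (W := V) (Ω.contMDiffAt_sharp x₀) (Ω.sharp_injective hlam x₀) (hs.congr_of_eventuallyEq ?_)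
  filter_upwards [h] with x hx
  rw [Ω.sharp_negPullContraction hlam hx]

/-- The bracket of 1-forms for which `sharp` is bracket preserving. -/
def cotangentBracketFun
    (α β : Cₛ^∞⟮𝓘(ℝ, E); E →L[ℝ] ℝ, (fun x : M ↦ TangentSpace 𝓘(ℝ, E) x →L[ℝ] ℝ)⟯) :
    Cₛ^∞⟮𝓘(ℝ, E); E →L[ℝ] ℝ, (fun x : M ↦ TangentSpace 𝓘(ℝ, E) x →L[ℝ] ℝ)⟯ :=
  ⟨fun x ↦ Ω.negPullContraction lam x (𝒜.bracket (Ω.sharpSection α) (Ω.sharpSection β) x),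
    fun _ ↦ Ω.contMDiffAt_negPullContraction hlam
      (Eventually.of_forall (Ω.bracket_sharp_mem_compl α β))
      (𝒜.bracket (Ω.sharpSection α) (Ω.sharpSection β)).contMDiff.contMDiffAt⟩

theorem sharpSection_cotangentBracketFun
    (α β : Cₛ^∞⟮𝓘(ℝ, E); E →L[ℝ] ℝ, (fun x : M ↦ TangentSpace 𝓘(ℝ, E) x →L[ℝ] ℝ)⟯) :
    Ω.sharpSection (Ω.cotangentBracketFun hlam α β) =
      𝒜.bracket (Ω.sharpSection α) (Ω.sharpSection β) := by
  ext x
  exact Ω.sharp_negPullContraction hlam (Ω.bracket_sharp_mem_compl α β x)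

theorem sharpSection_injective : Function.Injective Ω.sharpSection := by
  intro α β h
  ext1 x
  exact Ω.sharp_injective hlam x (congrArg (fun s : Cₛ^∞⟮𝓘(ℝ, E); F, V⟯ ↦ s x) h)

omit hlam in
theorem sharpSection_add
    (α β : Cₛ^∞⟮𝓘(ℝ, E); E →L[ℝ] ℝ, (fun x : M ↦ TangentSpace 𝓘(ℝ, E) x →L[ℝ] ℝ)⟯) :
    Ω.sharpSection (α + β) = Ω.sharpSection α + Ω.sharpSection β := by
  ext x
  exact map_add (Ω.sharp x) (α x) (β x)

omit hlam in
theorem sharpSection_smul (r : ℝ)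
    (α : Cₛ^∞⟮𝓘(ℝ, E); E →L[ℝ] ℝ, (fun x : M ↦ TangentSpace 𝓘(ℝ, E) x →L[ℝ] ℝ)⟯) :
    Ω.sharpSection (r • α) = r • Ω.sharpSection α := by
  ext x
  exact map_smul (Ω.sharp x) r (α x)

/-- The cotangent Lie algebroid of the Poisson structure of a symplectic Lie algebroid with
surjective anchor. -/
def cotangent : LieAlgebroid E (E →L[ℝ] ℝ) (fun x : M ↦ TangentSpace 𝓘(ℝ, E) x →L[ℝ] ℝ) where
  anchor x := (𝒜.anchor x).comp (Ω.sharp x)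
  anchor_contMDiff x₀ :=
    contMDiffAt_hom_of_apply (V := fun x : M ↦ TangentSpace 𝓘(ℝ, E) x →L[ℝ] ℝ)
      (W := (TangentSpace 𝓘(ℝ, E) : M → Type _)) fun _ hα ↦
      𝒜.anchor_contMDiff.contMDiffAt.clm_bundle_apply
        ((Ω.contMDiffAt_sharp x₀).clm_bundle_apply hα)
  -- Bilinearity and the axioms on the bracket are checked after applying the injective ♯, where
  -- they hold in 𝒜.
  bracket := LinearMap.mk₂ ℝ (Ω.cotangentBracketFun hlam)
    (fun α α' β ↦ Ω.sharpSection_injective hlam (by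
      simp only [sharpSection_add, sharpSection_cotangentBracketFun, map_add, LinearMap.add_apply]))
    (fun r α β ↦ Ω.sharpSection_injective hlam (by
      simp only [sharpSection_smul, sharpSection_cotangentBracketFun, map_smul,
        LinearMap.smul_apply]))
    (fun α β β' ↦ Ω.sharpSection_injective hlam (by
      simp only [sharpSection_add, sharpSection_cotangentBracketFun, map_add]))
    (fun r α β ↦ Ω.sharpSection_injective hlam (by
      simp only [sharpSection_smul, sharpSection_cotangentBracketFun, map_smul]))
  bracket_self α := Ω.sharpSection_injective hlam (by
    rw [LinearMap.mk₂_apply, sharpSection_cotangentBracketFun, 𝒜.bracket_self]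
    ext x
    exact (map_zero (Ω.sharp x)).symm)
  jacobi α β γ := Ω.sharpSection_injective hlam (by
    simp only [LinearMap.mk₂_apply, sharpSection_add, sharpSection_cotangentBracketFun]
    exact 𝒜.jacobi _ _ _)
  anchor_bracket α β x := by
    have h := 𝒜.anchor_bracket (Ω.sharpSection α) (Ω.sharpSection β) x
    rw [← Ω.sharpSection_cotangentBracketFun hlam] at h
    exact h
  leibniz α β fβ f hf hfβ x := by
    apply Ω.sharp_injective hlam x
    have h := 𝒜.leibniz (Ω.sharpSection α) (Ω.sharpSection β) (Ω.sharpSection fβ) f hf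
      (fun y ↦ by rw [sharpSection_apply, hfβ, map_smul, sharpSection_apply]) x
    rw [← Ω.sharpSection_cotangentBracketFun hlam, ← Ω.sharpSection_cotangentBracketFun hlam] at h
    rw [map_add, map_smul, map_smul]
    exact h

theorem cotangent_bracket_apply
    (α β : Cₛ^∞⟮𝓘(ℝ, E); E →L[ℝ] ℝ, (fun x : M ↦ TangentSpace 𝓘(ℝ, E) x →L[ℝ] ℝ)⟯) (x : M) :
    (Ω.cotangent hlam).bracket α β x =
      Ω.negPullContraction lam x (𝒜.bracket (Ω.sharpSection α) (Ω.sharpSection β) x) := rfl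

/-- The bracket formula is evaluated on a smooth c that equals λ(X) only at x; tensoriality of the
Lie derivatives makes agreement at the point sufficient. -/
theorem isCotangent_cotangent {P : PoissonStructure E M} (hP : P.IsInducedBy Ω) :
    (Ω.cotangent hlam).IsCotangent P where
  anchor_eq x α β := by
    rw [hP.bivector_eq, bivector_eq]
    rfl
  bracket_eq α β X x := by
    obtain ⟨c, hc⟩ := exists_section_eq (E := E) (F := F) (V := V) x (lam x (X x))
    have h0 : (fun y ↦ 𝒜.anchor y (c y)) x = X x := by
      simp only [hc, hlam]
    have h1 := Ω.form_bracket_sharp α β c x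
    rw [lieDerivOneForm_congr _ β (𝒜.contMDiff_anchor_apply c) X.contMDiff h0,
      lieDerivOneForm_congr _ α (𝒜.contMDiff_anchor_apply c) X.contMDiff h0] at h1
    simp only at h0
    rw [h0, hc] at h1
    simp only [hP.bivector_eq]
    exact h1

omit hlam in
theorem _root_.LieAlgebroid.IsCotangent.eq
    {𝒞 𝒞' : LieAlgebroid E (E →L[ℝ] ℝ) (fun x : M ↦ TangentSpace 𝓘(ℝ, E) x →L[ℝ] ℝ)}
    {P : PoissonStructure E M} (h : 𝒞.IsCotangent P) (h' : 𝒞'.IsCotangent P) : 𝒞 = 𝒞' := by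
  have hanchor : ∀ x α, 𝒞.anchor x α = 𝒞'.anchor x α := fun x α ↦
    (SeparatingDual.eq_iff_forall_dual_eq (R := ℝ) (V := E)).2 fun β ↦
      (h.anchor_eq x α β).trans (h'.anchor_eq x α β).symm
  refine LieAlgebroid.ext hanchor fun α β x ↦ ?_
  ext v
  obtain ⟨X, rfl⟩ := exists_section_eq (E := E) (F := E)
    (V := (TangentSpace 𝓘(ℝ, E) : M → Type _)) x v
  rw [h.bracket_eq, h'.bracket_eq]
  simp only [hanchor]

theorem existsUnique_cotangent {P : PoissonStructure E M} (hP : P.IsInducedBy Ω) :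
    ∃! 𝒞 : LieAlgebroid E (E →L[ℝ] ℝ) (fun x : M ↦ TangentSpace 𝓘(ℝ, E) x →L[ℝ] ℝ),
      𝒞.IsCotangent P :=
  ⟨Ω.cotangent hlam, Ω.isCotangent_cotangent hlam hP,
    fun _ h ↦ h.eq (Ω.isCotangent_cotangent hlam hP)⟩

theorem linearIndependent_sharp {κ : Type*} {x : M} {e : κ → TangentSpace 𝓘(ℝ, E) x →L[ℝ] ℝ}
    (he : LinearIndependent ℝ e) : LinearIndependent ℝ fun i ↦ Ω.sharp x (e i) :=
  he.map' (Ω.sharp x : (TangentSpace 𝓘(ℝ, E) x →L[ℝ] ℝ) →ₗ[ℝ] V x)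
    (LinearMap.ker_eq_bot.2 (Ω.sharp_injective hlam x))

theorem span_sharp {κ : Type*} [Fintype κ] {x : M} {e : κ → TangentSpace 𝓘(ℝ, E) x →L[ℝ] ℝ}
    {c : κ → (TangentSpace 𝓘(ℝ, E) x →L[ℝ] ℝ) → ℝ} (h : ∀ α, ∑ i, c i α • e i = α) :
    Submodule.span ℝ (range fun i ↦ Ω.sharp x (e i)) = Ω.compl (𝒜.isotropy x) := by
  refine le_antisymm ?_ fun a ha ↦ ?_
  · rw [Submodule.span_le]
    rintro _ ⟨i, rfl⟩
    exact Ω.sharp_mem_compl _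
  · rw [← Ω.sharp_negPullContraction hlam ha, ← h (Ω.negPullContraction lam x a), map_sum]
    refine Submodule.sum_mem _ fun i _ ↦ ?_
    rw [map_smul]
    exact Submodule.smul_mem _ _ (Submodule.subset_span ⟨i, rfl⟩)

/-- A local frame of the cotangent bundle is carried by ♯ to a local frame of L^ω. -/
theorem isSmoothSubbundle_compl : IsSmoothSubbundle E F fun x ↦ Ω.compl (𝒜.isotropy x) := by
  intro x₀
  let B := (nonempty_localDualFrame (E := E) (F := E →L[ℝ] ℝ)
    (V := fun x : M ↦ TangentSpace 𝓘(ℝ, E) x →L[ℝ] ℝ) x₀).some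
  refine ⟨Module.finrank ℝ (E →L[ℝ] ℝ), fun i ↦ Ω.sharpSection (B.e i), ?_⟩
  filter_upwards [B.sum_c, B.linearIndependent] with x hx hli
  exact ⟨Ω.linearIndependent_sharp hlam hli, Ω.span_sharp hlam hx⟩

theorem exists_sharpSection_eq {s : Cₛ^∞⟮𝓘(ℝ, E); F, V⟯}
    (hs : ∀ x, s x ∈ Ω.compl (𝒜.isotropy x)) : ∃ α, Ω.sharpSection α = s := by
  refine ⟨⟨fun x ↦ Ω.negPullContraction lam x (s x), fun x ↦
    Ω.contMDiffAt_negPullContraction hlam (Eventually.of_forall hs) (s.contMDiff x)⟩, ?_⟩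
  ext x
  exact Ω.sharp_negPullContraction hlam (hs x)

/-- The `ω`-complement of the isotropy is a Lie subalgebroid, isomorphic to the cotangent Lie
algebroid of the base. -/
theorem isIsoOnSubalgebroid_negPullContraction {P : PoissonStructure E M} (hP : P.IsInducedBy Ω)
    {𝒞 : LieAlgebroid E (E →L[ℝ] ℝ) (fun x : M ↦ TangentSpace 𝓘(ℝ, E) x →L[ℝ] ℝ)}
    (h𝒞 : 𝒞.IsCotangent P) :
    𝒜.IsIsoOnSubalgebroid (fun x ↦ Ω.compl (𝒜.isotropy x)) 𝒞 (Ω.negPullContraction lam) := by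
  -- By uniqueness the cotangent algebroid is the transported one, whose bracket is ψ[♯α, ♯β] by
  -- definition.
  obtain rfl := h𝒞.eq (Ω.isCotangent_cotangent hlam hP)
  refine ⟨⟨Ω.isSmoothSubbundle_compl hlam, ?_⟩, ?_, ?_, ?_, ?_⟩
  · intro s t hs ht x
    obtain ⟨α, rfl⟩ := Ω.exists_sharpSection_eq hlam hs
    obtain ⟨β, rfl⟩ := Ω.exists_sharpSection_eq hlam ht
    exact Ω.bracket_sharp_mem_compl α β x
  · intro x
    refine ⟨fun a b hab ↦ Subtype.ext ?_, fun α ↦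
      ⟨⟨Ω.sharp x α, Ω.sharp_mem_compl α⟩, Ω.negPullContraction_sharp hlam α⟩⟩
    rw [← Ω.sharp_negPullContraction hlam a.2, ← Ω.sharp_negPullContraction hlam b.2]
    exact congrArg _ hab
  · intro U hU s hs
    refine ⟨fun h x hx ↦ ContMDiffAt.contMDiffWithinAt ?_,
      fun h x hx ↦ ContMDiffAt.contMDiffWithinAt ?_⟩
    · refine Ω.contMDiffAt_negPullContraction hlam ?_ (h.contMDiffAt (hU.mem_nhds hx))
      filter_upwards [hU.mem_nhds hx] with y hy using hs y hy
    · refine ((Ω.contMDiffAt_sharp x).clm_bundle_apply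
        (h.contMDiffAt (hU.mem_nhds hx))).congr_of_eventuallyEq ?_
      filter_upwards [hU.mem_nhds hx] with y hy
      rw [Ω.sharp_negPullContraction hlam (hs y hy)]
  · intro x a ha
    exact congrArg (𝒜.anchor x) (Ω.sharp_negPullContraction hlam ha)
  · intro s t hs ht α β hα hβ x
    have hα' : Ω.sharpSection α = s := by
      ext y
      rw [sharpSection_apply, hα, Ω.sharp_negPullContraction hlam (hs y)]
    have hβ' : Ω.sharpSection β = t := by
      ext y
      rw [sharpSection_apply, hβ, Ω.sharp_negPullContraction hlam (ht y)]
    rw [cotangent_bracket_apply, hα', hβ']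

end SymplecticForm
end Cotangent
end

/-! ### Linear algebra of the decomposition -/

noncomputable section

section Decomposition

variable {E : Type*} [NormedAddCommGroup E] [NormedSpace ℝ E]
  {M : Type*} [TopologicalSpace M] [ChartedSpace E M] [IsManifold 𝓘(ℝ, E) ∞ M]
  {F : Type*} [NormedAddCommGroup F] [NormedSpace ℝ F] [FiniteDimensional ℝ F]
  {V : M → Type*} [TopologicalSpace (TotalSpace F V)]
  [∀ x, AddCommGroup (V x)] [∀ x, Module ℝ (V x)] [∀ x, TopologicalSpace (V x)]
  [∀ x, IsTopologicalAddGroup (V x)] [∀ x, ContinuousSMul ℝ (V x)]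
  [FiberBundle F V] [VectorBundle ℝ F V] [ContMDiffVectorBundle ∞ F V 𝓘(ℝ, E)]
  {𝒜 : LieAlgebroid E F V}

theorem SymplecticForm.finrank_compl [FiniteDimensional ℝ E] (Ω : SymplecticForm 𝒜) {x : M}
    (S : Submodule ℝ (V x)) :
    Module.finrank ℝ (Ω.compl S) + Module.finrank ℝ S = Module.finrank ℝ (V x) := by
  have := VectorBundle.finiteDimensional ℝ F V x
  have e : Ω.compl S = (Ω.bilinForm x).orthogonal S := by
    ext a
    rw [LinearMap.BilinForm.mem_orthogonal_iff]
    refine forall₂_congr fun b _ ↦ ?_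
    rw [Ω.bilinForm_apply, Ω.form_swap, neg_eq_zero]
  rw [e, LinearMap.BilinForm.finrank_orthogonal (Ω.bilinForm_nondegenerate x),
    Nat.sub_add_cancel (Submodule.finrank_le S)]

namespace CompatibleTriple

variable (T : CompatibleTriple 𝒜) {x : M}

theorem eq_zero_of_inner_self {a : V x} (h : T.g.inner x a a = 0) : a = 0 := by
  by_contra ha
  exact (T.g.pos x a ha).ne' h

/-- Positivity of this expression is what makes the intersections involving E¹ or E² trivial. -/
theorem form_J_self (a : V x) : T.Ω.form x (T.J x a) a = T.g.inner x a a := by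
  rw [T.Ω.form_swap, T.form_eq, T.J_J, map_neg, neg_neg]

theorem eq_zero_of_form_J {a : V x} (h : T.Ω.form x (T.J x a) a = 0) : a = 0 :=
  T.eq_zero_of_inner_self (by rw [← form_J_self, h])

theorem J_mem_E1 {a : V x} (ha : a ∈ T.L1 x) : T.J x a ∈ T.E1 x := Submodule.mem_map_of_mem ha

theorem disjoint_isotropy_E1 : Disjoint (𝒜.isotropy x) (T.E1 x) := by
  rw [Submodule.disjoint_def]
  rintro _ hL ⟨l, hl, rfl⟩
  have h : T.Ω.form x (T.J x l) l = 0 := by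
    rw [T.Ω.form_swap]
    exact neg_eq_zero.2 (hl.2 _ hL)
  rw [T.eq_zero_of_form_J h]
  exact map_zero _

theorem disjoint_E1_E2 : Disjoint (T.E1 x) (T.E2 x) := by
  rw [Submodule.disjoint_def]
  rintro _ ⟨l, hl, rfl⟩ hE2
  have h : T.Ω.form x (T.J x l) l = 0 := hE2 l (Submodule.mem_sup_left hl.1)
  rw [T.eq_zero_of_form_J h]
  exact map_zero _

theorem disjoint_E2_L1 : Disjoint (T.E2 x) (T.L1 x) := by
  rw [Submodule.disjoint_def]
  intro f hE2 hL1
  refine T.eq_zero_of_form_J ?_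
  rw [T.Ω.form_swap, hE2 _ (Submodule.mem_sup_right (T.J_mem_E1 hL1)), neg_zero]

/-- Pair Jl + f in L with l in L¹: the result is 0, and f contributes nothing since l is in L, so
g(l, l) = 0. What remains is f in E² ∩ L, which lies in E² ∩ L¹ = 0. -/
theorem disjoint_E_isotropy : Disjoint (T.E1 x ⊔ T.E2 x) (𝒜.isotropy x) := by
  rw [Submodule.disjoint_def]
  intro a ha hL
  obtain ⟨_, ⟨l, hl, rfl⟩, f, hf, rfl⟩ := Submodule.mem_sup.1 ha
  have h1 : T.Ω.form x (T.J x l + f) l = 0 := by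
    rw [T.Ω.form_swap]
    exact neg_eq_zero.2 (hl.2 _ hL)
  rw [map_add, _root_.add_apply, hf l (Submodule.mem_sup_left hl.1), add_zero] at h1
  obtain rfl := T.eq_zero_of_form_J h1
  have e : (T.J x : V x →ₗ[ℝ] V x) 0 + f = f := by rw [map_zero, zero_add]
  rw [e] at hL ⊢
  exact (Submodule.disjoint_def.1 T.disjoint_E2_L1) f hf
    ⟨hL, fun b hb ↦ hf b (Submodule.mem_sup_left hb)⟩

theorem J_injective : Function.Injective (T.J x : V x →ₗ[ℝ] V x) := by
  intro a b h
  have h' : T.J x (T.J x a) = T.J x (T.J x b) := congrArg (T.J x) h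
  rwa [T.J_J, T.J_J, neg_inj] at h'

theorem finrank_E1 : Module.finrank ℝ (T.E1 x) = Module.finrank ℝ (T.L1 x) :=
  (Submodule.equivMapOfInjective _ T.J_injective _).finrank_eq.symm

theorem finrank_E2 [FiniteDimensional ℝ E] : Module.finrank ℝ (T.E2 x) +
    (Module.finrank ℝ (𝒜.isotropy x) + Module.finrank ℝ (T.L1 x)) = Module.finrank ℝ (V x) := by
  have := VectorBundle.finiteDimensional ℝ F V x
  have h1 := T.Ω.finrank_compl (𝒜.isotropy x ⊔ T.E1 x)
  have h2 := Submodule.finrank_sup_add_finrank_inf_eq (𝒜.isotropy x) (T.E1 x)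
  rw [T.disjoint_isotropy_E1.eq_bot, finrank_bot, add_zero, finrank_E1] at h2
  rwa [h2] at h1

/-- Besides disjointness this is a count: dim E¹ = dim L¹ and dim E² = dim V - dim L - dim L¹. -/
theorem isCompl_E_isotropy [FiniteDimensional ℝ E] :
    IsCompl (T.E1 x ⊔ T.E2 x) (𝒜.isotropy x) := by
  have := VectorBundle.finiteDimensional ℝ F V x
  refine ⟨T.disjoint_E_isotropy, codisjoint_iff.2 (Submodule.eq_top_of_finrank_eq ?_)⟩
  have h1 := Submodule.finrank_sup_add_finrank_inf_eq (T.E1 x ⊔ T.E2 x) (𝒜.isotropy x)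
  have h2 := Submodule.finrank_sup_add_finrank_inf_eq (T.E1 x) (T.E2 x)
  rw [T.disjoint_E_isotropy.eq_bot, finrank_bot] at h1
  rw [T.disjoint_E1_E2.eq_bot, finrank_bot, finrank_E1] at h2
  have h3 := T.finrank_E2 (x := x)
  omega

/-- `E² + L¹` is the `ω`-complement of `L`. -/
theorem E2_sup_L1 [FiniteDimensional ℝ E] : T.E2 x ⊔ T.L1 x = T.Ω.compl (𝒜.isotropy x) := by
  have := VectorBundle.finiteDimensional ℝ F V x
  refine Submodule.eq_of_le_of_finrank_eq (sup_le
    (fun a ha b hb ↦ ha b (Submodule.mem_sup_left hb)) inf_le_right) ?_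
  -- Both sides have dimension dim V - dim L.
  have h1 := T.Ω.finrank_compl (𝒜.isotropy x)
  have h2 := Submodule.finrank_sup_add_finrank_inf_eq (T.E2 x) (T.L1 x)
  rw [T.disjoint_E2_L1.eq_bot, finrank_bot] at h2
  have h3 := T.finrank_E2 (x := x)
  omega

theorem disjoint_L1_L2 : Disjoint (T.L1 x) (T.L2 x) := by
  rw [Submodule.disjoint_def]
  exact fun a h1 h2 ↦ T.eq_zero_of_inner_self (h2.2 a h1)

/-- The modular law applied to V = L¹ ⊕ (L¹)^⊥ and L¹ ≤ L. -/
theorem L1_sup_L2 : T.L1 x ⊔ T.L2 x = 𝒜.isotropy x := by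
  have := VectorBundle.finiteDimensional ℝ F V x
  let B : LinearMap.BilinForm ℝ (V x) :=
    LinearMap.mk₂ ℝ (fun a b ↦ T.g.inner x a b) (fun a a' b ↦ by simp) (fun r a b ↦ by simp)
      (fun a b b' ↦ by simp) (fun r a b ↦ by simp)
  have hB : B.IsRefl := fun a b h ↦ (T.g.symm x b a).trans h
  have hmem : ∀ {a}, a ∈ B.orthogonal (T.L1 x) ↔ ∀ b ∈ T.L1 x, T.g.inner x b a = 0 := Iff.rfl
  have hc : IsCompl (T.L1 x) (B.orthogonal (T.L1 x)) := by
    rw [LinearMap.BilinForm.isCompl_orthogonal_iff_disjoint hB, Submodule.disjoint_def]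
    exact fun a h1 h2 ↦ T.eq_zero_of_inner_self (hmem.1 h2 a h1)
  have hL2 : T.L2 x = B.orthogonal (T.L1 x) ⊓ 𝒜.isotropy x := by
    ext a
    refine ⟨fun h ↦ ⟨hmem.2 fun b hb ↦ ?_, h.1⟩, fun h ↦ ⟨h.2, fun b hb ↦ ?_⟩⟩
    · rw [T.g.symm, h.2 b hb]
    · rw [T.g.symm, hmem.1 h.1 b hb]
  rw [hL2, ← sup_inf_assoc_of_le _ (show T.L1 x ≤ 𝒜.isotropy x from inf_le_left), hc.sup_eq_top, top_inf_eq]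

theorem hasDecomposition [FiniteDimensional ℝ E] (x : M) : T.HasDecomposition x where
  disjoint_E := T.disjoint_E1_E2
  disjoint_L := T.disjoint_L1_L2
  sup_L := T.L1_sup_L2
  isCompl := T.isCompl_E_isotropy

end CompatibleTriple
end Decomposition

/-! ### The splitting and the main theorem -/

section Main

variable {E : Type*} [NormedAddCommGroup E] [NormedSpace ℝ E] [FiniteDimensional ℝ E]
  {M : Type u} [TopologicalSpace M] [ChartedSpace E M] [IsManifold 𝓘(ℝ, E) ∞ M] [T2Space M]
  {F : Type*} [NormedAddCommGroup F] [NormedSpace ℝ F] [FiniteDimensional ℝ F]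
  {V : M → Type*} [TopologicalSpace (TotalSpace F V)]
  [∀ x, AddCommGroup (V x)] [∀ x, Module ℝ (V x)] [∀ x, TopologicalSpace (V x)]
  [∀ x, IsTopologicalAddGroup (V x)] [∀ x, ContinuousSMul ℝ (V x)]
  [FiberBundle F V] [VectorBundle ℝ F V] [ContMDiffVectorBundle ∞ F V 𝓘(ℝ, E)]
  {E' : Type*} [NormedAddCommGroup E'] [NormedSpace ℝ E'] [FiniteDimensional ℝ E']
  {N : Type v} [TopologicalSpace N] [ChartedSpace E' N] [IsManifold 𝓘(ℝ, E') ∞ N] [T2Space N]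
  {ι : C^∞⟮𝓘(ℝ, E'), N; 𝓘(ℝ, E), M⟯} {𝒜 : LieAlgebroid E F V}
  {𝒜N : LieAlgebroid E' F (ι *ᵖ V)}

namespace LieAlgebroid.IsRestriction

variable (h𝒜N : 𝒜.IsRestriction ι 𝒜N) (h𝒜 : 𝒜.IsIntegralSubmanifold ι)

include h𝒜N h𝒜

theorem anchor_surjective (x : N) : Function.Surjective (𝒜N.anchor x) := by
  intro v
  obtain ⟨a, ha⟩ : mfderiv 𝓘(ℝ, E') 𝓘(ℝ, E) ι x v ∈ range (𝒜.anchor (ι x)) := by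
    rw [← h𝒜.tangent x]
    exact mem_range_self v
  exact ⟨a, h𝒜.immersion x ((h𝒜N.anchor_eq x a).trans ha)⟩

theorem isotropy_eq (x : N) : 𝒜N.isotropy x = 𝒜.isotropy (ι x) := by
  ext a
  change 𝒜N.anchor x a = 0 ↔ 𝒜.anchor (ι x) a = 0
  rw [← h𝒜N.anchor_eq]
  exact ⟨fun h ↦ by rw [h, map_zero], fun h ↦ h𝒜.immersion x (by rw [h, map_zero])⟩

/-- Take any right inverse of the anchor and project it onto E¹ + E² along L, which changes it only
by elements of the kernel. Two splittings differ by vectors in (E¹ + E²) ∩ L = 0. -/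
theorem existsUnique_isSplitting (T : CompatibleTriple 𝒜) :
    ∃! lam : ∀ x : N, TangentSpace 𝓘(ℝ, E') x →L[ℝ] (ι *ᵖ V) x, T.IsSplitting ι 𝒜N lam := by
  have hc : ∀ x : N, IsCompl (T.E1 (ι x) ⊔ T.E2 (ι x) : Submodule ℝ ((ι *ᵖ V) x))
      (𝒜N.isotropy x) := fun x ↦ by
    rw [h𝒜N.isotropy_eq h𝒜]
    exact T.isCompl_E_isotropy
  have huniq : ∀ (x : N) (a b : (ι *ᵖ V) x), a ∈ T.E1 (ι x) ⊔ T.E2 (ι x) →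
      b ∈ T.E1 (ι x) ⊔ T.E2 (ι x) → 𝒜N.anchor x a = 𝒜N.anchor x b → a = b := by
    intro x a b ha hb hab
    rw [← sub_eq_zero]
    refine Submodule.disjoint_def.1 (hc x).disjoint _ (Submodule.sub_mem _ ha hb) ?_
    change 𝒜N.anchor x (a - b) = 0
    rw [map_sub, hab, sub_self]
  have hex : ∀ x : N, ∃ l : TangentSpace 𝓘(ℝ, E') x →L[ℝ] (ι *ᵖ V) x, ∀ v,
      l v ∈ T.E1 (ι x) ⊔ T.E2 (ι x) ∧ 𝒜N.anchor x (l v) = v := by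
    intro x
    obtain ⟨σ, hσ⟩ := LinearMap.exists_rightInverse_of_surjective
      (𝒜N.anchor x : (ι *ᵖ V) x →ₗ[ℝ] TangentSpace 𝓘(ℝ, E') x)
      (LinearMap.range_eq_top.2 (h𝒜N.anchor_surjective h𝒜 x))
    let p := (T.E1 (ι x) ⊔ T.E2 (ι x) : Submodule ℝ ((ι *ᵖ V) x)).subtype ∘ₗ
      Submodule.projectionOnto _ _ (hc x) ∘ₗ σ
    have : T2Space (TangentSpace 𝓘(ℝ, E') x) := inferInstanceAs (T2Space E')
    have : FiniteDimensional ℝ (TangentSpace 𝓘(ℝ, E') x) :=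
      inferInstanceAs (FiniteDimensional ℝ E')
    refine ⟨LinearMap.toContinuousLinearMap p, fun v ↦ ⟨Submodule.coe_mem _, ?_⟩⟩
    have h1 : σ v - p v ∈ 𝒜N.isotropy x := by
      rw [← Submodule.ker_projectionOnto (hc x), LinearMap.mem_ker, map_sub, sub_eq_zero]
      exact (Submodule.projectionOnto_apply_left (hc x) _).symm
    have h2 : 𝒜N.anchor x (σ v) = v := LinearMap.congr_fun hσ v
    have h3 : 𝒜N.anchor x (σ v - p v) = 0 := h1
    rw [map_sub, h2, sub_eq_zero] at h3
    exact h3.symm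
  choose l hl using hex
  exact ⟨l, hl, fun l' hl' ↦ funext fun x ↦ ContinuousLinearMap.ext fun v ↦
    huniq x _ _ (hl' x v).1 (hl x v).1 ((hl' x v).2.trans (hl x v).2.symm)⟩

end LieAlgebroid.IsRestriction
end Main
end

theorem mainTheorem3
    {E : Type*} [NormedAddCommGroup E] [NormedSpace ℝ E] [FiniteDimensional ℝ E]
    {M : Type u} [TopologicalSpace M] [ChartedSpace E M] [IsManifold 𝓘(ℝ, E) ∞ M]
    [T2Space M] [SecondCountableTopology M]
    {F : Type*} [NormedAddCommGroup F] [NormedSpace ℝ F] [FiniteDimensional ℝ F]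
    {V : M → Type*} [TopologicalSpace (TotalSpace F V)]
    [∀ x, AddCommGroup (V x)] [∀ x, Module ℝ (V x)] [∀ x, TopologicalSpace (V x)]
    [∀ x, IsTopologicalAddGroup (V x)] [∀ x, ContinuousSMul ℝ (V x)]
    [FiberBundle F V] [VectorBundle ℝ F V] [ContMDiffVectorBundle ∞ F V 𝓘(ℝ, E)]
    {E' : Type*} [NormedAddCommGroup E'] [NormedSpace ℝ E'] [FiniteDimensional ℝ E']
    {N : Type v} [TopologicalSpace N] [ChartedSpace E' N] [IsManifold 𝓘(ℝ, E') ∞ N]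
    [T2Space N] [SecondCountableTopology N]
    (𝒜 : LieAlgebroid E F V) (T : CompatibleTriple 𝒜)
    (ι : C^∞⟮𝓘(ℝ, E'), N; 𝓘(ℝ, E), M⟯) (hι : 𝒜.IsLeaf ι) :
    (∀ p : M, T.HasDecomposition p) ∧
    -- the restricted Lie algebroid `𝒜_N`
    (∃! 𝒜N : LieAlgebroid E' F (ι *ᵖ V), 𝒜.IsRestriction ι 𝒜N) ∧
    ∀ 𝒜N : LieAlgebroid E' F (ι *ᵖ V), 𝒜.IsRestriction ι 𝒜N →
      -- the restricted symplectic form `ω_N`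
      (∃! ωN : SymplecticForm 𝒜N, ∀ x, ωN.form x = T.Ω.form (ι x)) ∧
      ∀ ωN : SymplecticForm 𝒜N, (∀ x, ωN.form x = T.Ω.form (ι x)) →
        -- the induced Poisson structure on `N` and its cotangent Lie algebroid
        (∃! P : PoissonStructure E' N, P.IsInducedBy ωN) ∧
        ∀ P : PoissonStructure E' N, P.IsInducedBy ωN →
          (∃! 𝒞 : LieAlgebroid E' (E' →L[ℝ] ℝ) (fun x : N ↦ TangentSpace 𝓘(ℝ, E') x →L[ℝ] ℝ),
            𝒞.IsCotangent P) ∧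
          ∀ 𝒞 : LieAlgebroid E' (E' →L[ℝ] ℝ) (fun x : N ↦ TangentSpace 𝓘(ℝ, E') x →L[ℝ] ℝ),
            𝒞.IsCotangent P →
            -- the splitting `λ`, and the isomorphism `a ↦ -λ^*(i_a ω)`
            (∃! lam : ∀ x : N, TangentSpace 𝓘(ℝ, E') x →L[ℝ] (ι *ᵖ V) x,
              T.IsSplitting ι 𝒜N lam) ∧
            ∀ lam : ∀ x : N, TangentSpace 𝓘(ℝ, E') x →L[ℝ] (ι *ᵖ V) x,
              T.IsSplitting ι 𝒜N lam →
              𝒜N.IsIsoOnSubalgebroid (T.restrictedE2L1 ι) 𝒞 (ωN.negPullContraction lam) := by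
  have h𝒜 := hι.integral
  refine ⟨T.hasDecomposition, ⟨h𝒜.restrict, h𝒜.isRestriction_restrict,
    fun 𝒜N h ↦ h.eq h𝒜 h𝒜.isRestriction_restrict⟩, fun 𝒜N h𝒜N ↦ ⟨⟨T.Ω.restrict h𝒜N, fun _ ↦ rfl,
    fun ωN h ↦ SymplecticForm.ext h⟩, fun ωN hωN ↦ ⟨ωN.existsUnique_poisson, fun P hP ↦ ?_⟩⟩⟩
  -- Constructing the cotangent algebroid already requires some right inverse of the anchor.
  obtain ⟨l, hl, -⟩ := h𝒜N.existsUnique_isSplitting h𝒜 T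
  refine ⟨ωN.existsUnique_cotangent (fun x v ↦ (hl x v).2) hP, fun 𝒞 h𝒞 ↦
    ⟨h𝒜N.existsUnique_isSplitting h𝒜 T, fun lam hlam ↦ ?_⟩⟩
  -- Replacing E² + L¹ by L^ω removes J and g from the rest of the argument.
  have hS : T.restrictedE2L1 ι = fun x ↦ ωN.compl (𝒜N.isotropy x) := by
    funext x
    have h1 : T.restrictedE2L1 ι x = T.Ω.compl (𝒜.isotropy (ι x)) := T.E2_sup_L1
    rw [h1, h𝒜N.isotropy_eq h𝒜]
    ext a
    change _ ↔ ∀ b ∈ 𝒜.isotropy (ι x), ωN.form x a b = 0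
    rw [hωN]
    rfl
  rw [hS]
  exact ωN.isIsoOnSubalgebroid_negPullContraction (fun x v ↦ (hlam x v).2) hP h𝒞
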